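/- **Setting.** For a finite set $V$ of quantum variables (from $r_0,r_1,\dots$) let $\mathcal H(V)=\mathbb C^{\{0,1\}^V}$ with standard basis $\{|a\rangle : a\in\{0,1\}^V\}$. A *quantum register* is a unit vector of $\mathcal H(V)$. An *$n$-qubit gate* ($n\ge 1$) is a unitary operator on $\mathbb C^{2^n}$ that maps vectors with polynomial-time computable complex coordinates to such vectors. Fix a one-to-one enumeration $(\mathbf U_i)_{i<\omega}$ of all gates, with a symbol $U_i$ for each. For a $k$-qubit gate $\mathbf U$ and distinct $q_1,\dots,q_k\in V$, $\mathbf U_{\langle\langle q_1,\dots,q_k\rangle\rangle}$ is the operator on $\mathcal H(V)$ that acts as $\mathbf U$ on $q_1,\dots,q_k$ (in this order) and as the identity on the other variables. **Circuits.** A circuit is a finite sequence $K=U_{i_1},\vec q_1,\dots,U_{i_l},\vec q_l$, where $\vec q_j$ is a tuple of distinct quantum variables whose length is the arity of $\mathbf U_{i_j}$. It is based on a set $\mathcal G$ of gates if all $\mathbf U_{i_j}\in\mathcal G$, and it is a $V$-circuit if all its variables are in $V$; then it determines $U_K=(\mathbf U_{i_l})_{\langle\langle\vec q_l\rangle\rangle}\circ\dots\circ(\mathbf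 U_{i_1})_{\langle\langle\vec q_1\rangle\rangle}$ on $\mathcal H(V)$. Let $(\mathbf K_i)_{i<\omega}$ be an effective enumeration of all circuits (computable as a function from $i$ to the finite sequence of gate indices and variable indices). A *family of circuits generated by $\mathcal G$* is a triple $(f,g,h)$ of total computable functions $f,h:\mathbb N\to\mathbb N$, $g:\mathbb N\times\mathbb N\to\mathbb N$ such that $0\le g(n,i)\le n+1$ whenever $1\le i\le f(n)$, and $\mathbf K_{h(n)}$ is an $\{r_1,\dots,r_{f(n)}\}$-circuit based on $\mathcal G$ for every $n$. It is *finitely generated* if it is generated by some finite $\mathcal G$. **The $\mathsf Q$-calculus.** Terms, modulo $\alpha$-conversion, are $$M::=x\mid r\mid {!M}\mid 0\mid 1\mid U_i\mid \mathtt{new}(M)\mid M_1M_2\mid\langle M_1,\dots,M_n\rangle\mid\lambda!x.M\mid\lambda\pi.M\qquad(n\ge2),$$ where $x$ is a classical variable, $r$ a quantum variable, and the pattern $\pi$ is $x$ or $\langle x_1,\dots,x_n\rangle$ with $n\ge 2$. $\mathcal Q(M)$ is the set of quantum variables of $M$. An environment is a multiset of patterns, items $!x$, and quantum variables, in which no name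 occurs twice; commas denote (disjoint) union and $!\Gamma$ denotes an environment of items $!x$ only. Judgements are derived by the rules: $\vdash 0$, $\vdash 1$, $\vdash U_i$; $r\vdash r$; $x\vdash x$; from $\Gamma\vdash M$ infer $\Gamma,!x\vdash M$; from $\Gamma,!x,!y\vdash M$ infer $\Gamma,!z\vdash M\{z/x,z/y\}$; from $!\Gamma\vdash M$ infer $!\Gamma\vdash{!M}$; from $\Gamma,x\vdash M$ infer $\Gamma,!x\vdash M$; from $\Gamma,x_1,\dots,x_k\vdash M$ infer $\Gamma,\langle x_1,\dots,x_k\rangle\vdash M$; from $\Gamma_i\vdash M_i$ ($i\le k$) infer $\Gamma_1,\dots,\Gamma_k\vdash\langle M_1,\dots,M_k\rangle$; from $\Gamma\vdash M$ infer $\Gamma\vdash\mathtt{new}(M)$; from $\Gamma,\pi\vdash M$ infer $\Gamma\vdash\lambda\pi.M$; from $\Gamma,!x\vdash M$ infer $\Gamma\vdash\lambda!x.M$; from $\Gamma_1\vdash M_1$ and $\Gamma_2\vdash M_2$ infer $\Gamma_1,\Gamma_2\vdash M_1M_2$. The term $M$ is *well formed* if $\mathcal Q(M)\vdash M$ is derivable.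 A configuration $[Q,V,M]$ consists of a finite $V\supseteq\mathcal Q(M)$, $Q\in\mathcal H(V)$ and a term $M$, modulo bijective renaming of the quantum variables; $[Q,M]$ is $[Q,\mathcal Q(M),M]$. Reduction $\to$ is the closure, under all term contexts except those of the form $!M$, of - $[Q,V,U_i\langle q_1,\dots,q_k\rangle]\to[(\mathbf U_i)_{\langle\langle q_1,\dots,q_k\rangle\rangle}Q,V,\langle q_1,\dots,q_k\rangle]$, for $\mathbf U_i$ a $k$-qubit gate and $q_1,\dots,q_k$ distinct quantum variables (for $k=1$, $\langle q\rangle$ is $q$); - $[Q,V,\mathtt{new}(c)]\to[Q\otimes|r\mapsto c\rangle,V\cup\{r\},r]$, for $c\in\{0,1\}$ and $r\notin V$; - and, with $Q$ and $V$ unchanged: $(\lambda x.M)N\to M\{N/x\}$; $(\lambda\langle x_1,\dots,x_n\rangle.M)\langle q_1,\dots,q_n\rangle\to M\{q_1/x_1,\dots,q_n/x_n\}$ for quantum variables $q_i$; $(\lambda!x.M)!N\to M\{N/x\}$; $L((\lambda\pi.M)N)\to(\lambda\pi.LM)N$; $((\lambda\pi.M)N)L\to(\lambda\pi.ML)N$,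 where in the last two $L$ has no free variable in $\pi$. $C\Downarrow C'$ means that $C\to^*C'$ and that $C'$ has no reduct. Lists are $[\,]=\lambda!x.\lambda!y.y$ and $[M,M_1,\dots,M_n]=\lambda!x.\lambda!y.x\,M\,[M_1,\dots,M_n]$. A term $M$ is *quantum relevant* if it is well formed and for all $n\ge0$ and $c_1,\dots,c_n\in\{0,1\}$ there are a natural number $m$ and a quantum register $Q$ with $[1,M\,![!c_1,\dots,!c_n]]\Downarrow[Q,[r_1,\dots,r_m]]$, where $1\in\mathcal H(\emptyset)=\mathbb C$. **Theorem.** For every finitely generated family of circuits $(f,g,h)$ there is a quantum relevant term $M$ such that for all $n\ge 0$, all $c_1,\dots,c_n\in\{0,1\}$, all $m\ge 0$ and all $Q\in\mathcal H(\{r_1,\dots,r_m\})$, $$[1,M\,![!c_1,\dots,!c_n]]\Downarrow[Q,[r_1,\dots,r_m]]$$ if and only if $m=f(n)$ and $$Q=U_{\mathbf K_{h(n)}}\bigl(|r_1\mapsto c_{g(n,1)},\dots,r_{f(n)}\mapsto c_{g(n,f(n))}\rangle\bigr),$$ where $c_0=0$ and $c_{n+1}=1$. -/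

import Mathlib

open scoped BigOperators

noncomputable section

namespace QCalc

/-! ### Computable unitary operators -/

/-- Binary notation of an integer: a sign bit followed by the binary digits of `|m|`. -/
def encodeInt (m : ℤ) : List Bool :=
  decide (m < 0) :: Computability.encodeNat m.natAbs

/-- Polynomial-time computable reals: a Turing machine which on input `1ⁿ` outputs, in time
polynomial in `n`, the binary notation of an integer `m` with `|m / 2ⁿ - x| ≤ 1 / 2ⁿ`. -/
def IsPolyReal (x : ℝ) : Prop :=
  ∃ a : ℕ → ℤ,
    Nonempty (Turing.TM2ComputableInPolyTime Computability.unaryEncodeNat encodeInt a) ∧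
    ∀ n : ℕ, |(a n : ℝ) / 2 ^ n - x| ≤ 1 / 2 ^ n

/-- Polynomial-time computable complex numbers. -/
def IsPolyComplex (z : ℂ) : Prop :=
  IsPolyReal z.re ∧ IsPolyReal z.im

/-- A qubit gate: a computable unitary operator on `ℂ^(2ⁿ)`, `n ≥ 1`. The standard basis of
`ℂ^(2ⁿ)` is indexed by the bit strings of length `n`. -/
structure Gate where
  arity : ℕ
  arity_pos : 0 < arity
  op : Matrix (Fin arity → Bool) (Fin arity → Bool) ℂ
  unitary : op ∈ Matrix.unitaryGroup (Fin arity → Bool) ℂ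
  computable : ∀ v : (Fin arity → Bool) → ℂ,
    (∀ b, IsPolyComplex (v b)) → ∀ b, IsPolyComplex (op.mulVec v b)

/-! ### Registers -/

/-- The space `H(V)` of functions `{0,1}^V → ℂ`, for a finite set `V` of quantum variables;
the quantum variable `r_i` is represented by its index `i`. -/
abbrev HSpace (V : Finset ℕ) : Type := (V → Bool) → ℂ

/-- A quantum register is a normalized vector of `H(V)`. -/
def IsRegister {V : Finset ℕ} (φ : HSpace V) : Prop :=
  ∑ f, ‖φ f‖ ^ 2 = 1

/-- The vector `|f⟩` of the standard basis of `H(V)`. -/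
def ket {V : Finset ℕ} (f : V → Bool) : HSpace V :=
  fun g => if g = f then 1 else 0

/-- `φ ⊗ |r ↦ c⟩`, an element of `H(V ∪ {r})`, for `r ∉ V`. -/
def extendReg {V : Finset ℕ} (φ : HSpace V) (r : ℕ) (c : Bool) : HSpace (insert r V) :=
  fun f =>
    if f ⟨r, Finset.mem_insert_self r V⟩ = c then
      φ (fun v => f ⟨v.1, Finset.mem_insert_of_mem v.2⟩)
    else 0

/-- The bit that `f : V → {0,1}` assigns to the name `r` (it is used for `r ∈ V` only). -/
def bitAt {V : Finset ℕ} (f : V → Bool) (r : ℕ) : Bool :=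
  if h : r ∈ V then f ⟨r, h⟩ else false

/-- The operator `G_⟨⟨r_1,…,r_k⟩⟩` on `H(V)`, for a `k`-qubit gate `G` and a list `rs` of `k`
distinct elements of `V`: its matrix entry at `(f, g)` is the entry of `G` at
`(f(r_1)…f(r_k), g(r_1)…g(r_k))` if `f` and `g` agree outside `rs`, and `0` otherwise. -/
def gateOp (G : Gate) (rs : List ℕ) {V : Finset ℕ} (φ : HSpace V) : HSpace V :=
  fun f => ∑ g : V → Bool,
    (if ∀ v : V, v.1 ∉ rs → f v = g v then
      G.op (fun i => bitAt f (rs.getD i 0)) (fun i => bitAt g (rs.getD i 0))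
    else 0) * φ g

/-! ### Terms -/

/-- Shapes of patterns: a classical variable, or a tuple of `n + 2` classical variables. -/
inductive Pat where
  | var : Pat
  | tuple (n : ℕ) : Pat

/-- The number of variables bound by a pattern. -/
def Pat.size : Pat → ℕ
  | .var => 1
  | .tuple n => n + 2

/-- Terms modulo α-conversion, with de Bruijn indices for classical variables (a free index `i`
stands for the free variable `v_i`, shifted by the number of binders above it). Quantum variables
and the symbols of unitary operators are represented by their indices. In `lam π M` the `i`-th
variable of the pattern `π` is the index `i` of `M`. -/
inductive Term where
  | var (i : ℕ) : Term
  | qvar (r : ℕ) : Term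
  | bang (M : Term) : Term
  | bit (b : Bool) : Term
  | gate (i : ℕ) : Term
  | newq (M : Term) : Term
  | app (M N : Term) : Term
  | tup {n : ℕ} (Ms : Fin (n + 2) → Term) : Term
  | lamBang (M : Term) : Term
  | lam (p : Pat) (M : Term) : Term

/-- A map on variables, under `k` binders. -/
def liftRen (k : ℕ) (ρ : ℕ → ℕ) (i : ℕ) : ℕ :=
  if i < k then i else ρ (i - k) + k

namespace Term

/-- Renaming of free classical variables. -/
def rename : (ℕ → ℕ) → Term → Term
  | ρ, var i => var (ρ i)
  | _, qvar r => qvar r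
  | ρ, bang M => bang (rename ρ M)
  | _, bit b => bit b
  | _, gate i => gate i
  | ρ, newq M => newq (rename ρ M)
  | ρ, app M N => app (rename ρ M) (rename ρ N)
  | ρ, tup Ms => tup (fun i => rename ρ (Ms i))
  | ρ, lamBang M => lamBang (rename (liftRen 1 ρ) M)
  | ρ, lam p M => lam p (rename (liftRen p.size ρ) M)

/-- The term `M` placed under `k` further binders. -/
def shift (k : ℕ) (M : Term) : Term :=
  rename (fun i => i + k) M

/-- A substitution, under `k` binders. -/
def liftSub (k : ℕ) (σ : ℕ → Term) (i : ℕ) : Term :=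
  if i < k then var i else shift k (σ (i - k))

/-- Simultaneous capture-avoiding substitution for free classical variables. -/
def subst : (ℕ → Term) → Term → Term
  | σ, var i => σ i
  | _, qvar r => qvar r
  | σ, bang M => bang (subst σ M)
  | _, bit b => bit b
  | _, gate i => gate i
  | σ, newq M => newq (subst σ M)
  | σ, app M N => app (subst σ M) (subst σ N)
  | σ, tup Ms => tup (fun i => subst σ (Ms i))
  | σ, lamBang M => lamBang (subst (liftSub 1 σ) M)
  | σ, lam p M => lam p (subst (liftSub p.size σ) M)

/-- `M{N_0/x_0,…,N_{k-1}/x_{k-1}}`, where `x_0,…,x_{k-1}` are the variables of `M` bound by an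
abstraction that is removed. -/
def inst {k : ℕ} (Ns : Fin k → Term) (M : Term) : Term :=
  subst (fun i => if h : i < k then Ns ⟨i, h⟩ else var (i - k)) M

/-- The set `Q(M)` of the quantum variables occurring in `M`. -/
def qvars : Term → Finset ℕ
  | var _ => ∅
  | qvar r => {r}
  | bang M => qvars M
  | bit _ => ∅
  | gate _ => ∅
  | newq M => qvars M
  | app M N => qvars M ∪ qvars N
  | tup Ms => Finset.univ.biUnion (fun i => qvars (Ms i))
  | lamBang M => qvars M
  | lam _ M => qvars M

/-- The action `θ(M)` on terms of a map on quantum variables. -/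
def mapQ (θ : ℕ → ℕ) : Term → Term
  | var i => var i
  | qvar r => qvar (θ r)
  | bang M => bang (mapQ θ M)
  | bit b => bit b
  | gate i => gate i
  | newq M => newq (mapQ θ M)
  | app M N => app (mapQ θ M) (mapQ θ N)
  | tup Ms => tup (fun i => mapQ θ (Ms i))
  | lamBang M => lamBang (mapQ θ M)
  | lam p M => lam p (mapQ θ M)

theorem mapQ_eq_self {θ : ℕ → ℕ} (M : Term) (h : ∀ r ∈ M.qvars, θ r = r) : M.mapQ θ = M := by
  induction M with
  | tup Ms ih =>
    simp only [mapQ, tup.injEq, heq_eq_eq, true_and]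
    funext i
    refine ih i (fun r hr => h r ?_)
    simp only [qvars, Finset.mem_biUnion, Finset.mem_univ, true_and]
    exact ⟨i, hr⟩
  | _ => simp_all [mapQ, qvars]

theorem mapQ_mapQ (θ η : ℕ → ℕ) (M : Term) : (M.mapQ θ).mapQ η = M.mapQ (fun r => η (θ r)) := by
  induction M with
  | tup Ms ih => simp only [mapQ, ih]
  | _ => simp_all [mapQ]

/-! ### Well-formed terms -/

/-- The items of an environment: `x` (a pattern that is a variable), `⟨x_1,…,x_k⟩`, `!x`, and a
quantum variable. The natural number `x` is the name of the free classical variable `v_x`. -/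
inductive Item where
  | lin (x : ℕ) : Item
  | tens (xs : List ℕ) : Item
  | bang (x : ℕ) : Item
  | qv (r : ℕ) : Item

/-- The names occurring in an item: classical on the left, quantum on the right. -/
def Item.names : Item → Multiset (ℕ ⊕ ℕ)
  | .lin x => {Sum.inl x}
  | .tens xs => (xs.map Sum.inl : List (ℕ ⊕ ℕ))
  | .bang x => {Sum.inl x}
  | .qv r => {Sum.inr r}

/-- Environments are multisets of items, ... -/
abbrev Env : Type := Multiset Item

/-- ... in which each variable name occurs at most once. -/
def Env.Valid (Γ : Env) : Prop :=
  (Multiset.bind Γ Item.names).Nodup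

/-- The renaming that turns the free variables `xs = x_0,…,x_{k-1}` of a term into the first `k`
de Bruijn indices; the abstraction of `xs` in `M` binds these in `M.rename (closing xs)`. -/
def closing (xs : List ℕ) (y : ℕ) : ℕ :=
  if y ∈ xs then xs.idxOf y else y + xs.length

/-- `Judgement Γ M`: the judgement `Γ ⊢ M` is derivable by the well-forming rules. -/
inductive Judgement : Env → Term → Prop
  | constBit (b : Bool) : Judgement 0 (bit b)
  | constGate (i : ℕ) : Judgement 0 (gate i)
  | qpVar (r : ℕ) : Judgement {Item.qv r} (qvar r)
  | classicVar (x : ℕ) : Judgement {Item.lin x} (var x)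
  | weak {Γ : Env} {M : Term} (x : ℕ) :
      Judgement Γ M → Env.Valid (Item.bang x ::ₘ Γ) → Judgement (Item.bang x ::ₘ Γ) M
  | contr {Γ : Env} {M : Term} (x y z : ℕ) :
      Judgement (Item.bang x ::ₘ Item.bang y ::ₘ Γ) M → Env.Valid (Item.bang z ::ₘ Γ) →
      Judgement (Item.bang z ::ₘ Γ) (M.rename (fun v => if v = x ∨ v = y then z else v))
  | prom {Γ : Env} {M : Term} :
      (∀ a ∈ Γ, ∃ x, a = Item.bang x) → Judgement Γ M → Judgement Γ (Term.bang M)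
  | der {Γ : Env} {M : Term} (x : ℕ) :
      Judgement (Item.lin x ::ₘ Γ) M → Judgement (Item.bang x ::ₘ Γ) M
  | leftTens {Γ : Env} {M : Term} (xs : List ℕ) :
      2 ≤ xs.length → Judgement ((xs.map Item.lin : List Item) + Γ) M →
      Judgement (Item.tens xs ::ₘ Γ) M
  | rightTens {n : ℕ} (Γ : Fin (n + 2) → Env) (Ms : Fin (n + 2) → Term) :
      (∀ i, Judgement (Γ i) (Ms i)) → Env.Valid (∑ i, Γ i) → Judgement (∑ i, Γ i) (tup Ms)
  | new {Γ : Env} {M : Term} : Judgement Γ M → Judgement Γ (newq M)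
  | lamVar {Γ : Env} {M : Term} (x : ℕ) :
      Judgement (Item.lin x ::ₘ Γ) M → Judgement Γ (lam Pat.var (M.rename (closing [x])))
  | lamTuple {Γ : Env} {M : Term} (n : ℕ) (xs : List ℕ) :
      xs.length = n + 2 → Judgement (Item.tens xs ::ₘ Γ) M →
      Judgement Γ (lam (Pat.tuple n) (M.rename (closing xs)))
  | lamBang {Γ : Env} {M : Term} (x : ℕ) :
      Judgement (Item.bang x ::ₘ Γ) M → Judgement Γ (Term.lamBang (M.rename (closing [x])))
  | app {Γ Δ : Env} {M N : Term} :
      Judgement Γ M → Judgement Δ N → Env.Valid (Γ + Δ) → Judgement (Γ + Δ) (Term.app M N)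

/-- `M` is well formed if `Q(M) ⊢ M` is derivable. -/
def WellFormed (M : Term) : Prop :=
  Judgement (M.qvars.val.map Item.qv) M

/-! ### Lists -/

/-- The term `[M_1,…,M_n]`: `[] = λ!x.λ!y.y` and `[M,M_1,…,M_n] = λ!x.λ!y.x M [M_1,…,M_n]`. -/
def list : List Term → Term
  | [] => Term.lamBang (Term.lamBang (var 0))
  | M :: Ms =>
    Term.lamBang (Term.lamBang (Term.app (Term.app (var 1) (shift 2 M)) (shift 2 (list Ms))))

/-- The input `![!c_1,…,!c_n]`. -/
def bits (cs : List Bool) : Term :=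
  Term.bang (list (cs.map (fun c => Term.bang (bit c))))

/-- The output `[r_1,…,r_m]`. -/
def qlist (m : ℕ) : Term :=
  list ((List.range m).map (fun i => qvar (i + 1)))

end Term

/-! ### Configurations and reduction -/

/-- Preconfigurations `[Q, QV, M]`. -/
structure PreConfig where
  vars : Finset ℕ
  reg : HSpace vars
  term : Term
  sub : term.qvars ⊆ vars

/-- Equivalence of preconfigurations: a bijection `θ` of the sets of quantum variables which
carries one preconfiguration to the other. -/
def PreConfig.Equiv (P P' : PreConfig) : Prop :=
  ∃ θ : ℕ → ℕ, Set.BijOn θ P.vars P'.vars ∧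
    (∀ f : ℕ → Bool, P'.reg (fun v => f v.1) = P.reg (fun v => f (θ v.1))) ∧
    P'.term = P.term.mapQ θ

theorem PreConfig.equiv_refl (P : PreConfig) : P.Equiv P :=
  ⟨id, Set.bijOn_id _, fun _ => rfl, (Term.mapQ_eq_self _ (fun _ _ => rfl)).symm⟩

theorem PreConfig.equiv_symm {P P' : PreConfig} (h : P.Equiv P') : P'.Equiv P := by
  obtain ⟨θ, hθ, hreg, hterm⟩ := h
  have hinv := hθ.invOn_invFunOn
  refine ⟨Function.invFunOn θ P.vars, hθ.symm hinv.symm, fun f => ?_, ?_⟩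
  · rw [hreg (fun r => f (Function.invFunOn θ P.vars r))]
    congr 1
    funext v
    exact congrArg f (hinv.1 v.2).symm
  · rw [hterm, Term.mapQ_mapQ]
    exact (Term.mapQ_eq_self _ (fun r hr => hinv.1 (P.sub hr))).symm

theorem PreConfig.equiv_trans {P P' P'' : PreConfig} (h : P.Equiv P') (h' : P'.Equiv P'') :
    P.Equiv P'' := by
  obtain ⟨θ, hθ, hreg, hterm⟩ := h
  obtain ⟨η, hη, hreg', hterm'⟩ := h'
  refine ⟨fun r => η (θ r), hη.comp hθ, fun f => ?_, ?_⟩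
  · rw [hreg' f, hreg (fun r => f (η r))]
  · rw [hterm', hterm, Term.mapQ_mapQ]

instance PreConfig.setoid : Setoid PreConfig :=
  ⟨PreConfig.Equiv, PreConfig.equiv_refl, PreConfig.equiv_symm, PreConfig.equiv_trans⟩

/-- Configurations are preconfigurations modulo equivalence. -/
def Config : Type := Quotient PreConfig.setoid

/-- One-step reduction of preconfigurations, where `U i` is the operator denoted by the symbol
`U_i`: the reduction rules, closed under all contexts except those of the form `!M`. A one-qubit
gate is applied to a quantum variable, an `(n + 2)`-qubit gate to a tuple of quantum variables. -/
inductive PreConfig.Step (U : ℕ → Gate) : PreConfig → PreConfig → Prop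
  -- quantum reductions
  | uqOne {V : Finset ℕ} {φ : HSpace V} (i r : ℕ) {h h'} :
      (U i).arity = 1 →
      Step U ⟨V, φ, Term.app (Term.gate i) (Term.qvar r), h⟩
        ⟨V, gateOp (U i) [r] φ, Term.qvar r, h'⟩
  | uqTuple {V : Finset ℕ} {φ : HSpace V} (i : ℕ) {n : ℕ} (rs : Fin (n + 2) → ℕ) {h h'} :
      (U i).arity = n + 2 → Function.Injective rs →
      Step U ⟨V, φ, Term.app (Term.gate i) (Term.tup (fun j => Term.qvar (rs j))), h⟩
        ⟨V, gateOp (U i) (List.ofFn rs) φ, Term.tup (fun j => Term.qvar (rs j)), h'⟩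
  | qBeta {V : Finset ℕ} {φ : HSpace V} {n : ℕ} (M : Term) (rs : Fin (n + 2) → ℕ) {h h'} :
      Step U
        ⟨V, φ, Term.app (Term.lam (Pat.tuple n) M) (Term.tup (fun j => Term.qvar (rs j))), h⟩
        ⟨V, φ, Term.inst (fun j => Term.qvar (rs j)) M, h'⟩
  -- creation of a qubit
  | new {V : Finset ℕ} {φ : HSpace V} (c : Bool) (r : ℕ) {h h'} :
      r ∉ V →
      Step U ⟨V, φ, Term.newq (Term.bit c), h⟩ ⟨insert r V, extendReg φ r c, Term.qvar r, h'⟩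
  -- classical reductions
  | lBeta {V : Finset ℕ} {φ : HSpace V} (M N : Term) {h h'} :
      Step U ⟨V, φ, Term.app (Term.lam Pat.var M) N, h⟩
        ⟨V, φ, Term.inst (fun _ : Fin 1 => N) M, h'⟩
  | cBeta {V : Finset ℕ} {φ : HSpace V} (M N : Term) {h h'} :
      Step U ⟨V, φ, Term.app (Term.lamBang M) (Term.bang N), h⟩
        ⟨V, φ, Term.inst (fun _ : Fin 1 => N) M, h'⟩
  | lCm {V : Finset ℕ} {φ : HSpace V} (L : Term) (p : Pat) (M N : Term) {h h'} :
      Step U ⟨V, φ, Term.app L (Term.app (Term.lam p M) N), h⟩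
        ⟨V, φ, Term.app (Term.lam p (Term.app (Term.shift p.size L) M)) N, h'⟩
  | rCm {V : Finset ℕ} {φ : HSpace V} (p : Pat) (M N L : Term) {h h'} :
      Step U ⟨V, φ, Term.app (Term.app (Term.lam p M) N) L, h⟩
        ⟨V, φ, Term.app (Term.lam p (Term.app M (Term.shift p.size L))) N, h'⟩
  -- closure under contexts
  | inTuple {V V' : Finset ℕ} {φ : HSpace V} {φ' : HSpace V'} {n : ℕ}
      (Ms : Fin (n + 2) → Term) (i : Fin (n + 2)) (M' : Term) {h h' k k'} :
      Step U ⟨V, φ, Ms i, h⟩ ⟨V', φ', M', h'⟩ →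
      Step U ⟨V, φ, Term.tup Ms, k⟩ ⟨V', φ', Term.tup (Function.update Ms i M'), k'⟩
  | rightApp {V V' : Finset ℕ} {φ : HSpace V} {φ' : HSpace V'} (M N N' : Term) {h h' k k'} :
      Step U ⟨V, φ, N, h⟩ ⟨V', φ', N', h'⟩ →
      Step U ⟨V, φ, Term.app M N, k⟩ ⟨V', φ', Term.app M N', k'⟩
  | leftApp {V V' : Finset ℕ} {φ : HSpace V} {φ' : HSpace V'} (M M' N : Term) {h h' k k'} :
      Step U ⟨V, φ, M, h⟩ ⟨V', φ', M', h'⟩ →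
      Step U ⟨V, φ, Term.app M N, k⟩ ⟨V', φ', Term.app M' N, k'⟩
  | inNew {V V' : Finset ℕ} {φ : HSpace V} {φ' : HSpace V'} (M M' : Term) {h h' k k'} :
      Step U ⟨V, φ, M, h⟩ ⟨V', φ', M', h'⟩ →
      Step U ⟨V, φ, Term.newq M, k⟩ ⟨V', φ', Term.newq M', k'⟩
  | inLamBang {V V' : Finset ℕ} {φ : HSpace V} {φ' : HSpace V'} (M M' : Term) {h h' k k'} :
      Step U ⟨V, φ, M, h⟩ ⟨V', φ', M', h'⟩ →
      Step U ⟨V, φ, Term.lamBang M, k⟩ ⟨V', φ', Term.lamBang M', k'⟩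
  | inLam {V V' : Finset ℕ} {φ : HSpace V} {φ' : HSpace V'} (p : Pat) (M M' : Term)
      {h h' k k'} :
      Step U ⟨V, φ, M, h⟩ ⟨V', φ', M', h'⟩ →
      Step U ⟨V, φ, Term.lam p M, k⟩ ⟨V', φ', Term.lam p M', k'⟩

/-- One-step reduction of configurations. -/
def Config.Step (U : ℕ → Gate) (C C' : Config) : Prop :=
  ∃ P P' : PreConfig, C = Quotient.mk _ P ∧ C' = Quotient.mk _ P' ∧ PreConfig.Step U P P'

/-- Configurations in normal form. -/
def Config.IsNormal (U : ℕ → Gate) (C : Config) : Prop :=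
  ∀ C', ¬ Config.Step U C C'

/-- `C ⇓ C'`: `C` reduces, in finitely many steps, to `C'`, which is in normal form. -/
def Config.Evaluates (U : ℕ → Gate) (C C' : Config) : Prop :=
  Relation.ReflTransGen (Config.Step U) C C' ∧ Config.IsNormal U C'

/-- The configuration `[Q, M] = [Q, Q(M), M]`. -/
def Config.ofTerm (M : Term) (φ : HSpace M.qvars) : Config :=
  Quotient.mk _ ⟨M.qvars, φ, M, Finset.Subset.refl _⟩

/-- `[1, M] ⇓ [Q, N]`, where `M` contains no quantum variable and `1` is the vector `1` of
`H(∅) = ℂ`. -/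
def EvaluatesTo (U : ℕ → Gate) (M N : Term) (φ : HSpace N.qvars) : Prop :=
  ∃ h : M.qvars ⊆ ∅,
    Config.Evaluates U (Quotient.mk _ ⟨∅, fun _ => 1, M, h⟩) (Config.ofTerm N φ)

/-- Quantum relevant terms. -/
def QuantumRelevant (U : ℕ → Gate) (M : Term) : Prop :=
  M.WellFormed ∧
    ∀ cs : List Bool, ∃ (m : ℕ) (φ : HSpace (Term.qlist m).qvars),
      IsRegister φ ∧ EvaluatesTo U (Term.app M (Term.bits cs)) (Term.qlist m) φ

/-! ### Circuits -/

/-- A sequence `U_1, r_1^1,…,r_{n_1}^1, …, U_m, r_1^m,…,r_{n_m}^m`, each operator being given by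
the index of its symbol. -/
abbrev Circuit : Type := List (ℕ × List ℕ)

/-- Each gate of the sequence comes with as many distinct quantum variables as its arity. -/
def IsCircuit (U : ℕ → Gate) (k : Circuit) : Prop :=
  ∀ a ∈ k, a.2.length = (U a.1).arity ∧ a.2.Nodup

/-- `k` is a `Λ`-circuit based on the set `𝒢` of gates. -/
def IsCircuitOn (U : ℕ → Gate) (𝒢 : Set Gate) (Λ : Finset ℕ) (k : Circuit) : Prop :=
  IsCircuit U k ∧ ∀ a ∈ k, U a.1 ∈ 𝒢 ∧ ∀ r ∈ a.2, r ∈ Λ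

/-- The operator determined by a `V`-circuit: its gates are applied from left to right. -/
def circuitOp (U : ℕ → Gate) (k : Circuit) {V : Finset ℕ} (φ : HSpace V) : HSpace V :=
  k.foldl (fun ψ a => gateOp (U a.1) a.2 ψ) φ

/-- An effective enumeration of the quantum circuits. -/
def IsCircuitEnumeration (U : ℕ → Gate) (K : ℕ → Circuit) : Prop :=
  Computable K ∧ Set.range K = {k | IsCircuit U k}

/-- `(f, g, h)` is a family of circuits generated by `𝒢`. -/
structure IsCircuitFamily (U : ℕ → Gate) (K : ℕ → Circuit) (𝒢 : Set Gate)
    (f : ℕ → ℕ) (g : ℕ × ℕ → ℕ) (h : ℕ → ℕ) : Prop where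
  computable_f : Computable f
  computable_g : Computable g
  g_le : ∀ n m, 1 ≤ m → m ≤ f n → g (n, m) ≤ n + 1
  computable_h : Computable h
  circuit : ∀ n, IsCircuitOn U 𝒢 (Finset.Icc 1 (f n)) (K (h n))

/-- A family of circuits is finitely generated if it is generated by a finite set of gates. -/
def IsFinitelyGenerated (U : ℕ → Gate) (K : ℕ → Circuit)
    (f : ℕ → ℕ) (g : ℕ × ℕ → ℕ) (h : ℕ → ℕ) : Prop :=
  ∃ 𝒢 : Set Gate, 𝒢.Finite ∧ IsCircuitFamily U K 𝒢 f g h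

/-- The bit `c_i` of the input `c_1,…,c_n`, where `c_0 = 0` and `c_{n+1} = 1`. -/
def inputBit (cs : List Bool) : ℕ → Bool
  | 0 => false
  | i + 1 => cs.getD i true

end QCalc

end

namespace QCalc
namespace Term

/-! ### Renaming and substitution -/

/-! The term is an interpreter. It reads the input list, which yields the length `n` as a numeral
and the input bits in reverse order between two sentinels. A closed term computing a general
recursive function turns `n` into a program, coded as one natural number, and a machine executes
this program while carrying two lists of qubits. There are six fixed instructions (stop, reset or
advance a pointer into the bits, create a qubit from the bit at the pointer, move a qubit to the
second list, pull one back) and one instruction for each of the finitely many gates. Gates act on an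
initial segment of the first list only, so the program rearranges the list before each gate and
sorts it before stopping. Everything that depends on `n` is thus left to classical recursion theory
(`red_codeT`, `computable_program`), and the calculus has to simulate only finitely many
instructions (`run_fetch`, `run_gateT`). The effect of the programs is computed in `run_initProg`
and `run_circuitProg`.

Numerals, lists of bits and programs are encoded by their case distinctions and always stand below a
`!`. Since nothing reduces below a `!`, functions on them are written in continuation-passing style,
and the classical part of the evaluation takes place at the head of a spine of applications.
Recursion is self-application of a duplicable closed term. Qubits stay in linear positions and are
passed along exactly once.

This evaluation gives one direction of the equivalence. For the other, the normal form has to be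
unique. The terms concerned satisfy the condition `ok`, which reduction preserves: pattern variables
occur exactly once and outside of `!`, and no argument is an application, except of a gate. The
second clause makes the rule `L((λπ.M)N) → (λπ.LM)N` inapplicable. The first one, together with the
absence of reduction below `!`, ensures that a redex has at most one residual. Hence two steps from
a configuration can be joined by at most one step on each side (`TStep.peak`, `Config.Step.join`),
and confluence follows without any termination argument. Gates fired in different parts of a term
commute because no quantum variable occurs twice, and the names chosen for new qubits matter only up
to renaming. Finally, the output `[r_1,…,r_m]` lists its names, which fixes the register itself and
not only its class modulo renaming (`ofTerm_qlist_inj`).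

Well-formedness follows from `ok` as well: every closed `ok` term without quantum variables is
derivable (`derivable_of_ok`). -/

theorem liftRen_liftRen (k : ℕ) (ρ η : ℕ → ℕ) (i : ℕ) :
    liftRen k η (liftRen k ρ i) = liftRen k (fun j => η (ρ j)) i := by
  unfold liftRen
  by_cases h : i < k <;> simp [h]

theorem rename_rename (M : Term) : ∀ ρ η : ℕ → ℕ,
    rename η (rename ρ M) = rename (fun i => η (ρ i)) M := by
  induction M <;> intro ρ η <;> simp_all [rename, liftRen_liftRen]

theorem liftSub_liftRen (k : ℕ) (ρ : ℕ → ℕ) (σ : ℕ → Term) (i : ℕ) :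
    liftSub k σ (liftRen k ρ i) = liftSub k (fun j => σ (ρ j)) i := by
  unfold liftSub liftRen
  by_cases h : i < k <;> simp [h]

theorem subst_rename (M : Term) : ∀ (ρ : ℕ → ℕ) (σ : ℕ → Term),
    subst σ (rename ρ M) = subst (fun i => σ (ρ i)) M := by
  induction M <;> intro ρ σ <;> simp_all [rename, subst, liftSub_liftRen]

theorem rename_liftSub (k : ℕ) (ρ : ℕ → ℕ) (σ : ℕ → Term) (i : ℕ) :
    rename (liftRen k ρ) (liftSub k σ i) = liftSub k (fun j => rename ρ (σ j)) i := by
  unfold liftSub shift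
  by_cases h : i < k
  · simp [h, rename, liftRen]
  · simp [h, rename_rename, liftRen]

theorem rename_subst (M : Term) : ∀ (ρ : ℕ → ℕ) (σ : ℕ → Term),
    rename ρ (subst σ M) = subst (fun i => rename ρ (σ i)) M := by
  induction M <;> intro ρ σ <;> simp_all [rename, subst, rename_liftSub]

theorem subst_liftSub (k : ℕ) (τ σ : ℕ → Term) (i : ℕ) :
    subst (liftSub k τ) (liftSub k σ i) = liftSub k (fun j => subst τ (σ j)) i := by
  unfold liftSub shift
  by_cases h : i < k
  · simp [h, subst]
  · simp [h, subst_rename, rename_subst]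

theorem subst_subst (M : Term) : ∀ σ τ : ℕ → Term,
    subst τ (subst σ M) = subst (fun i => subst τ (σ i)) M := by
  induction M <;> intro σ τ <;> simp_all [subst, subst_liftSub]

theorem liftSub_var (k : ℕ) : liftSub k var = var := by
  funext i
  unfold liftSub shift
  by_cases h : i < k
  · simp [h]
  · simp only [h, if_false, rename]
    congr 1
    omega

theorem subst_var (M : Term) : subst var M = M := by
  induction M <;> simp_all [subst, liftSub_var]

theorem rename_eq_subst (ρ : ℕ → ℕ) (M : Term) : rename ρ M = subst (fun i => var (ρ i)) M := by
  have h := rename_subst M ρ var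
  rw [subst_var] at h
  simpa [rename] using h

theorem subst_shift (k : ℕ) (σ : ℕ → Term) (M : Term) :
    subst (liftSub k σ) (shift k M) = shift k (subst σ M) := by
  simp [shift, subst_rename, rename_subst, liftSub]

theorem subst_inst {k : ℕ} (σ : ℕ → Term) (Ns : Fin k → Term) (M : Term) :
    subst σ (inst Ns M) = inst (fun j => subst σ (Ns j)) (subst (liftSub k σ) M) := by
  unfold inst
  rw [subst_subst, subst_subst]
  congr 1
  funext i
  by_cases h : i < k
  · simp [h, subst, liftSub]
  · simp [h, subst, liftSub, shift, subst_rename, subst_var]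

theorem inst_shift {k : ℕ} (Ns : Fin k → Term) (M : Term) : inst Ns (shift k M) = M := by
  simp [inst, shift, subst_rename, subst_var]

/-! ### Quantum renaming -/

theorem mapQ_rename (θ : ℕ → ℕ) (M : Term) : ∀ ρ : ℕ → ℕ,
    mapQ θ (rename ρ M) = rename ρ (mapQ θ M) := by
  induction M <;> intro ρ <;> simp_all [rename, mapQ]

theorem mapQ_subst (θ : ℕ → ℕ) (M : Term) : ∀ σ : ℕ → Term,
    mapQ θ (subst σ M) = subst (fun i => mapQ θ (σ i)) (mapQ θ M) := by
  have hl : ∀ (k : ℕ) (σ : ℕ → Term),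
      (fun i => mapQ θ (liftSub k σ i)) = liftSub k (fun i => mapQ θ (σ i)) := by
    intro k σ
    funext i
    unfold liftSub shift
    by_cases h : i < k <;> simp [h, mapQ, mapQ_rename]
  induction M <;> intro σ <;> simp_all [subst, mapQ]

theorem mapQ_inst {k : ℕ} (θ : ℕ → ℕ) (Ns : Fin k → Term) (M : Term) :
    mapQ θ (inst Ns M) = inst (fun j => mapQ θ (Ns j)) (mapQ θ M) := by
  unfold inst
  rw [mapQ_subst]
  congr 1
  funext i
  by_cases h : i < k <;> simp [h, mapQ]

theorem mapQ_shift (θ : ℕ → ℕ) (k : ℕ) (M : Term) : mapQ θ (shift k M) = shift k (mapQ θ M) :=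
  mapQ_rename θ M _

/-! ### Weighted occurrence counts -/

/-- A weight on variables, under `k` binders: the bound variables have weight `0`. -/
def liftW (k : ℕ) (w : ℕ → ℕ) (i : ℕ) : ℕ :=
  if i < k then 0 else w (i - k)

/-- The total weight of the occurrences of variables in a term, `w` and `u` being the weights of
the classical and the quantum variables; occurrences within the scope of a `!` count twice. -/
def wt : (ℕ → ℕ) → (ℕ → ℕ) → Term → ℕ
  | w, _, var i => w i
  | _, u, qvar r => u r
  | w, u, bang M => 2 * wt w u M
  | _, _, bit _ => 0
  | _, _, gate _ => 0
  | w, u, newq M => wt w u M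
  | w, u, app M N => wt w u M + wt w u N
  | w, u, tup Ms => ∑ i, wt w u (Ms i)
  | w, u, lamBang M => wt (liftW 1 w) u M
  | w, u, lam p M => wt (liftW p.size w) u M

theorem liftW_add (k : ℕ) (w w' : ℕ → ℕ) : liftW k (w + w') = liftW k w + liftW k w' := by
  funext i
  by_cases h : i < k <;> simp [liftW, h]

theorem liftW_zero (k : ℕ) : liftW k 0 = 0 := by
  funext i
  by_cases h : i < k <;> simp [liftW, h]

theorem wt_zero (M : Term) : wt 0 0 M = 0 := by
  induction M <;> simp_all [wt, liftW_zero]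

theorem wt_add (M : Term) : ∀ w w' u u' : ℕ → ℕ,
    wt (w + w') (u + u') M = wt w u M + wt w' u' M := by
  induction M with
  | tup Ms ih => intro w w' u u'; simp [wt, ih, Finset.sum_add_distrib]
  | bang M ih => intro w w' u u'; simp [wt, ih, mul_add]
  | app M N ih ih' => intro w w' u u'; simp only [wt, ih, ih']; ring
  | _ => intro w w' u u'; simp_all [wt, liftW_add]

/-- The weight of a fixed term, as an additive function of the weights. -/
def wtHom (M : Term) : (ℕ → ℕ) × (ℕ → ℕ) →+ ℕ where
  toFun p := wt p.1 p.2 M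
  map_zero' := wt_zero M
  map_add' p q := wt_add M p.1 q.1 p.2 q.2

theorem wt_smul (M : Term) (c : ℕ) (w u : ℕ → ℕ) : wt (c • w) (c • u) M = c * wt w u M := by
  have h := map_nsmul (wtHom M) c (w, u)
  simpa [wtHom] using h

theorem wt_sum (M : Term) {ι : Type*} (s : Finset ι) (w : ι → ℕ → ℕ) :
    wt (∑ j ∈ s, w j) 0 M = ∑ j ∈ s, wt (w j) 0 M := by
  classical
  induction s using Finset.induction_on with
  | empty => simp [wt_zero]
  | insert a s ha ih =>
    rw [Finset.sum_insert ha, Finset.sum_insert ha, ← ih, ← wt_add, add_zero]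

theorem wt_rename (M : Term) : ∀ (ρ : ℕ → ℕ) (w u : ℕ → ℕ),
    wt w u (rename ρ M) = wt (fun i => w (ρ i)) u M := by
  have hl : ∀ (k : ℕ) (ρ w : ℕ → ℕ),
      (fun i => liftW k w (liftRen k ρ i)) = liftW k (fun i => w (ρ i)) := by
    intro k ρ w
    funext i
    by_cases h : i < k <;> simp [liftW, liftRen, h]
  induction M <;> intro ρ w u <;> simp_all [wt, rename]

theorem wt_shift (k : ℕ) (M : Term) (w u : ℕ → ℕ) :
    wt w u (shift k M) = wt (fun i => w (i + k)) u M := wt_rename M _ w u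

theorem wt_liftW_shift (k : ℕ) (M : Term) (w u : ℕ → ℕ) :
    wt (liftW k w) u (shift k M) = wt w u M := by
  simp [wt_shift, liftW]

theorem wt_subst (M : Term) : ∀ (σ : ℕ → Term) (w u : ℕ → ℕ),
    wt w u (subst σ M) = wt (fun i => wt w u (σ i)) u M := by
  have hl : ∀ (k : ℕ) (σ : ℕ → Term) (w u : ℕ → ℕ),
      (fun i => wt (liftW k w) u (liftSub k σ i)) = liftW k (fun i => wt w u (σ i)) := by
    intro k σ w u
    funext i
    by_cases h : i < k
    · simp [liftW, liftSub, h, wt]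
    · simp only [liftSub, h, if_false, wt_liftW_shift]
      simp [liftW, h]
  induction M <;> intro σ w u <;> simp_all [wt, subst]

/-- The number of occurrences of a classical variable, those within the scope of a `!` being
counted twice. -/
def cnt (i : ℕ) (M : Term) : ℕ := wt (Pi.single i 1) 0 M

theorem liftW_single (k i : ℕ) : liftW k (Pi.single i 1) = Pi.single (i + k) 1 := by
  funext j
  simp only [liftW, Pi.single_apply]
  split_ifs <;> omega

@[simp] theorem cnt_var (i j : ℕ) : cnt i (var j) = if j = i then 1 else 0 := by
  simp [cnt, wt, Pi.single_apply]

@[simp] theorem cnt_qvar (i r : ℕ) : cnt i (qvar r) = 0 := rfl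

@[simp] theorem cnt_bang (i : ℕ) (M : Term) : cnt i (bang M) = 2 * cnt i M := rfl

@[simp] theorem cnt_bit (i : ℕ) (b : Bool) : cnt i (bit b) = 0 := rfl

@[simp] theorem cnt_gate (i j : ℕ) : cnt i (gate j) = 0 := rfl

@[simp] theorem cnt_newq (i : ℕ) (M : Term) : cnt i (newq M) = cnt i M := rfl

@[simp] theorem cnt_app (i : ℕ) (M N : Term) : cnt i (app M N) = cnt i M + cnt i N := rfl

@[simp] theorem cnt_tup (i : ℕ) {n : ℕ} (Ms : Fin (n + 2) → Term) :
    cnt i (tup Ms) = ∑ j, cnt i (Ms j) := rfl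

@[simp] theorem cnt_lamBang (i : ℕ) (M : Term) : cnt i (lamBang M) = cnt (i + 1) M := by
  simp [cnt, wt, liftW_single]

@[simp] theorem cnt_lam (i : ℕ) (p : Pat) (M : Term) :
    cnt i (lam p M) = cnt (i + p.size) M := by
  simp [cnt, wt, liftW_single]

/-- A variable of count zero does not occur. The main use is that closed terms are invariant under
substitution. -/
theorem subst_congr (M : Term) : ∀ σ τ : ℕ → Term,
    (∀ i, cnt i M ≠ 0 → σ i = τ i) → subst σ M = subst τ M := by
  have hl : ∀ (k : ℕ) (σ τ : ℕ → Term) (i : ℕ), (k ≤ i → σ (i - k) = τ (i - k)) →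
      liftSub k σ i = liftSub k τ i := by
    intro k σ τ i h
    by_cases hi : i < k
    · simp [liftSub, hi]
    · simp [liftSub, hi, h (not_lt.mp hi)]
  induction M with
  | var i => intro σ τ h; exact h i (by simp)
  | qvar | bit | gate => intro σ τ h; rfl
  | bang M ih => intro σ τ h; simp only [subst]; rw [ih σ τ (fun i hi => h i (by simpa using hi))]
  | newq M ih => intro σ τ h; simp only [subst]; rw [ih σ τ (fun i hi => h i (by simpa using hi))]
  | app M N ih ih' =>
    intro σ τ h
    simp only [subst]
    rw [ih σ τ (fun i hi => h i (by simp [hi])), ih' σ τ (fun i hi => h i (by simp [hi]))]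
  | tup Ms ih =>
    intro σ τ h
    simp only [subst]
    congr 1
    funext j
    refine ih j σ τ (fun i hi => h i ?_)
    simp only [cnt_tup, ne_eq, Finset.sum_eq_zero_iff, not_forall]
    exact ⟨j, Finset.mem_univ j, hi⟩
  | lamBang M ih =>
    intro σ τ h
    simp only [subst]
    rw [ih _ _ (fun i hi => hl 1 σ τ i (fun hk => h (i - 1) ?_))]
    rw [cnt_lamBang, Nat.sub_add_cancel hk]
    exact hi
  | lam p M ih =>
    intro σ τ h
    simp only [subst]
    rw [ih _ _ (fun i hi => hl p.size σ τ i (fun hk => h (i - p.size) ?_))]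
    rw [cnt_lam, Nat.sub_add_cancel hk]
    exact hi

theorem rename_congr (M : Term) (ρ η : ℕ → ℕ) (h : ∀ i, cnt i M ≠ 0 → ρ i = η i) :
    rename ρ M = rename η M := by
  rw [rename_eq_subst, rename_eq_subst]
  exact subst_congr M _ _ (fun i hi => by rw [h i hi])

/-- The weight that the substitution induces on the indices of `M` is the lifted weight plus a
combination of indicator functions of the instantiated indices. The weight of a fixed term is
additive in the weights, so the formula follows. -/
theorem wt_inst {k : ℕ} (Ns : Fin k → Term) (M : Term) (w u : ℕ → ℕ) :
    wt w u (inst Ns M) =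
      wt (liftW k w) u M + ∑ j : Fin k, wt w u (Ns j) * cnt j M := by
  unfold inst
  rw [wt_subst]
  have h : (fun i => wt w u (if h : i < k then Ns ⟨i, h⟩ else var (i - k))) =
      liftW k w + ∑ j : Fin k, (wt w u (Ns j)) • Pi.single (j : ℕ) 1 := by
    funext i
    by_cases h : i < k
    · simp only [h, dif_pos, Pi.add_apply, liftW, if_true, Finset.sum_apply, Pi.smul_apply,
        Pi.single_apply, smul_eq_mul, zero_add]
      rw [Finset.sum_eq_single ⟨i, h⟩]
      · simp
      · intro b _ hb
        have : i ≠ (b : ℕ) := fun e => hb (Fin.ext e.symm)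
        simp [this]
      · simp
    · simp only [h, dif_neg, not_false_eq_true, Pi.add_apply, liftW, if_false, Finset.sum_apply,
        Pi.smul_apply, Pi.single_apply, smul_eq_mul, wt]
      rw [Finset.sum_eq_zero]
      · simp
      · intro b _
        have : i ≠ (b : ℕ) := fun e => h (e ▸ b.2)
        simp [this]
  rw [h]
  have h2 := wt_add M (liftW k w) (∑ j : Fin k, (wt w u (Ns j)) • Pi.single (j : ℕ) 1) u 0
  rw [add_zero] at h2
  rw [h2, wt_sum]
  congr 1
  refine Finset.sum_congr rfl (fun j _ => ?_)
  have := wt_smul M (wt w u (Ns j)) (Pi.single (j : ℕ) 1) 0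
  simpa [cnt] using this

theorem mem_qvars_iff (r : ℕ) (M : Term) : r ∈ M.qvars ↔ wt 0 (Pi.single r 1) M ≠ 0 := by
  induction M with
  | tup Ms ih => simp [qvars, wt, ih]
  | app M N ih ih' => simp only [qvars, wt, Finset.mem_union, ih, ih']; omega
  | qvar s => simp [qvars, wt, Pi.single_apply, eq_comm]
  | _ => simp_all [qvars, wt, liftW_zero]

theorem rename_qvars (ρ : ℕ → ℕ) (M : Term) : (rename ρ M).qvars = M.qvars := by
  ext r
  simp only [mem_qvars_iff, wt_rename]
  rfl

theorem mapQ_congr {θ η : ℕ → ℕ} (M : Term) (h : ∀ r ∈ M.qvars, θ r = η r) :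
    M.mapQ θ = M.mapQ η := by
  induction M with
  | tup Ms ih =>
    simp only [mapQ, tup.injEq, heq_eq_eq, true_and]
    funext i
    refine ih i (fun r hr => h r ?_)
    simp only [qvars, Finset.mem_biUnion, Finset.mem_univ, true_and]
    exact ⟨i, hr⟩
  | _ => simp_all [mapQ, qvars]

theorem qvars_mapQ (θ : ℕ → ℕ) (M : Term) : (mapQ θ M).qvars = M.qvars.image θ := by
  induction M with
  | tup Ms ih => ext r; simp [qvars, mapQ, ih]; aesop
  | _ => simp_all [qvars, mapQ, Finset.image_union]

end Term
end QCalc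

namespace QCalc
open Term

/-! ### Labelled reduction of terms -/

/-- The effect of a reduction step on the quantum register. -/
inductive Lab where
  | silent : Lab
  | gate (i : ℕ) (rs : List ℕ) : Lab
  | new (c : Bool) (r : ℕ) : Lab

/-- Reduction of terms, labelled by the effect on the register. -/
inductive TStep (U : ℕ → Gate) : Term → Lab → Term → Prop
  | uqOne (i r : ℕ) : (U i).arity = 1 →
      TStep U (app (Term.gate i) (qvar r)) (.gate i [r]) (qvar r)
  | uqTuple (i : ℕ) {n : ℕ} (rs : Fin (n + 2) → ℕ) (Ms : Fin (n + 2) → Term) :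
      (U i).arity = n + 2 → Function.Injective rs → (∀ j, Ms j = qvar (rs j)) →
      TStep U (app (Term.gate i) (tup Ms)) (.gate i (List.ofFn rs)) (tup Ms)
  | qBeta {n : ℕ} (M : Term) (rs : Fin (n + 2) → ℕ) (Ms : Fin (n + 2) → Term) :
      (∀ j, Ms j = qvar (rs j)) →
      TStep U (app (lam (Pat.tuple n) M) (tup Ms)) .silent (inst Ms M)
  | new (c : Bool) (r : ℕ) : TStep U (newq (bit c)) (.new c r) (qvar r)
  | lBeta (M N : Term) : TStep U (app (lam Pat.var M) N) .silent (inst (fun _ : Fin 1 => N) M)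
  | cBeta (M N : Term) :
      TStep U (app (Term.lamBang M) (Term.bang N)) .silent (inst (fun _ : Fin 1 => N) M)
  | lCm (L : Term) (p : Pat) (M N : Term) :
      TStep U (app L (app (lam p M) N)) .silent (app (lam p (app (shift p.size L) M)) N)
  | rCm (p : Pat) (M N L : Term) :
      TStep U (app (app (lam p M) N) L) .silent (app (lam p (app M (shift p.size L))) N)
  | inTuple {n : ℕ} (Ms : Fin (n + 2) → Term) (i : Fin (n + 2)) (a : Lab) (M' : Term) :
      TStep U (Ms i) a M' → TStep U (tup Ms) a (tup (Function.update Ms i M'))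
  | rightApp (M N N' : Term) (a : Lab) : TStep U N a N' → TStep U (app M N) a (app M N')
  | leftApp (M M' N : Term) (a : Lab) : TStep U M a M' → TStep U (app M N) a (app M' N)
  | inNew (M M' : Term) (a : Lab) : TStep U M a M' → TStep U (newq M) a (newq M')
  | inLamBang (M M' : Term) (a : Lab) :
      TStep U M a M' → TStep U (Term.lamBang M) a (Term.lamBang M')
  | inLam (p : Pat) (M M' : Term) (a : Lab) : TStep U M a M' → TStep U (lam p M) a (lam p M')

variable {U : ℕ → Gate}

/-- Redexes are recognized by abstractions, constants and quantum variables, none of which a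
substitution for classical variables can alter. -/
theorem TStep.subst {t t' : Term} {a : Lab} (h : TStep U t a t') :
    ∀ σ : ℕ → Term, TStep U (Term.subst σ t) a (Term.subst σ t') := by
  induction h with
  | uqOne i r hi => intro σ; exact .uqOne i r hi
  | uqTuple i rs Ms hi hrs hMs =>
    intro σ
    simp only [Term.subst]
    exact .uqTuple i rs _ hi hrs (fun j => by rw [hMs]; rfl)
  | qBeta M rs Ms hMs =>
    intro σ
    rw [subst_inst]
    exact .qBeta _ rs _ (fun j => by rw [hMs]; rfl)
  | new c r => intro σ; exact .new c r
  | lBeta M N => intro σ; rw [subst_inst]; exact .lBeta _ _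
  | cBeta M N => intro σ; rw [subst_inst]; exact .cBeta _ _
  | lCm L p M N =>
    intro σ
    simp only [Term.subst, subst_shift]
    exact .lCm _ p _ _
  | rCm p M N L =>
    intro σ
    simp only [Term.subst, subst_shift]
    exact .rCm p _ _ _
  | inTuple Ms i a M' _ ih =>
    intro σ
    have := TStep.inTuple (fun j => Term.subst σ (Ms j)) i a _ (ih σ)
    simp only [Term.subst]
    convert this using 2
    funext j
    exact Function.apply_update (fun _ => Term.subst σ) Ms i M' j
  | rightApp M N N' a _ ih => intro σ; exact .rightApp _ _ _ a (ih σ)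
  | leftApp M M' N a _ ih => intro σ; exact .leftApp _ _ _ a (ih σ)
  | inNew M M' a _ ih => intro σ; exact .inNew _ _ a (ih σ)
  | inLamBang M M' a _ ih => intro σ; exact .inLamBang _ _ a (ih _)
  | inLam p M M' a _ ih => intro σ; exact .inLam p _ _ a (ih _)

theorem TStep.rename {t t' : Term} {a : Lab} (h : TStep U t a t') (ρ : ℕ → ℕ) :
    TStep U (Term.rename ρ t) a (Term.rename ρ t') := by
  rw [rename_eq_subst, rename_eq_subst]
  exact h.subst _

theorem TStep.shift {t t' : Term} {a : Lab} (h : TStep U t a t') (k : ℕ) :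
    TStep U (Term.shift k t) a (Term.shift k t') := h.rename _

/-- Count 1 means one occurrence, outside of every `!`. So the substituted term is copied once, to a
place where reduction is allowed, and its step becomes exactly one step of the result. -/
theorem TStep.subst_arg {a : Lab} (M : Term) : ∀ (σ τ : ℕ → Term) (j : ℕ), cnt j M = 1 →
    TStep U (σ j) a (τ j) → (∀ i, i ≠ j → σ i = τ i) →
    TStep U (Term.subst σ M) a (Term.subst τ M) := by
  have hl : ∀ (k : ℕ) (σ τ : ℕ → Term) (j : ℕ), TStep U (σ j) a (τ j) →
      (∀ i, i ≠ j → σ i = τ i) → TStep U (liftSub k σ (j + k)) a (liftSub k τ (j + k)) ∧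
      ∀ i, i ≠ j + k → liftSub k σ i = liftSub k τ i := by
    intro k σ τ j hj hne
    refine ⟨by simpa [liftSub] using hj.shift k, fun i hi => ?_⟩
    by_cases h : i < k
    · simp [liftSub, h]
    · simp only [liftSub, h, if_false]
      rw [hne _ (by omega)]
  have hz : ∀ (M : Term) (σ τ : ℕ → Term) (j : ℕ), cnt j M = 0 →
      (∀ i, i ≠ j → σ i = τ i) → Term.subst σ M = Term.subst τ M := by
    intro M σ τ j h0 hne
    refine subst_congr M σ τ (fun i hi => hne i (fun e => hi (e ▸ h0)))
  induction M with
  | var i =>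
    intro σ τ j hc hj _
    by_cases h : i = j
    · subst h; exact hj
    · simp [h] at hc
  | qvar | bit | gate => intro σ τ j hc; simp at hc
  | bang M _ => intro σ τ j hc; simp at hc
  | newq M ih => intro σ τ j hc hj hne; exact .inNew _ _ _ (ih σ τ j (by simpa using hc) hj hne)
  | app M N ihM ihN =>
    intro σ τ j hc hj hne
    simp only [cnt_app] at hc
    simp only [Term.subst]
    by_cases h : cnt j M = 0
    · rw [hz M σ τ j h hne]
      exact .rightApp _ _ _ _ (ihN σ τ j (by omega) hj hne)
    · rw [hz N σ τ j (by omega) hne]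
      exact .leftApp _ _ _ _ (ihM σ τ j (by omega) hj hne)
  | tup Ms ih =>
    intro σ τ j hc hj hne
    simp only [cnt_tup] at hc
    -- The counts of the components sum to 1, so one component contains the variable and the others
    -- are unaffected by the substitution.
    obtain ⟨i, hi⟩ : ∃ i, cnt j (Ms i) ≠ 0 := by
      by_contra! h
      simp [h] at hc
    rw [← Finset.add_sum_erase _ _ (Finset.mem_univ i)] at hc
    have hi1 : cnt j (Ms i) = 1 := by omega
    have hrest : ∑ x ∈ Finset.univ.erase i, cnt j (Ms x) = 0 := by omega
    rw [Finset.sum_eq_zero_iff] at hrest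
    have := TStep.inTuple (fun j => Term.subst σ (Ms j)) i a _ (ih i σ τ j hi1 hj hne)
    simp only [Term.subst]
    convert this using 2
    funext l
    by_cases hl : l = i
    · subst hl; simp
    · rw [Function.update_of_ne hl]
      exact (hz _ σ τ j (hrest l (Finset.mem_erase.mpr ⟨hl, Finset.mem_univ l⟩)) hne).symm
  | lamBang M ih =>
    intro σ τ j hc hj hne
    obtain ⟨h1, h2⟩ := hl 1 σ τ j hj hne
    exact .inLamBang _ _ _ (ih _ _ (j + 1) (by simpa using hc) h1 h2)
  | lam p M ih =>
    intro σ τ j hc hj hne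
    obtain ⟨h1, h2⟩ := hl p.size σ τ j hj hne
    exact .inLam p _ _ _ (ih _ _ (j + p.size) (by simpa using hc) h1 h2)

theorem TStep.inst_arg {a : Lab} {N N' : Term} (M : Term) (hM : cnt 0 M = 1)
    (h : TStep U N a N') :
    TStep U (inst (fun _ : Fin 1 => N) M) a (inst (fun _ : Fin 1 => N') M) := by
  refine TStep.subst_arg M _ _ 0 hM (by simpa using h) (fun i hi => ?_)
  have : ¬ i < 1 := by omega
  simp [this]

/-! ### Linear terms whose arguments are values -/

/-- `ok false M`: the variables bound by patterns occur exactly once in `M`, outside of any `!`,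
and arguments of applications are not applications, except of gates. With `ok true M`, the term
itself is moreover not an application, except of a gate. -/
def ok : Bool → Term → Prop
  | _, .var _ => True
  | _, .qvar _ => True
  | _, .bang M => ok true M
  | _, .bit _ => True
  | _, .gate _ => True
  | _, .newq M => ok true M
  | f, .app M N => (f = true → ∃ i, M = Term.gate i) ∧ ok false M ∧ ok true N
  | _, .tup Ms => ∀ i, ok true (Ms i)
  | _, .lamBang M => ok false M
  | _, .lam p M => ok false M ∧ ∀ j < p.size, cnt j M = 1

theorem ok.weaken {f : Bool} {M : Term} (h : ok true M) : ok f M := by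
  cases M with
  | app M N => exact ⟨fun _ => h.1 rfl, h.2⟩
  | _ => exact h

theorem ok.toFalse {f : Bool} {M : Term} (h : ok f M) : ok false M := by
  cases M with
  | app M N => exact ⟨fun h => absurd h (by simp), h.2⟩
  | _ => exact h

theorem ok_rename (M : Term) : ∀ (f : Bool) (ρ : ℕ → ℕ), ok f M → ok f (rename ρ M) := by
  induction M with
  | app M N ihM ihN =>
    rintro f ρ ⟨h1, h2, h3⟩
    exact ⟨fun hf => by obtain ⟨i, rfl⟩ := h1 hf; exact ⟨i, rfl⟩, ihM _ _ h2, ihN _ _ h3⟩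
  | tup Ms ih => exact fun f ρ h i => ih i _ _ (h i)
  | lam p M ih =>
    rintro f ρ ⟨h1, h2⟩
    refine ⟨ih _ _ h1, fun j hj => ?_⟩
    rw [← h2 j hj, cnt, wt_rename, cnt]
    congr 1
    funext i
    simp only [liftRen, Pi.single_apply]
    split_ifs <;> first | rfl | omega
  | bang M ih => exact fun f ρ h => ih _ _ h
  | newq M ih => exact fun f ρ h => ih _ _ h
  | lamBang M ih => exact fun f ρ h => ih _ _ h
  | _ => exact fun f ρ h => trivial

theorem ok_subst (M : Term) : ∀ (f : Bool) (σ : ℕ → Term), ok f M → (∀ i, ok true (σ i)) →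
    ok f (subst σ M) := by
  have hl : ∀ (k : ℕ) (σ : ℕ → Term), (∀ i, ok true (σ i)) → ∀ i, ok true (liftSub k σ i) := by
    intro k σ h i
    unfold liftSub
    split_ifs
    · trivial
    · exact ok_rename _ _ _ (h _)
  induction M with
  | app M N ihM ihN =>
    rintro f σ ⟨h1, h2, h3⟩ hσ
    exact ⟨fun hf => by obtain ⟨i, rfl⟩ := h1 hf; exact ⟨i, rfl⟩, ihM _ _ h2 hσ, ihN _ _ h3 hσ⟩
  | tup Ms ih => exact fun f σ h hσ i => ih i _ _ (h i) hσ
  | lam p M ih =>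
    rintro f σ ⟨h1, h2⟩ hσ
    refine ⟨ih _ _ h1 (hl _ σ hσ), fun j hj => ?_⟩
    rw [← h2 j hj, cnt, wt_subst, cnt]
    congr 1
    funext i
    by_cases hi : i < p.size
    · simp [liftSub, hi, wt]
    · simp only [liftSub, hi, if_false, wt_shift]
      have : i ≠ j := by omega
      rw [Pi.single_apply, if_neg this, ← wt_zero (σ (i - p.size))]
      congr 1
      funext l
      have : l + p.size ≠ j := by omega
      simp [this]
  | var i => exact fun f σ _ hσ => (hσ i).weaken
  | bang M ih => exact fun f σ h hσ => ih _ _ h hσ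
  | newq M ih => exact fun f σ h hσ => ih _ _ h hσ
  | lamBang M ih => exact fun f σ h hσ => ih _ _ h (hl _ σ hσ)
  | _ => exact fun f σ h _ => trivial

theorem ok_inst {k : ℕ} {f : Bool} (Ns : Fin k → Term) (M : Term) (hM : ok f M)
    (h : ∀ j, ok true (Ns j)) : ok f (inst Ns M) := by
  refine ok_subst M f _ hM (fun i => ?_)
  split_ifs
  · exact h _
  · trivial

theorem not_step_gate {i : ℕ} {a : Lab} {t : Term} : ¬ TStep U (Term.gate i) a t := by
  intro h
  cases h

/-- The weight created by a step. -/
def Lab.weight (u : ℕ → ℕ) : Lab → ℕ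
  | .new _ r => u r
  | _ => 0

/-- Linear redexes move their argument without copying it. The bound 1 makes a copied `!N`
weightless, because occurrences below `!` count twice. The case of indicator weights is the
conservation of linear variables; for quantum variables only a creation adds weight. -/
theorem TStep.wt_eq {t t' : Term} {a : Lab} (h : TStep U t a t') :
    ∀ (f : Bool) (w u : ℕ → ℕ), ok f t → wt w u t ≤ 1 → wt w u t' = wt w u t + a.weight u := by
  induction h with
  | uqOne i r hi => intro f w u _ _; simp [wt, Lab.weight]
  | uqTuple i rs Ms hi hrs hMs => intro f w u _ _; simp [wt, Lab.weight]
  | qBeta M rs Ms hMs =>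
    intro f w u hok _
    rw [wt_inst]
    simp only [wt, Lab.weight, add_zero]
    congr 1
    refine Finset.sum_congr rfl (fun j _ => ?_)
    rw [hok.2.1.2 j j.2, mul_one]
  | new c r => intro f w u _ _; simp [wt, Lab.weight]
  | lBeta M N =>
    intro f w u hok _
    rw [wt_inst]
    have : cnt 0 M = 1 := hok.2.1.2 0 (by simp [Pat.size])
    simp only [wt, Lab.weight, Pat.size, Finset.univ_unique, Finset.sum_singleton, Fin.default_eq_zero,
      Fin.val_zero, this, mul_one, add_zero]
  | cBeta M N =>
    intro f w u hok hw
    rw [wt_inst]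
    simp only [wt] at hw
    -- Twice the weight of `N` is at most 1; being 0, it does not matter how often `N` is copied.
    have : wt w u N = 0 := by omega
    simp [wt, Lab.weight, this]
  | lCm L p M N =>
    intro f w u hok
    obtain ⟨i, hi⟩ := hok.2.2.1 rfl
    simp at hi
  | rCm p M N L => intro f w u _ _; simp [wt, Lab.weight, wt_liftW_shift]; ring
  | inTuple Ms i a M' _ ih =>
    intro f w u hok hw
    simp only [wt] at hw ⊢
    rw [← Finset.add_sum_erase _ _ (Finset.mem_univ i)] at hw ⊢
    rw [← Finset.add_sum_erase _ _ (Finset.mem_univ i), Function.update_self,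
      ih true w u (hok i) (by omega), Finset.sum_congr rfl (g := fun j => wt w u (Ms j))]
    · ring
    · intro j hj
      rw [Function.update_of_ne (Finset.ne_of_mem_erase hj)]
  | rightApp M N N' a _ ih =>
    intro f w u hok hw
    simp only [wt] at hw ⊢
    rw [ih true w u hok.2.2 (by omega)]
    ring
  | leftApp M M' N a _ ih =>
    intro f w u hok hw
    simp only [wt] at hw ⊢
    rw [ih false w u hok.2.1 (by omega)]
    ring
  | inNew M M' a _ ih => intro f w u hok hw; exact ih true w u hok hw
  | inLamBang M M' a _ ih => intro f w u hok hw; exact ih false _ u hok hw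
  | inLam p M M' a _ ih => intro f w u hok hw; exact ih false _ u hok.1 hw

theorem TStep.cnt_eq {t t' : Term} {a : Lab} (h : TStep U t a t') {f : Bool} (hok : ok f t)
    {j : ℕ} (hj : cnt j t = 1) : cnt j t' = 1 := by
  have := h.wt_eq f (Pi.single j 1) 0 hok (le_of_eq hj)
  rw [cnt, this]
  have h0 : a.weight 0 = 0 := by cases a <;> rfl
  rw [h0]
  exact hj

/-- Substituted terms were arguments before, hence are not applications except of gates, so argument
positions remain acceptable. The rule `lCm` cannot occur: its argument is an application of an
abstraction. The occurrence conditions below binders persist by conservation of counts. -/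
theorem TStep.ok {t t' : Term} {a : Lab} (h : TStep U t a t') :
    ∀ f : Bool, ok f t → ok f t' := by
  induction h with
  | uqOne i r hi => exact fun f _ => trivial
  | uqTuple i rs Ms hi hrs hMs => exact fun f h => h.2.2
  | qBeta M rs Ms hMs =>
    rintro f ⟨h1, h2, h3⟩
    cases f
    · exact ok_inst _ _ h2.1 h3
    · obtain ⟨i, hi⟩ := h1 rfl; simp at hi
  | new c r => exact fun f _ => trivial
  | lBeta M N =>
    rintro f ⟨h1, h2, h3⟩
    cases f
    · exact ok_inst _ _ h2.1 (fun _ => h3)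
    · obtain ⟨i, hi⟩ := h1 rfl; simp at hi
  | cBeta M N =>
    rintro f ⟨h1, h2, h3⟩
    cases f
    · exact ok_inst _ _ h2 (fun _ => h3)
    · obtain ⟨i, hi⟩ := h1 rfl; simp at hi
  | lCm L p M N =>
    intro f hok
    obtain ⟨i, hi⟩ := hok.2.2.1 rfl
    simp at hi
  | rCm p M N L =>
    rintro f ⟨h1, h2, h3⟩
    cases f
    · refine ⟨by simp, ⟨⟨by simp, h2.2.1.1, ok_rename _ _ _ h3⟩, fun j hj => ?_⟩, h2.2.2⟩
      rw [cnt_app, h2.2.1.2 j hj, cnt, wt_shift]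
      have : (fun i => (Pi.single j 1 : ℕ → ℕ) (i + p.size)) = 0 := by
        funext i
        have : i + p.size ≠ j := by omega
        simp [this]
      rw [this, wt_zero]
    · obtain ⟨i, hi⟩ := h1 rfl; simp at hi
  | inTuple Ms i a M' _ ih =>
    intro f hok j
    by_cases h : j = i
    · subst h; simpa using ih true (hok j)
    · simpa [h] using hok j
  | rightApp M N N' a _ ih => exact fun f h => ⟨h.1, h.2.1, ih true h.2.2⟩
  | leftApp M M' N a hs ih =>
    refine fun f h => ⟨fun hf => ?_, ih false h.2.1, h.2.2⟩
    obtain ⟨i, rfl⟩ := h.1 hf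
    exact absurd hs not_step_gate
  | inNew M M' a _ ih => exact fun f h => ih true h
  | inLamBang M M' a _ ih => exact fun f h => ih false h
  | inLam p M M' a hs ih => exact fun f h => ⟨ih false h.1, fun j hj => hs.cnt_eq h.1 (h.2 j hj)⟩

/-! ### Renaming of quantum variables -/

/-- The action on labels of a map on quantum variables. -/
def Lab.mapQ (θ : ℕ → ℕ) : Lab → Lab
  | .silent => .silent
  | .gate i rs => .gate i (rs.map θ)
  | .new c r => .new c (θ r)

/-- Injectivity keeps the qubits to which a gate is applied distinct. -/
theorem TStep.mapQ {t t' : Term} {a : Lab} (h : TStep U t a t') {θ : ℕ → ℕ}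
    (hθ : Function.Injective θ) : TStep U (Term.mapQ θ t) (a.mapQ θ) (Term.mapQ θ t') := by
  induction h with
  | uqOne i r hi => exact .uqOne i _ hi
  | uqTuple i rs Ms hi hrs hMs =>
    have := TStep.uqTuple (U := U) i (fun j => θ (rs j)) (fun j => Term.mapQ θ (Ms j)) hi
      (hθ.comp hrs) (fun j => by rw [hMs]; rfl)
    simpa [Lab.mapQ, List.map_ofFn, Function.comp_def, Term.mapQ] using this
  | qBeta M rs Ms hMs =>
    rw [mapQ_inst]
    exact .qBeta _ (fun j => θ (rs j)) _ (fun j => by rw [hMs]; rfl)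
  | new c r => exact .new c _
  | lBeta M N => rw [mapQ_inst]; exact .lBeta _ _
  | cBeta M N => rw [mapQ_inst]; exact .cBeta _ _
  | lCm L p M N => simp only [Term.mapQ, mapQ_shift]; exact .lCm _ p _ _
  | rCm p M N L => simp only [Term.mapQ, mapQ_shift]; exact .rCm p _ _ _
  | inTuple Ms i a M' _ ih =>
    have := TStep.inTuple (fun j => Term.mapQ θ (Ms j)) i _ _ ih
    simp only [Term.mapQ]
    convert this using 2
    funext j
    exact Function.apply_update (fun _ => Term.mapQ θ) Ms i M' j
  | rightApp M N N' a _ ih => exact .rightApp _ _ _ _ ih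
  | leftApp M M' N a _ ih => exact .leftApp _ _ _ _ ih
  | inNew M M' a _ ih => exact .inNew _ _ _ ih
  | inLamBang M M' a _ ih => exact .inLamBang _ _ _ ih
  | inLam p M M' a _ ih => exact .inLam p _ _ _ ih

end QCalc

namespace QCalc
open Term

variable {U : ℕ → Gate}

/-! ### Local confluence of terms -/

/-- The name created by a step does not occur in `t`. -/
def Lab.Fresh (t : Term) : Lab → Prop
  | .new _ r => r ∉ t.qvars
  | _ => True

/-- The steps do not create the same name. -/
def Lab.Apart : Lab → Lab → Prop
  | .new _ r, .new _ s => r ≠ s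
  | _, _ => True

/-- The steps do not operate on common qubits. -/
def Lab.Indep : Lab → Lab → Prop
  | .gate _ rs, .gate _ ss => ∀ r ∈ rs, r ∉ ss
  | _, _ => True

theorem Lab.Apart.symm {a b : Lab} (h : a.Apart b) : b.Apart a := by
  cases a <;> cases b <;> simp_all [Lab.Apart, eq_comm]

theorem Lab.Indep.symm {a b : Lab} (h : a.Indep b) : b.Indep a := by
  cases a <;> cases b <;> simp_all [Lab.Indep]
  exact fun r hr hr' => h r hr' hr

theorem Lab.indep_silent (b : Lab) : Lab.Indep .silent b := by
  cases b <;> trivial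

theorem TStep.gate_mem {t t' : Term} {a : Lab} (h : TStep U t a t') :
    ∀ (i : ℕ) (rs : List ℕ), a = .gate i rs → ∀ r ∈ rs, r ∈ t.qvars := by
  induction h with
  | uqOne i r hi =>
    rintro _ _ ⟨⟩ s hs
    simpa [qvars] using hs
  | uqTuple i rs Ms hi hrs hMs =>
    rintro _ _ ⟨⟩ s hs
    rw [List.mem_ofFn] at hs
    obtain ⟨j, rfl⟩ := hs
    simp only [qvars, Finset.empty_union, Finset.mem_biUnion]
    exact ⟨j, Finset.mem_univ j, by simp [hMs, qvars]⟩
  | inTuple Ms i a M' _ ih =>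
    intro i' rs ha r hr
    simp only [qvars, Finset.mem_biUnion]
    exact ⟨i, Finset.mem_univ i, ih i' rs ha r hr⟩
  | rightApp M N N' a _ ih =>
    intro i rs ha r hr
    exact Finset.mem_union_right _ (ih i rs ha r hr)
  | leftApp M M' N a _ ih =>
    intro i rs ha r hr
    exact Finset.mem_union_left _ (ih i rs ha r hr)
  | inNew M M' a _ ih => exact ih
  | inLamBang M M' a _ ih => exact ih
  | inLam p M M' a _ ih => exact ih
  | _ => intro i rs ha; simp at ha

/-- The ways in which two one-step reductions of a term can be joined. -/
def Peak (U : ℕ → Gate) (t₁ : Term) (a b : Lab) (t₂ : Term) : Prop :=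
  (a = b ∧ t₁ = t₂) ∨
  (a.Indep b ∧ ∃ t', TStep U t₁ b t' ∧ TStep U t₂ a t') ∨
  (a = .silent ∧ b = .silent ∧ (TStep U t₁ .silent t₂ ∨ TStep U t₂ .silent t₁)) ∨
  ∃ c r s, a = .new c r ∧ b = .new c s ∧ t₂ = t₁.mapQ (Equiv.swap r s)

theorem Peak.symm {t₁ t₂ : Term} {a b : Lab} (h : Peak U t₁ a b t₂) : Peak U t₂ b a t₁ := by
  rcases h with ⟨rfl, rfl⟩ | ⟨h, t', h1, h2⟩ | ⟨rfl, rfl, h⟩ | ⟨c, r, s, rfl, rfl, rfl⟩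
  · exact .inl ⟨rfl, rfl⟩
  · exact .inr (.inl ⟨h.symm, t', h2, h1⟩)
  · exact .inr (.inr (.inl ⟨rfl, rfl, h.symm⟩))
  · refine .inr (.inr (.inr ⟨c, s, r, rfl, rfl, ?_⟩))
    rw [mapQ_mapQ, mapQ_eq_self]
    intro x _
    rw [Equiv.swap_comm s r, Equiv.swap_apply_self]

theorem Peak.commute {t₁ t₂ : Term} (t' : Term) {b : Lab} (h1 : TStep U t₁ b t')
    (h2 : TStep U t₂ .silent t') : Peak U t₁ .silent b t₂ :=
  .inr (.inl ⟨Lab.indep_silent b, t', h1, h2⟩)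

/-- Joining below a context. -/
theorem Peak.context {t₁ t₂ : Term} {a b : Lab} (h : Peak U t₁ a b t₂) (E : Term → Term)
    (hE : ∀ t c t', TStep U t c t' → TStep U (E t) c (E t'))
    (hQ : ∀ c r s, a = .new c r → b = .new c s →
      E (t₁.mapQ (Equiv.swap r s)) = (E t₁).mapQ (Equiv.swap r s)) :
    Peak U (E t₁) a b (E t₂) := by
  rcases h with ⟨rfl, rfl⟩ | ⟨h, t', h1, h2⟩ | ⟨rfl, rfl, h⟩ | ⟨c, r, s, rfl, rfl, rfl⟩
  · exact .inl ⟨rfl, rfl⟩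
  · exact .inr (.inl ⟨h, _, hE _ _ _ h1, hE _ _ _ h2⟩)
  · exact .inr (.inr (.inl ⟨rfl, rfl, h.imp (hE _ _ _) (hE _ _ _)⟩))
  · exact .inr (.inr (.inr ⟨c, r, s, rfl, rfl, hQ c r s rfl rfl⟩))

theorem inst_app {k : ℕ} (Ns : Fin k → Term) (M N : Term) :
    inst Ns (app M N) = app (inst Ns M) (inst Ns N) := rfl

theorem mapQ_swap_eq_self {r s : ℕ} {M : Term} (hr : r ∉ M.qvars) (hs : s ∉ M.qvars) :
    M.mapQ (Equiv.swap r s) = M :=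
  mapQ_eq_self M (fun _ hx => Equiv.swap_apply_of_ne_of_ne (fun e => hr (e ▸ hx))
    (fun e => hs (e ▸ hx)))

theorem not_step_qvar {r : ℕ} {a : Lab} {t : Term} : ¬ TStep U (qvar r) a t := by
  intro h
  cases h

theorem not_step_bang {M : Term} {a : Lab} {t : Term} : ¬ TStep U (Term.bang M) a t := by
  intro h
  cases h

theorem not_step_bit {c : Bool} {a : Lab} {t : Term} : ¬ TStep U (bit c) a t := by
  intro h
  cases h

theorem not_step_tup {n : ℕ} {Ms : Fin (n + 2) → Term} {rs : Fin (n + 2) → ℕ}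
    (h : ∀ j, Ms j = qvar (rs j)) {a : Lab} {t : Term} : ¬ TStep U (tup Ms) a t := by
  intro hs
  cases hs with
  | inTuple _ i _ M' hi =>
    rw [h i] at hi
    exact not_step_qvar hi

theorem ok.not_app_lam {p : Pat} {M N : Term} : ¬ ok true (app (lam p M) N) := by
  intro h
  obtain ⟨i, hi⟩ := h.1 rfl
  simp at hi

/-- A step inside the body survives by stability under substitution; a step inside the argument has
exactly one residual, because the bound variable occurs once. -/
theorem peak_lBeta {f : Bool} {M N t : Term} {b : Lab} (hok : ok f (app (lam Pat.var M) N))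
    (h : TStep U (app (lam Pat.var M) N) b t) :
    Peak U (inst (fun _ : Fin 1 => N) M) .silent b t := by
  have hM : cnt 0 M = 1 := hok.2.1.2 0 (by simp [Pat.size])
  cases h with
  | lBeta => exact .inl ⟨rfl, rfl⟩
  | lCm => exact absurd hok.2.2 ok.not_app_lam
  | rightApp _ _ N' _ h => exact .commute _ (h.inst_arg M hM) (.lBeta _ _)
  | leftApp _ _ _ _ h =>
    cases h with
    | inLam _ _ M' _ h => exact .commute _ (h.subst _) (.lBeta _ _)

/-- The duplicated term stands below `!` and has no steps, so only steps of the body compete. -/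
theorem peak_cBeta {f : Bool} {M N t : Term} {b : Lab}
    (_ : ok f (app (Term.lamBang M) (Term.bang N)))
    (h : TStep U (app (Term.lamBang M) (Term.bang N)) b t) :
    Peak U (inst (fun _ : Fin 1 => N) M) .silent b t := by
  cases h with
  | cBeta => exact .inl ⟨rfl, rfl⟩
  | rightApp _ _ N' _ h => exact absurd h not_step_bang
  | leftApp _ _ _ _ h =>
    cases h with
    | inLamBang _ M' _ h => exact .commute _ (h.subst _) (.cBeta _ _)

theorem peak_qBeta {n : ℕ} {M t : Term} {b : Lab} {rs : Fin (n + 2) → ℕ}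
    {Ms : Fin (n + 2) → Term} (hMs : ∀ j, Ms j = qvar (rs j))
    (h : TStep U (app (lam (Pat.tuple n) M) (tup Ms)) b t) :
    Peak U (inst Ms M) .silent b t := by
  cases h with
  | qBeta => exact .inl ⟨rfl, rfl⟩
  | rightApp _ _ N' _ h => exact absurd h (not_step_tup hMs)
  | leftApp _ _ _ _ h =>
    cases h with
    | inLam _ _ M' _ h => exact .commute _ (h.subst _) (.qBeta _ rs _ hMs)

/-- Against a contraction of the redex `(λp.M)N` itself the diagram closes as a triangle: after the
commutation, the same contraction leads in one step to the other reduct, since `L` does not contain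
the pattern variables. -/
theorem peak_rCm {f : Bool} {p : Pat} {M N L t : Term} {b : Lab}
    (hok : ok f (app (app (lam p M) N) L)) (h : TStep U (app (app (lam p M) N) L) b t) :
    Peak U (app (lam p (app M (shift p.size L))) N) .silent b t := by
  cases h with
  | rCm => exact .inl ⟨rfl, rfl⟩
  | lCm => exact absurd hok.2.2 ok.not_app_lam
  | rightApp _ _ L' _ h =>
    exact .commute _ (.leftApp _ _ _ _ (.inLam _ _ _ _ (.rightApp _ _ _ _ (h.shift _))))
      (.rCm _ _ _ _)
  | leftApp _ _ _ _ h =>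
    cases h with
    | lBeta =>
      refine .inr (.inr (.inl ⟨rfl, rfl, .inl ?_⟩))
      have := TStep.lBeta (U := U) (app M (shift 1 L)) N
      have h2 : inst (fun _ : Fin 1 => N) (app M (shift 1 L)) =
          app (inst (fun _ : Fin 1 => N) M) L := by
        rw [inst_app, inst_shift]
      rw [h2] at this
      exact this
    | @qBeta n _ rs Ms hMs =>
      refine .inr (.inr (.inl ⟨rfl, rfl, .inl ?_⟩))
      have := TStep.qBeta (U := U) (app M (shift (Pat.size (.tuple n)) L)) rs Ms hMs
      have h2 : inst Ms (app M (shift (Pat.size (.tuple n)) L)) = app (inst Ms M) L := by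
        rw [inst_app]
        exact congrArg _ (inst_shift Ms L)
      rw [h2] at this
      exact this
    | lCm => exact absurd hok.2.1.2.2 ok.not_app_lam
    | rightApp _ _ N' _ h => exact .commute _ (.rightApp _ _ _ _ h) (.rCm _ _ _ _)
    | leftApp _ _ _ _ h =>
      cases h with
      | inLam _ _ M' _ h =>
        exact .commute _ (.leftApp _ _ _ _ (.inLam _ _ _ _ (.leftApp _ _ _ _ h))) (.rCm _ _ _ _)

theorem peak_uqOne {i r : ℕ} {t : Term} {b : Lab}
    (h : TStep U (app (Term.gate i) (qvar r)) b t) : Peak U (qvar r) (.gate i [r]) b t := by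
  cases h with
  | uqOne => exact .inl ⟨rfl, rfl⟩
  | rightApp _ _ _ _ h => exact absurd h not_step_qvar
  | leftApp _ _ _ _ h => exact absurd h not_step_gate

theorem peak_uqTuple {i n : ℕ} {t : Term} {b : Lab} {rs : Fin (n + 2) → ℕ}
    {Ms : Fin (n + 2) → Term} (hMs : ∀ j, Ms j = qvar (rs j))
    (h : TStep U (app (Term.gate i) (tup Ms)) b t) :
    Peak U (tup Ms) (.gate i (List.ofFn rs)) b t := by
  cases h with
  | uqTuple _ ss _ _ _ hMs' =>
    have : rs = ss := by
      funext j
      have := (hMs j).symm.trans (hMs' j)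
      simpa using this
    subst this
    exact .inl ⟨rfl, rfl⟩
  | rightApp _ _ _ _ h => exact absurd h (not_step_tup hMs)
  | leftApp _ _ _ _ h => exact absurd h not_step_gate

/-- The same creation may pick two different names; the results differ by their transposition. -/
theorem peak_new {c : Bool} {r : ℕ} {t : Term} {b : Lab} (h : TStep U (newq (bit c)) b t) :
    Peak U (qvar r) (.new c r) b t := by
  cases h with
  | new _ s => exact .inr (.inr (.inr ⟨c, r, s, rfl, rfl, by simp [Term.mapQ]⟩))
  | inNew _ _ _ h => exact absurd h not_step_bit

theorem Lab.Fresh.mono {M N : Term} {a : Lab} (h : a.Fresh N) (hs : M.qvars ⊆ N.qvars) :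
    a.Fresh M := by
  cases a with
  | new c r => exact fun hr => h (hs hr)
  | _ => trivial

theorem Lab.Fresh.mapQ_eq {M : Term} {a b : Lab} (ha : a.Fresh M) (hb : b.Fresh M) :
    ∀ c r s, a = .new c r → b = .new c s → M = M.mapQ (Equiv.swap r s) := by
  rintro c r s rfl rfl
  exact (mapQ_swap_eq_self ha hb).symm

/-- Steps in disjoint parts of a linear term are independent. -/
theorem indep_of_wt {M N M' N' : Term} {a b : Lab} (hM : TStep U M a M') (hN : TStep U N b N')
    (h : ∀ r, wt 0 (Pi.single r 1) M + wt 0 (Pi.single r 1) N ≤ 1) : a.Indep b := by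
  cases a with
  | gate i rs =>
    cases b with
    | gate j ss =>
      intro r hr hs
      have h1 := (mem_qvars_iff r M).mp (hM.gate_mem i rs rfl r hr)
      have h2 := (mem_qvars_iff r N).mp (hN.gate_mem j ss rfl r hs)
      have := h r
      omega
    | _ => trivial
  | _ => trivial

/-- Nested redexes are handled by the lemmas on the root rules, disjoint ones commute. Freshness is
needed for one alternative only: when the reducts of a subterm differ by a transposition of created
names, the surrounding context must contain neither name, so that the transposition relates the
whole terms. -/
theorem TStep.peak {t t₁ : Term} {a : Lab} (h₁ : TStep U t a t₁) :
    ∀ (f : Bool) (b : Lab) (t₂ : Term), TStep U t b t₂ → QCalc.ok f t →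
      (∀ r, wt 0 (Pi.single r 1) t ≤ 1) → a.Fresh t → b.Fresh t → Peak U t₁ a b t₂ := by
  induction h₁ with
  | uqOne i r hi => exact fun f b t₂ h₂ _ _ _ _ => peak_uqOne h₂
  | uqTuple i rs Ms hi hrs hMs => exact fun f b t₂ h₂ _ _ _ _ => peak_uqTuple hMs h₂
  | qBeta M rs Ms hMs => exact fun f b t₂ h₂ _ _ _ _ => peak_qBeta hMs h₂
  | new c r => exact fun f b t₂ h₂ _ _ _ _ => peak_new h₂
  | lBeta M N => exact fun f b t₂ h₂ hok _ _ _ => peak_lBeta hok h₂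
  | cBeta M N => exact fun f b t₂ h₂ hok _ _ _ => peak_cBeta hok h₂
  | lCm L p M N => exact fun f b t₂ _ hok _ _ _ => absurd hok.2.2 ok.not_app_lam
  | rCm p M N L => exact fun f b t₂ h₂ hok _ _ _ => peak_rCm hok h₂
  | inTuple Ms i a M' h ih =>
    intro f b t₂ h₂ hok hq ha hb
    have hsub : ∀ j, (Ms j).qvars ⊆ (tup Ms).qvars := fun j =>
      Finset.subset_biUnion_of_mem (fun j => (Ms j).qvars) (Finset.mem_univ j)
    cases h₂ with
    | inTuple _ j _ N' h' =>
      by_cases hij : j = i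
      · subst hij
        have hp := ih true b N' h' (hok j) (fun r => ?_) (ha.mono (hsub j)) (hb.mono (hsub j))
        · refine hp.context (fun t => tup (Function.update Ms j t)) (fun t c t' hs => ?_)
            (fun c r s e1 e2 => ?_)
          · have := TStep.inTuple (U := U) (Function.update Ms j t) j c t' (by simpa using hs)
            simpa using this
          · simp only [Term.mapQ]
            congr 1
            funext l
            by_cases hl : l = j
            · subst hl; simp
            · simp only [Function.update_of_ne hl]
              exact Lab.Fresh.mapQ_eq (ha.mono (hsub l)) (hb.mono (hsub l)) c r s e1 e2
        · refine le_trans ?_ (hq r)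
          exact Finset.single_le_sum (f := fun j => wt 0 (Pi.single r 1) (Ms j))
            (fun _ _ => Nat.zero_le _) (Finset.mem_univ j)
      -- Steps in two different components commute as updates; they share no qubit, since both
      -- components together carry weight at most 1.
      · refine .inr (.inl ⟨indep_of_wt h h' (fun r => ?_), _,
          .inTuple _ j b N' (by rwa [Function.update_of_ne hij]), ?_⟩)
        · refine le_trans ?_ (hq r)
          simp only [wt]
          rw [← Finset.add_sum_erase _ _ (Finset.mem_univ i)]
          refine Nat.add_le_add_left ?_ _
          exact Finset.single_le_sum (f := fun j => wt 0 (Pi.single r 1) (Ms j))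
            (fun _ _ => Nat.zero_le _) (Finset.mem_erase.mpr ⟨hij, Finset.mem_univ j⟩)
        · rw [Function.update_comm (Ne.symm hij)]
          exact .inTuple _ i a M' (by rwa [Function.update_of_ne (Ne.symm hij)])
  | rightApp M N N' a h ih =>
    intro f b t₂ h₂ hok hq ha hb
    have hM : M.qvars ⊆ (app M N).qvars := Finset.subset_union_left
    have hN : N.qvars ⊆ (app M N).qvars := Finset.subset_union_right
    have hs := TStep.rightApp M N N' a h
    cases h₂ with
    | uqOne => exact (peak_uqOne hs).symm
    | uqTuple _ _ _ _ _ hMs => exact (peak_uqTuple hMs hs).symm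
    | qBeta _ _ _ hMs => exact (peak_qBeta hMs hs).symm
    | lBeta => exact (peak_lBeta hok hs).symm
    | cBeta => exact (peak_cBeta hok hs).symm
    | lCm => exact absurd hok.2.2 ok.not_app_lam
    | rCm => exact (peak_rCm hok hs).symm
    | rightApp _ _ N'' _ h' =>
      refine (ih true b N'' h' hok.2.2 (fun r => le_trans ?_ (hq r)) (ha.mono hN)
        (hb.mono hN)).context (app M) (fun t c t' hs => .rightApp _ _ _ _ hs)
        (fun c r s e1 e2 => ?_)
      · simp only [wt]; omega
      · simp only [Term.mapQ]
        rw [← Lab.Fresh.mapQ_eq (ha.mono hM) (hb.mono hM) c r s e1 e2]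
    | leftApp _ M' _ _ h' =>
      exact .inr (.inl ⟨(indep_of_wt h' h (fun r => hq r)).symm, _, .leftApp _ _ _ _ h',
        .rightApp _ _ _ _ h⟩)
  | leftApp M M' N a h ih =>
    intro f b t₂ h₂ hok hq ha hb
    have hM : M.qvars ⊆ (app M N).qvars := Finset.subset_union_left
    have hN : N.qvars ⊆ (app M N).qvars := Finset.subset_union_right
    have hs := TStep.leftApp M M' N a h
    cases h₂ with
    | uqOne => exact (peak_uqOne hs).symm
    | uqTuple _ _ _ _ _ hMs => exact (peak_uqTuple hMs hs).symm
    | qBeta _ _ _ hMs => exact (peak_qBeta hMs hs).symm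
    | lBeta => exact (peak_lBeta hok hs).symm
    | cBeta => exact (peak_cBeta hok hs).symm
    | lCm => exact absurd hok.2.2 ok.not_app_lam
    | rCm => exact (peak_rCm hok hs).symm
    | rightApp _ _ N' _ h' =>
      exact .inr (.inl ⟨indep_of_wt h h' (fun r => hq r), _, .rightApp _ _ _ _ h',
        .leftApp _ _ _ _ h⟩)
    | leftApp _ M'' _ _ h' =>
      refine (ih false b M'' h' hok.2.1 (fun r => le_trans ?_ (hq r)) (ha.mono hM)
        (hb.mono hM)).context (fun t => app t N) (fun t c t' hs => .leftApp _ _ _ _ hs)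
        (fun c r s e1 e2 => ?_)
      · simp only [wt]; omega
      · simp only [Term.mapQ]
        rw [← Lab.Fresh.mapQ_eq (ha.mono hN) (hb.mono hN) c r s e1 e2]
  | inNew M M' a h ih =>
    intro f b t₂ h₂ hok hq ha hb
    cases h₂ with
    | new => exact absurd h not_step_bit
    | inNew _ M'' _ h' =>
      exact (ih true b M'' h' hok hq ha hb).context newq (fun _ _ _ hs => .inNew _ _ _ hs)
        (fun _ _ _ _ _ => rfl)
  | inLamBang M M' a h ih =>
    intro f b t₂ h₂ hok hq ha hb
    cases h₂ with
    | inLamBang _ M'' _ h' =>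
      refine (ih false b M'' h' hok (fun r => ?_) ha hb).context Term.lamBang
        (fun _ _ _ hs => .inLamBang _ _ _ hs) (fun _ _ _ _ _ => rfl)
      simpa [wt, liftW_zero] using hq r
  | inLam p M M' a h ih =>
    intro f b t₂ h₂ hok hq ha hb
    cases h₂ with
    | inLam _ _ M'' _ h' =>
      refine (ih false b M'' h' hok.1 (fun r => ?_) ha hb).context (lam p)
        (fun _ _ _ hs => .inLam _ _ _ _ hs) (fun _ _ _ _ _ => rfl)
      simpa [wt, liftW_zero] using hq r

end QCalc

noncomputable section

namespace QCalc
open Term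

/-! ### Operations on registers, as functions of assignments of bits to all names -/

/-- The assignment `f`, changed to `x_0,…,x_{k-1}` at the names `rs`. -/
def updBits (rs : List ℕ) {k : ℕ} (x : Fin k → Bool) (f : ℕ → Bool) (v : ℕ) : Bool :=
  if h : rs.idxOf v < k then x ⟨rs.idxOf v, h⟩ else f v

/-- The operation of a gate on the qubits `rs`. -/
def gateSem (G : Gate) (rs : List ℕ) (Φ : (ℕ → Bool) → ℂ) (f : ℕ → Bool) : ℂ :=
  ∑ x : Fin G.arity → Bool, G.op (fun i => f (rs.getD i 0)) x * Φ (updBits rs x f)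

/-- The creation of a qubit. -/
def newSem (c : Bool) (r : ℕ) (Φ : (ℕ → Bool) → ℂ) (f : ℕ → Bool) : ℂ :=
  if f r = c then Φ f else 0

theorem updBits_of_notMem {rs : List ℕ} {k : ℕ} (hk : rs.length = k) (x : Fin k → Bool)
    (f : ℕ → Bool) {v : ℕ} (hv : v ∉ rs) : updBits rs x f v = f v := by
  have : ¬ rs.idxOf v < k := by
    rw [← hk, List.idxOf_lt_length_iff]
    exact hv
  simp [updBits, this]

theorem getD_mem {rs : List ℕ} {i : ℕ} (hi : i < rs.length) : rs.getD i 0 ∈ rs := by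
  rw [List.getD_eq_getElem _ _ hi]
  exact List.getElem_mem hi

theorem updBits_getD {rs : List ℕ} {k : ℕ} (hk : rs.length = k) (hn : rs.Nodup)
    (x : Fin k → Bool) (f : ℕ → Bool) (i : Fin k) : updBits rs x f (rs.getD i 0) = x i := by
  subst hk
  rw [List.getD_eq_getElem _ _ i.2]
  simp [updBits, hn.idxOf_getElem]

theorem updBits_of_mem {rs : List ℕ} {k : ℕ} (hk : rs.length = k) (x : Fin k → Bool)
    (f g : ℕ → Bool) {v : ℕ} (hv : v ∈ rs) : updBits rs x f v = updBits rs x g v := by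
  have : rs.idxOf v < k := by
    rw [← hk, List.idxOf_lt_length_iff]
    exact hv
  simp [updBits, this]

theorem updBits_self {rs : List ℕ} {k : ℕ} (hk : rs.length = k) (f : ℕ → Bool) :
    updBits rs (fun i : Fin k => f (rs.getD i 0)) f = f := by
  subst hk
  funext v
  by_cases h : rs.idxOf v < rs.length
  · simp [updBits, h]
  · simp [updBits, h]

theorem updBits_updBits {rs : List ℕ} {k : ℕ} (x y : Fin k → Bool) (f : ℕ → Bool) :
    updBits rs x (updBits rs y f) = updBits rs x f := by
  funext v
  by_cases h : rs.idxOf v < k <;> simp [updBits, h]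

theorem updBits_comm {rs ss : List ℕ} {k l : ℕ} (hk : rs.length = k) (hl : ss.length = l)
    (x : Fin k → Bool) (y : Fin l → Bool) (f : ℕ → Bool) (h : ∀ r ∈ rs, r ∉ ss) :
    updBits rs x (updBits ss y f) = updBits ss y (updBits rs x f) := by
  funext v
  by_cases hv : v ∈ rs
  · rw [updBits_of_notMem hl _ _ (h v hv)]
    exact updBits_of_mem hk _ _ _ hv
  · rw [updBits_of_notMem hk _ _ hv]
    by_cases hv' : v ∈ ss
    · exact updBits_of_mem hl _ _ _ hv'
    · rw [updBits_of_notMem hl _ _ hv', updBits_of_notMem hl _ _ hv', updBits_of_notMem hk _ _ hv]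

/-- Each gate reads and writes only its own bits. On disjoint lists the updates commute and leave
the indices of the other matrix unchanged, so the two sums can be interchanged. -/
theorem gateSem_comm {G H : Gate} {rs ss : List ℕ} (hG : rs.length = G.arity)
    (hH : ss.length = H.arity) (h : ∀ r ∈ rs, r ∉ ss) (Φ : (ℕ → Bool) → ℂ) :
    gateSem G rs (gateSem H ss Φ) = gateSem H ss (gateSem G rs Φ) := by
  funext f
  simp only [gateSem, Finset.mul_sum]
  rw [Finset.sum_comm]
  refine Finset.sum_congr rfl (fun y _ => Finset.sum_congr rfl (fun x _ => ?_))
  have h1 : (fun i : Fin H.arity => updBits rs x f (ss.getD i 0)) = fun i : Fin H.arity => f (ss.getD i 0) := by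
    funext i
    exact updBits_of_notMem hG _ _ (fun hr => h _ hr (getD_mem (by rw [hH]; exact i.2)))
  have h2 : (fun i : Fin G.arity => updBits ss y f (rs.getD i 0)) = fun i : Fin G.arity => f (rs.getD i 0) := by
    funext i
    exact updBits_of_notMem hH _ _ (h _ (getD_mem (by rw [hG]; exact i.2)))
  rw [h1, h2, updBits_comm hG hH x y f h]
  ring

theorem gateSem_newSem {G : Gate} {rs : List ℕ} (hG : rs.length = G.arity) (c : Bool) {r : ℕ}
    (hr : r ∉ rs) (Φ : (ℕ → Bool) → ℂ) :
    gateSem G rs (newSem c r Φ) = newSem c r (gateSem G rs Φ) := by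
  funext f
  simp only [gateSem, newSem, updBits_of_notMem hG _ _ hr]
  split_ifs <;> simp

theorem newSem_comm (c d : Bool) (r s : ℕ) (Φ : (ℕ → Bool) → ℂ) :
    newSem c r (newSem d s Φ) = newSem d s (newSem c r Φ) := by
  funext f
  simp only [newSem]
  split_ifs <;> rfl

/-- The register of a preconfiguration, as a function of assignments of bits to all names. -/
def PreConfig.ext (P : PreConfig) (f : ℕ → Bool) : ℂ := P.reg (fun v => f v)

theorem exists_assignment {V : Finset ℕ} (g : V → Bool) : ∃ f : ℕ → Bool, g = fun v : V => f v := by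
  refine ⟨fun n => bitAt g n, ?_⟩
  funext v
  simp [bitAt]

/-- Every assignment on the finite set of variables extends to all names, so `ext` determines the
register. Comparing registers through `ext` avoids transport along equalities of the index sets. -/
theorem PreConfig.eq_of {P P' : PreConfig} (hv : P.vars = P'.vars) (he : P.ext = P'.ext)
    (ht : P.term = P'.term) : P = P' := by
  obtain ⟨V, φ, t, h⟩ := P
  obtain ⟨V', φ', t', h'⟩ := P'
  obtain rfl : V = V' := hv
  obtain rfl : t = t' := ht
  have : φ = φ' := by
    funext g
    obtain ⟨f, rfl⟩ := exists_assignment g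
    exact congrFun he f
  rw [this]

theorem PreConfig.ext_congr (P : PreConfig) {f g : ℕ → Bool} (h : ∀ v ∈ P.vars, f v = g v) :
    P.ext f = P.ext g := by
  unfold PreConfig.ext
  congr 1
  funext v
  exact h v v.2

/-- The nonzero terms of the sum over all assignments on `V` are those that agree with `f` outside
`rs`. They correspond to the strings of bits at `rs`: as `rs` is a list of distinct elements of `V`,
reading off these bits and updating `f` by them are mutually inverse. -/
theorem gateOp_apply {G : Gate} {rs : List ℕ} {V : Finset ℕ} (φ : HSpace V)
    (hG : rs.length = G.arity) (hn : rs.Nodup) (hV : ∀ r ∈ rs, r ∈ V) (f : ℕ → Bool) :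
    gateOp G rs φ (fun v => f v) = gateSem G rs (fun f => φ (fun v => f v)) f := by
  have hmem : ∀ i : Fin G.arity, rs.getD i 0 ∈ V := fun i =>
    hV _ (getD_mem (by rw [hG]; exact i.2))
  unfold gateOp gateSem
  simp only [ite_mul, zero_mul]
  rw [← Finset.sum_filter]
  refine Finset.sum_nbij' (fun g i => bitAt g (rs.getD i 0)) (fun x v => updBits rs x f v)
    (fun _ _ => Finset.mem_univ _) ?_ ?_ ?_ ?_
  · intro x _
    simp only [Finset.mem_filter, Finset.mem_univ, true_and]
    intro v hv
    exact (updBits_of_notMem hG x f hv).symm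
  · intro g hg
    simp only [Finset.mem_filter, Finset.mem_univ, true_and] at hg
    funext v
    by_cases hv : v.1 ∈ rs
    · have hi : rs.idxOf v.1 < rs.length := List.idxOf_lt_length_iff.mpr hv
      have hi' : rs.idxOf v.1 < G.arity := hG ▸ hi
      simp [updBits, hi', List.getElem?_eq_getElem hi, bitAt]
    · rw [updBits_of_notMem hG _ _ hv]
      exact hg v hv
  · intro x _
    funext i
    simp only [bitAt, hmem i, dif_pos]
    exact updBits_getD hG hn x f i
  · intro g hg
    simp only [Finset.mem_filter, Finset.mem_univ, true_and] at hg
    have h1 : (fun i : Fin G.arity => bitAt (fun v : V => f v) (rs.getD i 0)) =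
        fun i : Fin G.arity => f (rs.getD i 0) := by
      funext i
      have := hmem i
      simp only [bitAt, this, dif_pos]
    have h2 : (fun v : V => updBits rs (fun i : Fin G.arity => bitAt g (rs.getD i 0)) f v) = g := by
      funext v
      by_cases hv : v.1 ∈ rs
      · have hi : rs.idxOf v.1 < rs.length := List.idxOf_lt_length_iff.mpr hv
        have hi' : rs.idxOf v.1 < G.arity := hG ▸ hi
        simp [updBits, hi', List.getElem?_eq_getElem hi, bitAt]
      · rw [updBits_of_notMem hG _ _ hv]
        exact hg v hv
    rw [h1, h2]

variable {U : ℕ → Gate}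

/-- The variables after a step. -/
def Lab.vars : Lab → Finset ℕ → Finset ℕ
  | .new _ r, V => insert r V
  | _, V => V

/-- The operation of a step on the register. -/
def Lab.act (U : ℕ → Gate) : Lab → ((ℕ → Bool) → ℂ) → (ℕ → Bool) → ℂ
  | .silent, Φ => Φ
  | .gate i rs, Φ => gateSem (U i) rs Φ
  | .new c r, Φ => newSem c r Φ

/-- The conditions under which a step is possible. -/
def Lab.Enabled (U : ℕ → Gate) : Lab → Finset ℕ → Prop
  | .silent, _ => True
  | .gate i rs, V => rs.length = (U i).arity ∧ rs.Nodup ∧ ∀ r ∈ rs, r ∈ V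
  | .new _ r, V => r ∉ V

/-- The step from `P` to `P'` labelled by `a`. -/
structure LStep (U : ℕ → Gate) (P : PreConfig) (a : Lab) (P' : PreConfig) : Prop where
  term : TStep U P.term a P'.term
  enabled : a.Enabled U P.vars
  vars : P'.vars = a.vars P.vars
  ext : P'.ext = a.act U P.ext

theorem LStep.of_term {P P' Q Q' : PreConfig} {a : Lab} (h : LStep U P a P')
    (ht : TStep U Q.term a Q'.term) (h1 : Q.vars = P.vars) (h2 : Q.ext = P.ext)
    (h3 : Q'.vars = P'.vars) (h4 : Q'.ext = P'.ext) : LStep U Q a Q' :=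
  ⟨ht, h1 ▸ h.enabled, by rw [h3, h1, h.vars], by rw [h4, h2, h.ext]⟩

theorem PreConfig.Step.lstep {P P' : PreConfig} (h : PreConfig.Step U P P') :
    ∃ a, LStep U P a P' := by
  induction h with
  | @uqOne V φ i r h h' hi =>
    refine ⟨_, .uqOne i r hi, ⟨by simp [hi], by simp, ?_⟩, rfl, ?_⟩
    · simpa [Term.qvars] using h
    · funext f
      exact gateOp_apply φ (by simp [hi]) (by simp) (by simpa [Term.qvars] using h) f
  | @uqTuple V φ i n rs h h' hi hrs =>
    have hV : ∀ r ∈ List.ofFn rs, r ∈ V := by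
      intro r hr
      rw [List.mem_ofFn] at hr
      obtain ⟨j, rfl⟩ := hr
      apply h
      simp only [Term.qvars, Finset.empty_union, Finset.mem_biUnion]
      exact ⟨j, Finset.mem_univ j, by simp⟩
    have hn : (List.ofFn rs).Nodup := List.nodup_ofFn.mpr hrs
    refine ⟨_, .uqTuple i rs _ hi hrs (fun _ => rfl), ⟨by simp [hi], hn, hV⟩, rfl, ?_⟩
    funext f
    exact gateOp_apply φ (by simp [hi]) hn hV f
  | qBeta M rs => exact ⟨.silent, .qBeta M rs _ (fun _ => rfl), trivial, rfl, rfl⟩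
  | @new V φ c r h h' hr =>
    refine ⟨.new c r, .new c r, hr, rfl, ?_⟩
    rfl
  | lBeta M N => exact ⟨.silent, .lBeta M N, trivial, rfl, rfl⟩
  | cBeta M N => exact ⟨.silent, .cBeta M N, trivial, rfl, rfl⟩
  | lCm L p M N => exact ⟨.silent, .lCm L p M N, trivial, rfl, rfl⟩
  | rCm p M N L => exact ⟨.silent, .rCm p M N L, trivial, rfl, rfl⟩
  | inTuple Ms i M' _ ih =>
    obtain ⟨a, h⟩ := ih
    exact ⟨a, h.of_term (.inTuple _ _ _ _ h.term) rfl rfl rfl rfl⟩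
  | rightApp M N N' _ ih =>
    obtain ⟨a, h⟩ := ih
    exact ⟨a, h.of_term (.rightApp _ _ _ _ h.term) rfl rfl rfl rfl⟩
  | leftApp M M' N _ ih =>
    obtain ⟨a, h⟩ := ih
    exact ⟨a, h.of_term (.leftApp _ _ _ _ h.term) rfl rfl rfl rfl⟩
  | inNew M M' _ ih =>
    obtain ⟨a, h⟩ := ih
    exact ⟨a, h.of_term (.inNew _ _ _ h.term) rfl rfl rfl rfl⟩
  | inLamBang M M' _ ih =>
    obtain ⟨a, h⟩ := ih
    exact ⟨a, h.of_term (.inLamBang _ _ _ h.term) rfl rfl rfl rfl⟩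
  | inLam p M M' _ ih =>
    obtain ⟨a, h⟩ := ih
    exact ⟨a, h.of_term (.inLam _ _ _ _ h.term) rfl rfl rfl rfl⟩

theorem qvars_inst_subset {k : ℕ} (Ns : Fin k → Term) (M : Term) :
    (inst Ns M).qvars ⊆ M.qvars ∪ Finset.univ.biUnion (fun j => (Ns j).qvars) := by
  intro r hr
  rw [mem_qvars_iff, wt_inst, liftW_zero] at hr
  simp only [Finset.mem_union, Finset.mem_biUnion, mem_qvars_iff, Finset.mem_univ, true_and]
  by_contra! h
  apply hr
  simp [h.1, h.2]

theorem qvars_shift (k : ℕ) (M : Term) : (shift k M).qvars = M.qvars := rename_qvars _ _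

theorem TStep.qvars_subset {t t' : Term} {a : Lab} (h : TStep U t a t') {V : Finset ℕ}
    (hV : t.qvars ⊆ V) : t'.qvars ⊆ a.vars V := by
  induction h with
  | qBeta M rs Ms hMs =>
    refine (qvars_inst_subset _ _).trans ?_
    exact hV
  | new c r => simp [qvars, Lab.vars]
  | lBeta M N =>
    refine (qvars_inst_subset _ _).trans ?_
    simpa [qvars, Lab.vars] using hV
  | cBeta M N =>
    refine (qvars_inst_subset _ _).trans ?_
    simpa [qvars, Lab.vars] using hV
  | lCm L p M N =>
    simp only [qvars, Finset.union_subset_iff, qvars_shift, Lab.vars] at hV ⊢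
    tauto
  | rCm p M N L =>
    simp only [qvars, Finset.union_subset_iff, qvars_shift, Lab.vars] at hV ⊢
    tauto
  | uqOne i r hi => simpa [qvars, Lab.vars] using hV
  | uqTuple i rs Ms hi hrs hMs => simpa [qvars, Lab.vars] using hV
  | inTuple Ms i a M' _ ih =>
    simp only [qvars, Finset.biUnion_subset_iff_forall_subset, Finset.mem_univ, true_imp_iff]
      at hV ⊢
    intro j
    by_cases h : j = i
    · subst h; simpa using ih (hV j)
    · rw [Function.update_of_ne h]
      refine (hV j).trans ?_
      cases a <;> simp [Lab.vars]
  | rightApp M N N' a _ ih =>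
    simp only [qvars, Finset.union_subset_iff] at hV ⊢
    refine ⟨hV.1.trans ?_, ih hV.2⟩
    cases a <;> simp [Lab.vars]
  | leftApp M M' N a _ ih =>
    simp only [qvars, Finset.union_subset_iff] at hV ⊢
    refine ⟨ih hV.1, hV.2.trans ?_⟩
    cases a <;> simp [Lab.vars]
  | inNew M M' a _ ih => exact ih hV
  | inLamBang M M' a _ ih => exact ih hV
  | inLam p M M' a _ ih => exact ih hV

/-- The register after a step. -/
def Lab.reg (U : ℕ → Gate) : (a : Lab) → {V : Finset ℕ} → HSpace V → HSpace (a.vars V)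
  | .silent, _, φ => φ
  | .gate i rs, _, φ => gateOp (U i) rs φ
  | .new c r, _, φ => extendReg φ r c

theorem TStep.step {t t' : Term} {a : Lab} (h : TStep U t a t') {V : Finset ℕ} (φ : HSpace V)
    (hV : t.qvars ⊆ V) (hV' : t'.qvars ⊆ a.vars V) (ha : ∀ c r, a = .new c r → r ∉ V) :
    PreConfig.Step U ⟨V, φ, t, hV⟩ ⟨a.vars V, a.reg U φ, t', hV'⟩ := by
  induction h with
  | uqOne i r hi => exact .uqOne i r hi
  | uqTuple i rs Ms hi hrs hMs =>
    obtain rfl : Ms = fun j => qvar (rs j) := funext hMs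
    exact .uqTuple i rs hi hrs
  | qBeta M rs Ms hMs =>
    obtain rfl : Ms = fun j => qvar (rs j) := funext hMs
    exact .qBeta M rs
  | new c r => exact .new c r (ha c r rfl)
  | lBeta M N => exact .lBeta M N
  | cBeta M N => exact .cBeta M N
  | lCm L p M N => exact .lCm L p M N
  | rCm p M N L => exact .rCm p M N L
  | inTuple Ms i a M' h ih =>
    have hi : (Ms i).qvars ⊆ V :=
      (Finset.subset_biUnion_of_mem (fun j => (Ms j).qvars) (Finset.mem_univ i)).trans hV
    exact .inTuple Ms i M' (ih hi (h.qvars_subset hi) ha)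
  | rightApp M N N' a h ih =>
    have hi : N.qvars ⊆ V := Finset.subset_union_right.trans hV
    exact .rightApp _ _ _ (ih hi (h.qvars_subset hi) ha)
  | leftApp M M' N a h ih =>
    have hi : M.qvars ⊆ V := Finset.subset_union_left.trans hV
    exact .leftApp _ _ _ (ih hi (h.qvars_subset hi) ha)
  | inNew M M' a h ih => exact .inNew _ _ (ih hV hV' ha)
  | inLamBang M M' a h ih => exact .inLamBang _ _ (ih hV hV' ha)
  | inLam p M M' a h ih => exact .inLam _ _ _ (ih hV hV' ha)

theorem TStep.gate_arity {t t' : Term} {l : Lab} (h : TStep U t l t') {i : ℕ} {rs : List ℕ}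
    (hl : l = .gate i rs) : rs.length = (U i).arity ∧ rs.Nodup := by
  induction h with
  | uqOne i' r hi => cases hl; simp [hi]
  | uqTuple i' rs' Ms hi hrs hMs => cases hl; exact ⟨by simp [hi], List.nodup_ofFn.mpr hrs⟩
  | inTuple Ms i a M' _ ih => exact ih hl
  | rightApp M N N' a _ ih => exact ih hl
  | leftApp M M' N a _ ih => exact ih hl
  | inNew M M' a _ ih => exact ih hl
  | inLamBang M M' a _ ih => exact ih hl
  | inLam p M M' a _ ih => exact ih hl
  | _ => simp at hl

/-- Arity, distinctness and presence of the qubits of a gate follow from the step of the term, since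
the variables of the term belong to the configuration. Only the freshness of a created name has to
be assumed. -/
theorem LStep.exists {P : PreConfig} {a : Lab} {t' : Term} (h : TStep U P.term a t')
    (ha : ∀ c r, a = .new c r → r ∉ P.vars) :
    ∃ P', PreConfig.Step U P P' ∧ LStep U P a P' ∧ P'.term = t' := by
  have hsub := h.qvars_subset P.sub
  have hs := h.step P.reg P.sub hsub ha
  refine ⟨_, hs, ⟨h, ?_, rfl, ?_⟩, rfl⟩
  · cases a with
    | silent => trivial
    | new c r => exact ha c r rfl
    | gate i rs =>
      have key := h.gate_arity rfl
      exact ⟨key.1, key.2, fun r hr => P.sub (h.gate_mem i rs rfl r hr)⟩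
  · cases a with
    | silent => rfl
    | new c r => rfl
    | gate i rs =>
      funext f
      have h1 := h.gate_arity rfl
      exact gateOp_apply P.reg h1.1 h1.2 (fun r hr => P.sub (h.gate_mem i rs rfl r hr)) f

end QCalc

end

noncomputable section

namespace QCalc
open Term

variable {U : ℕ → Gate}

/-! ### Permutations of the quantum variables -/

/-- The action on preconfigurations of a permutation of the quantum variables. -/
def PreConfig.map (θ : Equiv.Perm ℕ) (P : PreConfig) : PreConfig where
  vars := P.vars.image θ
  reg g := P.reg (fun v => g ⟨θ v, Finset.mem_image_of_mem θ v.2⟩)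
  term := P.term.mapQ θ
  sub := by rw [qvars_mapQ]; exact Finset.image_subset_image P.sub

theorem PreConfig.ext_map (θ : Equiv.Perm ℕ) (P : PreConfig) (f : ℕ → Bool) :
    (P.map θ).ext f = P.ext (fun v => f (θ v)) := rfl

theorem PreConfig.map_equiv (θ : Equiv.Perm ℕ) (P : PreConfig) : P.Equiv (P.map θ) := by
  refine ⟨θ, ?_, fun f => rfl, rfl⟩
  have : ((P.map θ).vars : Set ℕ) = θ '' P.vars := by simp [PreConfig.map]
  rw [this]
  exact θ.injective.injOn.bijOn_image

/-- The complements of two finite sets are countably infinite, so any bijection between them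
completes the given one. Thus equivalence of preconfigurations is the action of permutations, under
which steps can be transported. -/
theorem exists_perm_of_bijOn {V V' : Finset ℕ} {θ : ℕ → ℕ} (h : Set.BijOn θ V V') :
    ∃ e : Equiv.Perm ℕ, ∀ v ∈ V, e v = θ v := by
  classical
  have e1 : {x // x ∈ V} ≃ {x // x ∈ V'} := h.equiv
  have i1 : Infinite {x // x ∉ V} := V.finite_toSet.infinite_compl.to_subtype
  have i2 : Infinite {x // x ∉ V'} := V'.finite_toSet.infinite_compl.to_subtype
  obtain ⟨e2⟩ : Nonempty ({x // x ∉ V} ≃ {x // x ∉ V'}) := nonempty_equiv_of_countable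
  refine ⟨Equiv.subtypeCongr (p := fun x => x ∈ V) (q := fun x => x ∈ V') (h.equiv θ) e2,
    fun v hv => ?_⟩
  simp [Equiv.subtypeCongr, Equiv.sumCompl_symm_apply_of_pos (p := fun x => x ∈ V) hv]
  rfl

theorem PreConfig.Equiv.exists_perm {P P' : PreConfig} (h : P.Equiv P') :
    ∃ θ : Equiv.Perm ℕ, P' = P.map θ := by
  obtain ⟨θ, hθ, hreg, hterm⟩ := h
  obtain ⟨e, he⟩ := exists_perm_of_bijOn hθ
  refine ⟨e, PreConfig.eq_of ?_ ?_ ?_⟩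
  · apply Finset.coe_injective
    simp only [PreConfig.map, Finset.coe_image]
    rw [← hθ.image_eq]
    exact Set.image_congr (fun v hv => (he v hv).symm)
  · funext f
    refine (hreg f).trans ?_
    exact P.ext_congr (f := fun v => f (θ v)) (g := fun v => f (e v))
      (fun v hv => by rw [he v hv])
  · rw [hterm]
    exact mapQ_congr _ (fun r hr => (he r (P.sub hr)).symm)

theorem updBits_map (θ : Equiv.Perm ℕ) (rs : List ℕ) {k : ℕ} (x : Fin k → Bool) (f : ℕ → Bool)
    (v : ℕ) : updBits (rs.map θ) x f (θ v) = updBits rs x (fun v => f (θ v)) v := by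
  have : (rs.map θ).idxOf (θ v) = rs.idxOf v := by
    induction rs with
    | nil => rfl
    | cons r rs ih =>
      rw [List.map_cons, List.idxOf_cons, List.idxOf_cons, ih]
      have : (θ r == θ v) = (r == v) := by
        rw [Bool.eq_iff_iff, beq_iff_eq, beq_iff_eq, θ.apply_eq_iff_eq]
      rw [this]
  simp only [updBits, this]

theorem gateSem_map (θ : Equiv.Perm ℕ) {G : Gate} {rs : List ℕ} (hG : rs.length = G.arity)
    (Φ : (ℕ → Bool) → ℂ) (f : ℕ → Bool) :
    gateSem G (rs.map θ) (fun f => Φ (fun v => f (θ v))) f =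
      gateSem G rs Φ (fun v => f (θ v)) := by
  unfold gateSem
  refine Finset.sum_congr rfl (fun x _ => ?_)
  simp only [updBits_map]
  congr 3
  funext i
  have hi : (i : ℕ) < rs.length := by rw [hG]; exact i.2
  simp [List.getElem?_eq_getElem hi]

theorem Lab.act_map (θ : Equiv.Perm ℕ) {a : Lab} {V : Finset ℕ} (ha : a.Enabled U V)
    (Φ : (ℕ → Bool) → ℂ) (f : ℕ → Bool) :
    (a.mapQ θ).act U (fun f => Φ (fun v => f (θ v))) f = a.act U Φ (fun v => f (θ v)) := by
  cases a with
  | silent => rfl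
  | new c r => rfl
  | gate i rs => exact gateSem_map θ ha.1 Φ f

theorem Lab.vars_map (θ : Equiv.Perm ℕ) (a : Lab) (V : Finset ℕ) :
    (a.mapQ θ).vars (V.image θ) = (a.vars V).image θ := by
  cases a <;> simp [Lab.vars, Lab.mapQ, Finset.image_insert]

theorem LStep.map {P Q : PreConfig} {a : Lab} (h : LStep U P a Q) (θ : Equiv.Perm ℕ) :
    LStep U (P.map θ) (a.mapQ θ) (Q.map θ) := by
  refine ⟨h.term.mapQ θ.injective, ?_, ?_, ?_⟩
  · have := h.enabled
    cases a with
    | silent => trivial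
    | new c r => simpa [Lab.Enabled, Lab.mapQ, PreConfig.map] using this
    | gate i rs =>
      obtain ⟨h1, h2, h3⟩ := this
      refine ⟨by simpa using h1, h2.map θ.injective, ?_⟩
      simpa [PreConfig.map] using h3
  · exact (congrArg (Finset.image θ) h.vars).trans (Lab.vars_map θ a P.vars).symm
  · funext f
    rw [PreConfig.ext_map, h.ext]
    exact (Lab.act_map θ h.enabled P.ext f).symm

theorem LStep.step {P Q : PreConfig} {a : Lab} (h : LStep U P a Q) : PreConfig.Step U P Q := by
  obtain ⟨Q', hs, hl, ht⟩ := LStep.exists h.term (fun c r e => by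
    have := h.enabled
    rw [e] at this
    exact this)
  have : Q' = Q := PreConfig.eq_of (by rw [hl.vars, h.vars]) (by rw [hl.ext, h.ext]) ht
  exact this ▸ hs

theorem Config.mk_map (θ : Equiv.Perm ℕ) (P : PreConfig) :
    (Quotient.mk _ (P.map θ) : Config) = Quotient.mk _ P :=
  Quotient.sound (PreConfig.equiv_symm (P.map_equiv θ))

/-- A step of the class of `P` may use another representative; a permutation brings the step back to
`P`. Two steps of one configuration can therefore be compared from a common preconfiguration. -/
theorem Config.Step.exists_lstep {P : PreConfig} {C : Config}
    (h : Config.Step U (Quotient.mk _ P) C) :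
    ∃ a Q, C = Quotient.mk _ Q ∧ LStep U P a Q := by
  obtain ⟨P₁, Q₁, h1, rfl, hs⟩ := h
  obtain ⟨θ, rfl⟩ := (PreConfig.equiv_symm (Quotient.exact h1)).exists_perm
  obtain ⟨a, hl⟩ := hs.lstep
  exact ⟨_, Q₁.map θ, (Config.mk_map θ Q₁).symm, hl.map θ⟩

/-! ### Confluence -/

/-- Linear terms whose arguments are values and in which no quantum variable is duplicated. -/
def Good (t : Term) : Prop := ok false t ∧ ∀ r, wt 0 (Pi.single r 1) t ≤ 1

/-- Weights at most 1 are preserved, and a created name, being fresh, rises from weight 0 to weight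
1. -/
theorem Good.step {t t' : Term} {a : Lab} (hg : Good t) (h : TStep U t a t') (ha : a.Fresh t) :
    Good t' := by
  refine ⟨h.ok false hg.1, fun r => ?_⟩
  rw [h.wt_eq false 0 (Pi.single r 1) hg.1 (hg.2 r)]
  cases a with
  | silent => exact hg.2 r
  | gate i rs => exact hg.2 r
  | new c s =>
    simp only [Lab.weight, Pi.single_apply]
    split_ifs with h
    · have h0 := ha
      simp only [Lab.Fresh, mem_qvars_iff, not_not] at h0
      rw [← h, h0]
    · exact hg.2 r

theorem LStep.fresh {P Q : PreConfig} {a : Lab} (h : LStep U P a Q) : a.Fresh P.term := by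
  have := h.enabled
  cases a with
  | new c r => exact fun hr => this (P.sub hr)
  | _ => trivial

/-- Configurations whose term is good. -/
def Config.Good (C : Config) : Prop := ∃ P : PreConfig, C = Quotient.mk _ P ∧ QCalc.Good P.term

theorem Config.Good.step {C C' : Config} (h : C.Good) (hs : Config.Step U C C') : C'.Good := by
  obtain ⟨P, rfl, hP⟩ := h
  obtain ⟨a, Q, rfl, hl⟩ := hs.exists_lstep
  exact ⟨Q, rfl, hP.step hl.term hl.fresh⟩

theorem Lab.act_comm {a b : Lab} {V : Finset ℕ} (ha : a.Enabled U V) (hb : b.Enabled U V)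
    (hi : a.Indep b) (Φ : (ℕ → Bool) → ℂ) : a.act U (b.act U Φ) = b.act U (a.act U Φ) := by
  cases a with
  | silent => rfl
  | gate i rs =>
    cases b with
    | silent => rfl
    | gate j ss => exact gateSem_comm ha.1 hb.1 hi Φ
    | new c r => exact gateSem_newSem ha.1 c (fun hr => hb (ha.2.2 r hr)) Φ
  | new c r =>
    cases b with
    | silent => rfl
    | gate j ss => exact (gateSem_newSem hb.1 c (fun hr => ha (hb.2.2 r hr)) Φ).symm
    | new d s => exact newSem_comm c d r s Φ

theorem Lab.vars_comm (a b : Lab) (V : Finset ℕ) : a.vars (b.vars V) = b.vars (a.vars V) := by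
  cases a <;> cases b <;> simp [Lab.vars, Finset.insert_comm]

theorem PreConfig.map_swap_eq {P : PreConfig} {r s : ℕ} (hr : r ∉ P.vars) (hs : s ∉ P.vars) :
    P.map (Equiv.swap r s) = P := by
  have hfix : ∀ v ∈ P.vars, Equiv.swap r s v = v := fun v hv =>
    Equiv.swap_apply_of_ne_of_ne (fun e => hr (e ▸ hv)) (fun e => hs (e ▸ hv))
  refine PreConfig.eq_of ?_ ?_ ?_
  · simp only [PreConfig.map]
    rw [Finset.image_congr (g := id) (fun v hv => hfix v hv), Finset.image_id]
  · funext f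
    exact P.ext_congr (f := fun v => f (Equiv.swap r s v)) (g := f)
      (fun v hv => by rw [hfix v hv])
  · exact mapQ_eq_self _ (fun v hv => hfix v (P.sub hv))

theorem LStep.fresh_of_apart {P Q : PreConfig} {a b : Lab} (h : LStep U P a Q)
    (hb : b.Enabled U P.vars) (hab : a.Apart b) : ∀ c r, b = .new c r → r ∉ Q.vars := by
  rintro c r rfl
  rw [h.vars]
  cases a with
  | new d s => simpa [Lab.vars, Finset.mem_insert, not_or] using ⟨Ne.symm hab, hb⟩
  | _ => exact hb

/-- The alternatives of `Peak` are lifted to registers. Distinct created names are required so that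
each step remains possible after the other. -/
theorem LStep.join_of_apart {P A B : PreConfig} {a b : Lab} (hP : Good P.term)
    (hA : LStep U P a A) (hB : LStep U P b B) (hab : a.Apart b) :
    ∃ D : Config, Relation.ReflGen (Config.Step U) (Quotient.mk _ A) D ∧
      Relation.ReflGen (Config.Step U) (Quotient.mk _ B) D := by
  rcases hA.term.peak false b B.term hB.term hP.1 hP.2 hA.fresh hB.fresh with
    ⟨rfl, ht⟩ | ⟨hi, t', h1, h2⟩ | ⟨rfl, rfl, h⟩ | ⟨c, r, s, rfl, rfl, ht⟩
  · have : A = B := PreConfig.eq_of (by rw [hA.vars, hB.vars]) (by rw [hA.ext, hB.ext]) ht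
    exact ⟨_, .refl, this ▸ .refl⟩
  · obtain ⟨D, hD, hDl, hDt⟩ := LStep.exists h1 (hA.fresh_of_apart hB.enabled hab)
    obtain ⟨D', hD', hDl', hDt'⟩ := LStep.exists h2 (hB.fresh_of_apart hA.enabled hab.symm)
    have : D = D' := by
      refine PreConfig.eq_of ?_ ?_ (hDt.trans hDt'.symm)
      · rw [hDl.vars, hDl'.vars, hA.vars, hB.vars, Lab.vars_comm]
      · rw [hDl.ext, hDl'.ext, hA.ext, hB.ext, Lab.act_comm hA.enabled hB.enabled hi]
    exact ⟨_, .single ⟨_, _, rfl, rfl, hD⟩, .single ⟨_, _, rfl, by rw [this], hD'⟩⟩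
  · rcases h with h | h
    · have hs : LStep U A .silent B :=
        ⟨h, trivial, by rw [hB.vars, hA.vars]; rfl, by rw [hB.ext, hA.ext]; rfl⟩
      exact ⟨_, .single ⟨_, _, rfl, rfl, hs.step⟩, .refl⟩
    · have hs : LStep U B .silent A :=
        ⟨h, trivial, by rw [hB.vars, hA.vars]; rfl, by rw [hB.ext, hA.ext]; rfl⟩
      exact ⟨_, .refl, .single ⟨_, _, rfl, rfl, hs.step⟩⟩
  · have hr : r ∉ P.vars := hA.enabled
    have hs : s ∉ P.vars := hB.enabled
    -- The transposition fixes `P`, in which neither name occurs, and so carries the first step to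
    -- one with the label of the second. The results then differ by a renaming and represent the
    -- same configuration.
    have : B = A.map (Equiv.swap r s) := by
      have hl := hA.map (Equiv.swap r s)
      rw [PreConfig.map_swap_eq hr hs] at hl
      have e : (Lab.new c r).mapQ (Equiv.swap r s) = .new c s := by simp [Lab.mapQ]
      rw [e] at hl
      exact PreConfig.eq_of (by rw [hl.vars, hB.vars]) (by rw [hl.ext, hB.ext]) ht
    refine ⟨_, .refl, ?_⟩
    rw [this, Config.mk_map]
    exact .refl

theorem Config.Step.join {C A B : Config} (hC : C.Good) (hA : Config.Step U C A)
    (hB : Config.Step U C B) :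
    ∃ D, Relation.ReflGen (Config.Step U) A D ∧ Relation.ReflGen (Config.Step U) B D := by
  obtain ⟨P, rfl, hP⟩ := hC
  obtain ⟨a, A', rfl, lA⟩ := Config.Step.exists_lstep hA
  obtain ⟨b, B', rfl, lB⟩ := Config.Step.exists_lstep hB
  by_cases hab : a.Apart b
  · exact lA.join_of_apart hP lB hab
  · cases a with
    | new c r =>
      cases b with
      | new d s =>
        -- Two creations with the same name: the second result is renamed to use a name that is
        -- fresh also with respect to the first one, which does not change its class.
        obtain ⟨s', hs'⟩ := Infinite.exists_notMem_finset (insert r P.vars)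
        rw [Finset.mem_insert, not_or] at hs'
        have hl := lB.map (Equiv.swap s s')
        rw [PreConfig.map_swap_eq lB.enabled hs'.2] at hl
        have e : (Lab.new d s).mapQ (Equiv.swap s s') = .new d s' := by simp [Lab.mapQ]
        rw [e] at hl
        rw [← Config.mk_map (Equiv.swap s s') B']
        exact lA.join_of_apart hP hl (Ne.symm hs'.1)
      | _ => exact absurd trivial hab
    | _ => exact absurd trivial hab

/-- Good configurations have at most one normal form. -/
theorem Config.Evaluates.unique {C A B : Config} (hC : C.Good) (hA : Config.Evaluates U C A)
    (hB : Config.Evaluates U C B) : A = B := by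
  -- Steps can be joined from good configurations only, so goodness of the source is made part of
  -- the relation; it propagates along reductions.
  let R : Config → Config → Prop := fun C D => C.Good ∧ Config.Step U C D
  have lift : ∀ {D : Config}, Relation.ReflTransGen (Config.Step U) C D →
      Relation.ReflTransGen R C D ∧ D.Good := by
    intro D h
    induction h with
    | refl => exact ⟨.refl, hC⟩
    | tail _ hs ih => exact ⟨ih.1.tail ⟨ih.2, hs⟩, ih.2.step hs⟩
  have hnf : ∀ {D E : Config}, Config.IsNormal U D → Relation.ReflTransGen R D E → D = E := by
    intro D E hn h
    rcases Relation.ReflTransGen.cases_head h with rfl | ⟨F, hF, _⟩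
    · rfl
    · exact absurd hF.2 (hn F)
  -- At most one step closes each side of a peak, which is stronger than local confluence and
  -- suffices for confluence.
  obtain ⟨D, h1, h2⟩ := Relation.church_rosser (r := R) (fun a b c hb hc => by
    obtain ⟨d, h1, h2⟩ := Config.Step.join hb.1 hb.2 hc.2
    have gb := hb.1.step hb.2
    have gc := hc.1.step hc.2
    refine ⟨d, ?_, ?_⟩
    · cases h1 with
      | refl => exact .refl
      | single h => exact .single ⟨gb, h⟩
    · cases h2 with
      | refl => exact .refl
      | single h => exact .single ⟨gc, h⟩) (lift hA.1).1 (lift hB.1).1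
  exact (hnf hA.2 h1).trans (hnf hB.2 h2).symm

end QCalc

end

noncomputable section

set_option linter.unusedSimpArgs false

namespace QCalc
open Term

variable {U : ℕ → Gate}

/-! ### Evaluation of spines -/

/-- The substitution `N, σ 0, σ 1, …`. -/
def scons (N : Term) (σ : ℕ → Term) : ℕ → Term
  | 0 => N
  | i + 1 => σ i

theorem inst_subst_liftSub (N : Term) (σ : ℕ → Term) (M : Term) :
    inst (fun _ : Fin 1 => N) (subst (liftSub 1 σ) M) = subst (scons N σ) M := by
  unfold inst
  rw [subst_subst]
  congr 1
  funext i
  cases i with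
  | zero => simp [liftSub, subst, scons]
  | succ i =>
    simp [liftSub, scons, shift, subst_rename, subst_var]

/-- Application to several arguments. -/
def apps (f : Term) (as : List Term) : Term := as.foldl app f

/-- Reduction without effects on the register. -/
def Red (U : ℕ → Gate) : Term → Term → Prop :=
  Relation.ReflTransGen (fun t t' => TStep U t .silent t')

theorem TStep.apps {t t' : Term} {a : Lab} (h : TStep U t a t') (as : List Term) :
    TStep U (apps t as) a (QCalc.apps t' as) := by
  induction as generalizing t t' with
  | nil => exact h
  | cons b as ih => exact ih (.leftApp _ _ _ _ h)

theorem run_app {f a T : Term} {as : List Term} (h : Red U (apps f (a :: as)) T) :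
    Red U (apps (app f a) as) T := h

theorem run_step {t t' T : Term} {as : List Term} (hs : TStep U t .silent t')
    (h : Red U (apps t' as) T) : Red U (apps t as) T :=
  .head (hs.apps as) h

/-- Head reduction is organized as an abstract machine: a term with pending substitution `σ` as
environment, applied to a stack `as`. An abstraction takes the top of the stack into the
environment, so no instantiated body has to be computed before its variables reach the head. -/
theorem run_bang {N M T : Term} {σ : ℕ → Term} {as : List Term}
    (h : Red U (apps (subst (scons N σ) M) as) T) :
    Red U (apps (subst σ (lamBang M)) (bang N :: as)) T := by
  refine run_step (as := as) (t := app (subst σ (lamBang M)) (bang N)) ?_ h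
  rw [← inst_subst_liftSub]
  exact .cBeta _ _

theorem run_lam {N M T : Term} {σ : ℕ → Term} {as : List Term}
    (h : Red U (apps (subst (scons N σ) M) as) T) :
    Red U (apps (subst σ (lam Pat.var M)) (N :: as)) T := by
  refine run_step (as := as) (t := app (subst σ (lam Pat.var M)) N) ?_ h
  rw [← inst_subst_liftSub]
  exact .lBeta _ _

/-! ### Data -/

/-- The numeral `0`. -/
def zeroT : Term := lamBang (lamBang (var 1))

/-- The successor of a numeral. -/
def succT (N : Term) : Term := lamBang (lamBang (app (var 0) (bang (shift 2 N))))

/-- The empty list of duplicable data. -/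
def nilT : Term := lamBang (lamBang (var 1))

/-- Lists of duplicable data. -/
def consT (N L : Term) : Term :=
  lamBang (lamBang (app (app (var 0) (bang (shift 2 N))) (bang (shift 2 L))))

/-- Lists with linear contents. -/
def qconsT (N L : Term) : Term :=
  lamBang (lamBang (app (app (var 1) (shift 2 N)) (shift 2 L)))

/-- The empty list with linear contents. -/
def qnilT : Term := lamBang (lamBang (var 0))

theorem shift_two (M : Term) : shift 2 M = shift 1 (shift 1 M) := by
  simp [shift, rename_rename]

theorem subst_zeroT (σ : ℕ → Term) : subst σ zeroT = zeroT := rfl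
theorem subst_nilT (σ : ℕ → Term) : subst σ nilT = nilT := rfl
theorem subst_qnilT (σ : ℕ → Term) : subst σ qnilT = qnilT := rfl

theorem subst_succT (σ : ℕ → Term) (N : Term) : subst σ (succT N) = succT (subst σ N) := by
  simp only [succT, shift_two, subst, subst_shift]
  rfl

theorem subst_consT (σ : ℕ → Term) (N L : Term) :
    subst σ (consT N L) = consT (subst σ N) (subst σ L) := by
  simp only [consT, shift_two, subst, subst_shift]
  rfl

theorem subst_qconsT (σ : ℕ → Term) (N L : Term) :
    subst σ (qconsT N L) = qconsT (subst σ N) (subst σ L) := by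
  simp only [qconsT, shift_two, subst, subst_shift]
  rfl

theorem subst_scons_shift (N : Term) (σ : ℕ → Term) (M : Term) :
    subst (scons N σ) (shift 1 M) = subst σ M := by
  simp [shift, subst_rename, scons]

theorem run_zeroT {A B T : Term} {as : List Term} (h : Red U (apps A as) T) :
    Red U (apps zeroT (bang A :: bang B :: as)) T := by
  -- The identity substitution serves as the initial environment.
  rw [← subst_zeroT var]
  exact run_bang (run_bang h)

theorem run_nilT {A B T : Term} {as : List Term} (h : Red U (apps A as) T) :
    Red U (apps nilT (bang A :: bang B :: as)) T := run_zeroT h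

theorem run_qnilT {A B T : Term} {as : List Term} (h : Red U (apps B as) T) :
    Red U (apps qnilT (bang A :: bang B :: as)) T := by
  rw [← subst_qnilT var]
  exact run_bang (run_bang h)

theorem run_succT {N A B T : Term} {as : List Term} (h : Red U (apps B (bang N :: as)) T) :
    Red U (apps (succT N) (bang A :: bang B :: as)) T := by
  rw [← subst_var (succT N), succT]
  refine run_bang (run_bang ?_)
  simp only [subst, shift_two, subst_scons_shift, subst_var, scons]
  exact h

theorem run_consT {N L A B T : Term} {as : List Term}
    (h : Red U (apps B (bang N :: bang L :: as)) T) :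
    Red U (apps (consT N L) (bang A :: bang B :: as)) T := by
  rw [← subst_var (consT N L), consT]
  refine run_bang (run_bang ?_)
  simp only [subst, shift_two, subst_scons_shift, subst_var, scons]
  exact h

theorem run_qconsT {N L A B T : Term} {as : List Term} (h : Red U (apps A (N :: L :: as)) T) :
    Red U (apps (qconsT N L) (bang A :: bang B :: as)) T := by
  rw [← subst_var (qconsT N L), qconsT]
  refine run_bang (run_bang ?_)
  simp only [subst, shift_two, subst_scons_shift, subst_var, scons]
  exact h

/-- Numerals. -/
def natT : ℕ → Term
  | 0 => zeroT
  | n + 1 => succT (natT n)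

/-- Lists of numerals. -/
def listT : List ℕ → Term
  | [] => nilT
  | n :: l => consT (natT n) (listT l)

/-! ### Terms for partial recursive functions -/

local notation:75 f:75 " ⬝ " x:76 => Term.app f (Term.bang x)
local prefix:max "ƛ" => lamBang
local prefix:max "#" => Term.var

open Turing.ToPartrec (Code)

/-- The iteration of a closed term `F`: the result of `F` is passed again to `F` as long as its head
is not `0`. -/
def loopT (F : Term) : Term :=
  ƛ(ƛ(ƛ(F ⬝ ƛ(#0 ⬝ ƛ(ƛ(#0 ⬝ nilT)) ⬝ ƛ(ƛ(ƛ(ƛ(#3 ⬝ ƛ(ƛ(ƛ(#0 ⬝ #2))) ⬝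
    ƛ(ƛ(ƛ(ƛ(#1 ⬝ #1 ⬝ #0 ⬝ #2)))) ⬝ #2 ⬝ #1 ⬝ #0)))) ⬝ #3 ⬝ #2) ⬝ #0)))

/-- A closed term which applies a continuation to the value of a code. -/
def codeT : Code → Term
  | .zero' => ƛ(ƛ(#1 ⬝ consT zeroT #0))
  | .succ => ƛ(ƛ(#0 ⬝ ƛ(#0 ⬝ consT (succT zeroT) nilT) ⬝ ƛ(ƛ(ƛ(#0 ⬝ consT (succT #2) nilT))) ⬝ #1))
  | .tail => ƛ(ƛ(#0 ⬝ ƛ(#0 ⬝ nilT) ⬝ ƛ(ƛ(ƛ(#0 ⬝ #1))) ⬝ #1))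
  | .cons f g => ƛ(ƛ(codeT f ⬝ ƛ(codeT g ⬝ ƛ(#1 ⬝ ƛ(ƛ(#1 ⬝ consT zeroT #0)) ⬝
      ƛ(ƛ(ƛ(ƛ(#1 ⬝ consT #3 #0)))) ⬝ #3 ⬝ #0) ⬝ #1) ⬝ #0))
  | .comp f g => ƛ(ƛ(codeT g ⬝ ƛ(codeT f ⬝ #2 ⬝ #0) ⬝ #0))
  | .case f g => ƛ(ƛ(#0 ⬝ ƛ(codeT f ⬝ #0 ⬝ nilT) ⬝ ƛ(ƛ(ƛ(#2 ⬝ ƛ(ƛ(codeT f ⬝ #1 ⬝ #0)) ⬝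
      ƛ(ƛ(ƛ(codeT g ⬝ #1 ⬝ consT #2 #0))) ⬝ #0 ⬝ #1))) ⬝ #1))
  | .fix f => ƛ(ƛ(loopT (codeT f) ⬝ loopT (codeT f) ⬝ #1 ⬝ #0))

theorem cnt_shift_two (i : ℕ) (M : Term) : cnt (i + 2) (shift 2 M) = cnt i M := by
  have := wt_liftW_shift 2 M (Pi.single i 1) 0
  rwa [liftW_single] at this

@[simp] theorem cnt_zeroT (i : ℕ) : cnt i zeroT = 0 := by simp [zeroT]
@[simp] theorem cnt_nilT (i : ℕ) : cnt i nilT = 0 := by simp [nilT]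
@[simp] theorem cnt_qnilT (i : ℕ) : cnt i qnilT = 0 := by simp [qnilT]
@[simp] theorem cnt_succT (i : ℕ) (N : Term) : cnt i (succT N) = 2 * cnt i N := by
  simp [succT, cnt_shift_two]
@[simp] theorem cnt_consT (i : ℕ) (N L : Term) :
    cnt i (consT N L) = 2 * cnt i N + 2 * cnt i L := by
  simp [consT, cnt_shift_two]
@[simp] theorem cnt_qconsT (i : ℕ) (N L : Term) :
    cnt i (qconsT N L) = cnt i N + cnt i L := by
  simp [qconsT, cnt_shift_two]

theorem subst_of_closed {M : Term} (h : ∀ i, cnt i M = 0) (σ : ℕ → Term) : subst σ M = M := by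
  rw [subst_congr M σ var (fun i hi => absurd (h i) hi), subst_var]

@[simp] theorem cnt_codeT (c : Code) (i : ℕ) : cnt i (codeT c) = 0 := by
  induction c generalizing i <;> simp_all [codeT, loopT]

theorem subst_codeT (c : Code) (σ : ℕ → Term) : subst σ (codeT c) = codeT c :=
  subst_of_closed (cnt_codeT c) σ

theorem subst_loopT (c : Code) (σ : ℕ → Term) : subst σ (loopT (codeT c)) = loopT (codeT c) :=
  subst_of_closed (by simp [loopT]) σ

theorem subst_v (σ : ℕ → Term) (i : ℕ) : subst σ (var i) = σ i := rfl
theorem subst_app (σ : ℕ → Term) (M N : Term) : subst σ (app M N) = app (subst σ M) (subst σ N) := rfl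
theorem subst_bang (σ : ℕ → Term) (M : Term) : subst σ (bang M) = bang (subst σ M) := rfl

theorem scons_zero (N : Term) (σ : ℕ → Term) : scons N σ 0 = N := rfl
theorem scons_succ (N : Term) (σ : ℕ → Term) (i : ℕ) : scons N σ (i + 1) = σ i := rfl

/-- The interior of `!M` never reduces, so a result cannot be computed in place as duplicable data;
it is handed to the continuation `k` instead. The arbitrary stack `as` and target `T` allow the
induction hypotheses to be applied in the middle of a run. -/
theorem red_codeT (c : Code) : ∀ (v w : List ℕ) (k T : Term) (as : List Term), w ∈ c.eval v →
    Red U (apps k (bang (listT w) :: as)) T →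
    Red U (apps (codeT c) (bang k :: bang (listT v) :: as)) T := by
  induction c with
  | zero' =>
    intro v w k T as hw h
    obtain rfl : w = 0 :: v := by simpa using hw
    rw [← subst_codeT _ var, codeT]
    simp only [listT, natT] at h
    -- This loop executes the machine: each `apply` is a transition at the head, each `simp only`
    -- looks up variables in the environment. Reducible transparency keeps numerals, lists and codes
    -- folded, so their own transitions are used.
    repeat' (with_reducible
      first
      | exact h | apply run_app | apply run_nilT | apply run_consT
      | apply run_zeroT | apply run_succT | apply run_bang
      | simp only [subst_succT, subst_consT, subst_zeroT, subst_nilT, scons_zero, scons_succ,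
        subst_v, subst_app, subst_bang, subst_codeT, subst_loopT])
  | succ =>
    intro v w k T as hw h
    obtain rfl : w = [v.headI.succ] := by simpa using hw
    rw [← subst_codeT _ var, codeT]
    cases v with
    | nil =>
      simp only [listT, natT, List.headI, Nat.default_eq_zero] at h ⊢
      repeat' (with_reducible
        first
        | exact h | apply run_app | apply run_nilT | apply run_consT
        | apply run_zeroT | apply run_succT | apply run_bang
        | simp only [subst_succT, subst_consT, subst_zeroT, subst_nilT, scons_zero, scons_succ,
          subst_v, subst_app, subst_bang, subst_codeT, subst_loopT])
    | cons n v =>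
      simp only [listT, natT, List.headI, Nat.default_eq_zero] at h ⊢
      repeat' (with_reducible
        first
        | exact h | apply run_app | apply run_nilT | apply run_consT
        | apply run_zeroT | apply run_succT | apply run_bang
        | simp only [subst_succT, subst_consT, subst_zeroT, subst_nilT, scons_zero, scons_succ,
          subst_v, subst_app, subst_bang, subst_codeT, subst_loopT])
  | tail =>
    intro v w k T as hw h
    obtain rfl : w = v.tail := by simpa using hw
    rw [← subst_codeT _ var, codeT]
    cases v with
    | nil =>
      simp only [listT, List.tail] at h ⊢
      repeat' (with_reducible
        first
        | exact h | apply run_app | apply run_nilT | apply run_consT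
        | apply run_zeroT | apply run_succT | apply run_bang
        | simp only [subst_succT, subst_consT, subst_zeroT, subst_nilT, scons_zero, scons_succ,
          subst_v, subst_app, subst_bang, subst_codeT, subst_loopT])
    | cons n v =>
      simp only [listT, List.tail] at h ⊢
      repeat' (with_reducible
        first
        | exact h | apply run_app | apply run_nilT | apply run_consT
        | apply run_zeroT | apply run_succT | apply run_bang
        | simp only [subst_succT, subst_consT, subst_zeroT, subst_nilT, scons_zero, scons_succ,
          subst_v, subst_app, subst_bang, subst_codeT, subst_loopT])
  | cons f g ihf ihg =>
    intro v w k T as hw h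
    simp only [Code.eval, Part.bind_eq_bind, Part.mem_bind_iff, Part.pure_eq_some,
      Part.mem_some_iff] at hw
    obtain ⟨a, ha, b, hb, rfl⟩ := hw
    rw [← subst_codeT _ var, codeT]
    repeat' (with_reducible
      first
      | exact h | apply run_app | apply run_nilT | apply run_consT
      | apply run_zeroT | apply run_succT | apply run_bang
      | simp only [subst_succT, subst_consT, subst_zeroT, subst_nilT, scons_zero, scons_succ,
        subst_v, subst_app, subst_bang, subst_codeT, subst_loopT])
    refine ihf v a _ T as ha ?_
    repeat' (with_reducible
      first
      | exact h | apply run_app | apply run_nilT | apply run_consT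
      | apply run_zeroT | apply run_succT | apply run_bang
      | simp only [subst_succT, subst_consT, subst_zeroT, subst_nilT, scons_zero, scons_succ,
        subst_v, subst_app, subst_bang, subst_codeT, subst_loopT])
    refine ihg v b _ T as hb ?_
    cases a with
    | nil =>
      simp only [listT, natT, List.headI, Nat.default_eq_zero] at h ⊢
      repeat' (with_reducible
        first
        | exact h | apply run_app | apply run_nilT | apply run_consT
        | apply run_zeroT | apply run_succT | apply run_bang
        | simp only [subst_succT, subst_consT, subst_zeroT, subst_nilT, scons_zero, scons_succ,
          subst_v, subst_app, subst_bang, subst_codeT, subst_loopT])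
    | cons n a =>
      simp only [listT, List.headI] at h ⊢
      repeat' (with_reducible
        first
        | exact h | apply run_app | apply run_nilT | apply run_consT
        | apply run_zeroT | apply run_succT | apply run_bang
        | simp only [subst_succT, subst_consT, subst_zeroT, subst_nilT, scons_zero, scons_succ,
          subst_v, subst_app, subst_bang, subst_codeT, subst_loopT])
  | comp f g ihf ihg =>
    intro v w k T as hw h
    obtain ⟨a, ha, hb⟩ := Part.mem_bind_iff.mp hw
    rw [← subst_codeT _ var, codeT]
    repeat' (with_reducible
      first
      | exact h | apply run_app | apply run_nilT | apply run_consT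
      | apply run_zeroT | apply run_succT | apply run_bang
      | simp only [subst_succT, subst_consT, subst_zeroT, subst_nilT, scons_zero, scons_succ,
        subst_v, subst_app, subst_bang, subst_codeT, subst_loopT])
    refine ihg v a _ T as ha ?_
    repeat' (with_reducible
      first
      | exact h | apply run_app | apply run_nilT | apply run_consT
      | apply run_zeroT | apply run_succT | apply run_bang
      | simp only [subst_succT, subst_consT, subst_zeroT, subst_nilT, scons_zero, scons_succ,
        subst_v, subst_app, subst_bang, subst_codeT, subst_loopT])
    exact ihf a w _ T as hb h
  | case f g ihf ihg =>
    intro v w k T as hw h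
    rw [← subst_codeT _ var, codeT]
    cases v with
    | nil =>
      simp only [listT]
      repeat' (with_reducible
        first
        | exact h | apply run_app | apply run_nilT | apply run_consT
        | apply run_zeroT | apply run_succT | apply run_bang
        | simp only [subst_succT, subst_consT, subst_zeroT, subst_nilT, scons_zero, scons_succ,
          subst_v, subst_app, subst_bang, subst_codeT, subst_loopT])
      exact ihf [] w _ T as hw h
    | cons n v =>
      simp only [listT]
      cases n with
      | zero =>
        simp only [natT]
        repeat' (with_reducible
          first
          | exact h | apply run_app | apply run_nilT | apply run_consT
          | apply run_zeroT | apply run_succT | apply run_bang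
          | simp only [subst_succT, subst_consT, subst_zeroT, subst_nilT, scons_zero, scons_succ,
            subst_v, subst_app, subst_bang, subst_codeT, subst_loopT])
        exact ihf v w _ T as hw h
      | succ n =>
        simp only [natT]
        repeat' (with_reducible
          first
          | exact h | apply run_app | apply run_nilT | apply run_consT
          | apply run_zeroT | apply run_succT | apply run_bang
          | simp only [subst_succT, subst_consT, subst_zeroT, subst_nilT, scons_zero, scons_succ,
            subst_v, subst_app, subst_bang, subst_codeT, subst_loopT])
        exact ihg (n :: v) w _ T as hw h
  | fix f ih =>
    intro v w k T as hw h
    rw [← subst_codeT _ var, codeT]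
    repeat' (with_reducible
      first
      | exact h | apply run_app | apply run_nilT | apply run_consT
      | apply run_zeroT | apply run_succT | apply run_bang
      | simp only [subst_succT, subst_consT, subst_zeroT, subst_nilT, scons_zero, scons_succ,
        subst_v, subst_app, subst_bang, subst_codeT, subst_loopT])
    -- The loop receives a copy of itself as its first argument. The induction follows the
    -- terminating iteration backwards from its last round.
    refine PFun.fixInduction' (C := fun v => Red U (apps (loopT (codeT f))
      (bang (loopT (codeT f)) :: bang k :: bang (listT v) :: as)) T) hw (fun v hv => ?_)
      (fun v v' _ hv hrec => ?_)
    · obtain ⟨u, hu, he⟩ := (Part.mem_map_iff _).mp hv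
      rw [← subst_loopT _ var, loopT]
      repeat' (with_reducible
        first
        | exact h | apply run_app | apply run_nilT | apply run_consT
        | apply run_zeroT | apply run_succT | apply run_bang
        | simp only [subst_succT, subst_consT, subst_zeroT, subst_nilT, scons_zero, scons_succ,
          subst_v, subst_app, subst_bang, subst_codeT, subst_loopT])
      refine ih v u _ T as hu ?_
      -- The iteration stops if the head of the result is 0, and the default head of the empty list
      -- is 0 as well; a positive head is excluded in the last round.
      rcases u with _ | ⟨_ | n, u⟩
      · obtain rfl : [] = w := by simpa using he
        simp only [listT] at h ⊢
        repeat' (with_reducible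
          first
          | exact h | apply run_app | apply run_nilT | apply run_consT
          | apply run_zeroT | apply run_succT | apply run_bang
          | simp only [subst_succT, subst_consT, subst_zeroT, subst_nilT, scons_zero, scons_succ,
            subst_v, subst_app, subst_bang, subst_codeT, subst_loopT])
      · obtain rfl : u = w := by simpa using he
        simp only [listT, natT] at h ⊢
        repeat' (with_reducible
          first
          | exact h | apply run_app | apply run_nilT | apply run_consT
          | apply run_zeroT | apply run_succT | apply run_bang
          | simp only [subst_succT, subst_consT, subst_zeroT, subst_nilT, scons_zero, scons_succ,
            subst_v, subst_app, subst_bang, subst_codeT, subst_loopT])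
      · simp at he
    · obtain ⟨u, hu, he⟩ := (Part.mem_map_iff _).mp hv
      rw [← subst_loopT _ var, loopT]
      repeat' (with_reducible
        first
        | exact h | apply run_app | apply run_nilT | apply run_consT
        | apply run_zeroT | apply run_succT | apply run_bang
        | simp only [subst_succT, subst_consT, subst_zeroT, subst_nilT, scons_zero, scons_succ,
          subst_v, subst_app, subst_bang, subst_codeT, subst_loopT])
      refine ih v u _ T as hu ?_
      rcases u with _ | ⟨_ | n, u⟩
      · simp at he
      · simp at he
      -- A positive head makes the loop call itself on the tail, for which the remaining run is
      -- known.
      · obtain rfl : u = v' := by simpa using he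
        have h := hrec
        simp only [listT, natT] at h ⊢
        rw [← subst_loopT _ var, loopT] at h
        repeat' (with_reducible
          first
          | exact h | apply run_app | apply run_nilT | apply run_consT
          | apply run_zeroT | apply run_succT | apply run_bang
          | simp only [subst_succT, subst_consT, subst_zeroT, subst_nilT, scons_zero, scons_succ,
            subst_v, subst_app, subst_bang, subst_codeT, subst_loopT])

/-- A code for a computable function. -/
theorem exists_code_of_computable {f : ℕ → ℕ} (hf : Computable f) :
    ∃ c : Code, ∀ n, [f n] ∈ c.eval [n] := by
  obtain ⟨c, hc⟩ := Code.exists_code (Nat.Partrec'.part_iff₁.mpr hf)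
  refine ⟨c, fun n => ?_⟩
  have := hc (n ::ᵥ List.Vector.nil)
  have h2 : c.eval [n] = pure <$> (f n : Part ℕ) := this
  rw [h2]
  simp

end QCalc

end

noncomputable section

set_option linter.unusedSimpArgs false

namespace QCalc
open Term

variable {U : ℕ → Gate}

local notation:75 f:75 " ⬝ " x:76 => Term.app f (Term.bang x)
local prefix:max "ƛ" => lamBang
local prefix:max "λ₁" => lam Pat.var
local prefix:max "#" => Term.var

/-! ### The instructions of a machine operating on two lists of qubits

The state of the machine is given by the arguments `!D, !p, !B, !P, L, R`: the machine itself, the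
program, the list of the input bits, a final segment of the latter, and two lists of qubits. -/

/-- The lists of qubits. -/
def qlistT (l : List ℕ) : Term := list (l.map qvar)

/-- The lists of bits. -/
def bitsT : List Bool → Term
  | [] => nilT
  | b :: l => consT (bit b) (bitsT l)

/-- The continuation of the machine. -/
def goT (d p B P L R : Term) : Term := app (app (d ⬝ d ⬝ p ⬝ B ⬝ P) L) R

/-- Return the first list; the second list has to be empty. -/
def stopT : Term := ƛ(ƛ(ƛ(ƛ(λ₁(λ₁(app (#0 ⬝ zeroT ⬝ λ₁(#0)) #1))))))

/-- Reset the pointer to the input. -/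
def resetT : Term := ƛ(ƛ(ƛ(ƛ(λ₁(λ₁(goT #5 #4 #3 #3 #1 #0))))))

/-- Advance the pointer to the input. -/
def advanceT : Term :=
  ƛ(ƛ(ƛ(ƛ(#0 ⬝ zeroT ⬝ ƛ(ƛ(ƛ(ƛ(ƛ(λ₁(λ₁(goT #4 #3 #2 #5 #1 #0))))))) ⬝ #3 ⬝ #2 ⬝ #1))))

/-- Create a qubit from the bit at the pointer to the input. -/
def newT : Term :=
  ƛ(ƛ(ƛ(ƛ(#0 ⬝ zeroT ⬝ ƛ(ƛ(ƛ(ƛ(ƛ(ƛ(λ₁(λ₁(goT #5 #4 #3 #2 (qconsT (newq #7) #1) #0)))))))) ⬝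
    #3 ⬝ #2 ⬝ #1 ⬝ #0))))

/-- Remove the first `k` qubits from the first list and pass them to `F` as additional arguments,
in reverse order. -/
def popT : ℕ → Term → Term
  | 0, F => F
  | k + 1, F => ƛ(ƛ(ƛ(ƛ(λ₁(λ₁(app (#1 ⬝
      λ₁(λ₁(ƛ(ƛ(ƛ(ƛ(λ₁(app (app (app (popT k F ⬝ #4 ⬝ #3 ⬝ #2 ⬝ #1) #5) #0) #6))))))) ⬝ zeroT ⬝
      #5 ⬝ #4 ⬝ #3 ⬝ #2) #0))))))

/-- Move a qubit from the first list to the second one. -/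
def moveT : Term :=
  popT 1 (ƛ(ƛ(ƛ(ƛ(λ₁(λ₁(λ₁(goT #6 #5 #4 #3 #2 (qconsT #0 #1)))))))))

/-- Move a qubit from the second list to the second place of the first list. -/
def pullT : Term :=
  popT 1 (ƛ(ƛ(ƛ(ƛ(λ₁(λ₁(λ₁(app (app (app (popT 1
    (ƛ(ƛ(ƛ(ƛ(λ₁(λ₁(λ₁(λ₁(goT #7 #6 #5 #4 (qconsT #0 (qconsT #1 #2)) #3)))))))))
    ⬝ #6 ⬝ #5 ⬝ #4 ⬝ #3) #1) #2) #0))))))))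

/-- The abstraction of `k` variables. -/
def lamsT : ℕ → Term → Term
  | 0, M => M
  | k + 1, M => lamsT k (λ₁ M)

/-- The list `L` with `k` variables in front. -/
def pushT (k : ℕ) (L : Term) : Term := (List.range k).foldr (fun j T => qconsT (var j) T) L

/-- Apply a gate of the given arity to the first qubits of the first list. -/
def gateBodyT (i : ℕ) : ℕ → Term
  | 0 => zeroT
  | 1 => goT #6 #5 #4 #3 (qconsT (app (gate i) #0) #2) #1
  | n + 2 =>
    let k := n + 2
    app (lam (.tuple n) (goT (var (k + (k + 5))) (var (k + (k + 4))) (var (k + (k + 3)))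
      (var (k + (k + 2))) (pushT k (var (k + (k + 1)))) (var (k + k))))
      (app (gate i) (tup (fun j : Fin (n + 2) => var j)))

/-- Apply a gate to the first qubits of the first list. -/
def gateT (U : ℕ → Gate) (i : ℕ) : Term :=
  popT (U i).arity (ƛ(ƛ(ƛ(ƛ(λ₁(λ₁(lamsT (U i).arity (gateBodyT i (U i).arity))))))))

/-- The selection of one of a list of terms by a numeral. -/
def selectT : List Term → Term
  | [] => zeroT
  | o :: os => ƛ(#0 ⬝ o ⬝ selectT os)

/-- The machine with the instructions `os`, where `c` is a code that finds the first instruction of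
a program. -/
def machineT (c : Turing.ToPartrec.Code) (os : List Term) : Term :=
  ƛ(ƛ(codeT c ⬝ ƛ(#0 ⬝ zeroT ⬝ ƛ(ƛ(selectT os ⬝ #1 ⬝ #4 ⬝ #0))) ⬝ #0))

theorem cnt_popT {F : Term} (hF : ∀ i, cnt i F = 0) (k i : ℕ) : cnt i (popT k F) = 0 := by
  induction k generalizing i with
  | zero => exact hF i
  | succ k ih => simp [popT, ih, Pat.size]

theorem cnt_lamsT (k i : ℕ) (M : Term) : cnt i (lamsT k M) = cnt (i + k) M := by
  induction k generalizing M with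
  | zero => rfl
  | succ k ih => rw [lamsT, ih, cnt_lam]; rfl

theorem cnt_pushT (k i : ℕ) (L : Term) :
    cnt i (pushT k L) = (if i < k then 1 else 0) + cnt i L := by
  unfold pushT
  induction k generalizing L with
  | zero => simp
  | succ k ih =>
    rw [List.range_succ, List.foldr_append, ih]
    simp only [List.foldr_cons, List.foldr_nil, cnt_qconsT, cnt_var]
    split_ifs <;> omega

@[simp] theorem cnt_stopT (i : ℕ) : cnt i stopT = 0 := by simp [stopT, Pat.size]
@[simp] theorem cnt_resetT (i : ℕ) : cnt i resetT = 0 := by simp [resetT, goT, Pat.size]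
@[simp] theorem cnt_advanceT (i : ℕ) : cnt i advanceT = 0 := by simp [advanceT, goT, Pat.size]
@[simp] theorem cnt_newT (i : ℕ) : cnt i newT = 0 := by simp [newT, goT, Pat.size]
@[simp] theorem cnt_moveT (i : ℕ) : cnt i moveT = 0 :=
  cnt_popT (by simp [goT, Pat.size]) 1 i
@[simp] theorem cnt_pullT (i : ℕ) : cnt i pullT = 0 := by
  refine cnt_popT (fun i => ?_) 1 i
  simp [cnt_popT, goT, Pat.size]

/-- The `k + 6` enclosing binders are those of the `k` qubits and of the state `d, p, B, P, L, R`.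
-/
theorem cnt_gateBodyT (i k j : ℕ) : cnt (j + (k + 6)) (gateBodyT i k) = 0 := by
  rcases k with _ | _ | n
  · simp [gateBodyT]
  · simp [gateBodyT, goT]
  · have h : ∀ x : Fin (n + 2), ¬ (x : ℕ) = j + (n + 2 + 6) := fun x => by omega
    simp only [gateBodyT, goT, cnt_app, cnt_lam, cnt_bang, cnt_var, cnt_pushT, cnt_gate, cnt_tup,
      Pat.size, h, if_false, Finset.sum_const_zero]
    split_ifs <;> omega

@[simp] theorem cnt_gateT (i j : ℕ) : cnt j (gateT U i) = 0 := by
  refine cnt_popT (fun j => ?_) _ j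
  have := cnt_gateBodyT i (U i).arity j
  simp only [cnt_lamBang, cnt_lam, cnt_lamsT, Pat.size]
  rw [← this]
  congr 1
  omega

theorem cnt_selectT {os : List Term} (h : ∀ o ∈ os, ∀ i, cnt i o = 0) (i : ℕ) :
    cnt i (selectT os) = 0 := by
  induction os generalizing i with
  | nil => simp [selectT]
  | cons o os ih =>
    simp [selectT, h o (by simp), ih (fun o ho => h o (by simp [ho]))]

theorem cnt_machineT (c : Turing.ToPartrec.Code) {os : List Term}
    (h : ∀ o ∈ os, ∀ i, cnt i o = 0) (i : ℕ) : cnt i (machineT c os) = 0 := by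
  simp [machineT, cnt_selectT h]

/-! ### Correctness of the instructions -/

theorem subst_newq (σ : ℕ → Term) (M : Term) : subst σ (newq M) = newq (subst σ M) := rfl

theorem qlistT_cons (r : ℕ) (l : List ℕ) : qlistT (r :: l) = qconsT (qvar r) (qlistT l) := rfl

theorem run_selectT {T : Term} {as : List Term} {os : List Term}
    (hos : ∀ o ∈ os, ∀ i, cnt i o = 0) (j : ℕ) (o : Term) (hj : os[j]? = some o)
    (h : Red U (apps o as) T) : Red U (apps (selectT os) (bang (natT j) :: as)) T := by
  induction os generalizing j with
  | nil => simp at hj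
  | cons o' os ih =>
    have h1 : ∀ σ, subst σ o' = o' := subst_of_closed (hos o' (by simp))
    have h2 : ∀ σ, subst σ (selectT os) = selectT os :=
      subst_of_closed (cnt_selectT (fun o ho => hos o (by simp [ho])))
    rw [← subst_var (selectT _), selectT]
    cases j with
    | zero =>
      obtain rfl : o' = o := by simpa using hj
      simp only [natT]
      repeat' (with_reducible
        first
        | exact h | apply run_app | apply run_nilT | apply run_consT | apply run_qconsT
        | apply run_zeroT | apply run_succT | apply run_qnilT | apply run_bang | apply run_lam
        | simp only [subst_consT, subst_zeroT, subst_qconsT, scons_zero, scons_succ, goT,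
          subst_v, subst_app, subst_bang, subst_codeT, subst_newq, h1, h2])
    | succ j =>
      have h := ih (fun o ho => hos o (by simp [ho])) j (by simpa using hj)
      simp only [natT]
      repeat' (with_reducible
        first
        | exact h | apply run_app | apply run_nilT | apply run_consT | apply run_qconsT
        | apply run_zeroT | apply run_succT | apply run_qnilT | apply run_bang | apply run_lam
        | simp only [subst_consT, subst_zeroT, subst_qconsT, scons_zero, scons_succ, goT,
          subst_v, subst_app, subst_bang, subst_codeT, subst_newq, h1, h2])

/-- One cycle of the interpreter: the code splits the program number into the index of an
instruction and the number of the rest, and the index selects the instruction, which gets the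
machine and the rest of the program. -/
theorem run_machineT {T : Term} {as : List Term} {c : Turing.ToPartrec.Code} {os : List Term}
    (hos : ∀ o ∈ os, ∀ i, cnt i o = 0) {p p' j : ℕ} {o : Term} (hj : os[j]? = some o)
    (hc : [j, p'] ∈ c.eval [p]) (D : Term)
    (h : Red U (apps o (bang D :: bang (listT [p']) :: as)) T) :
    Red U (apps (machineT c os) (bang D :: bang (listT [p]) :: as)) T := by
  have h1 : ∀ σ, subst σ (selectT os) = selectT os := subst_of_closed (cnt_selectT hos)
  rw [← subst_var (machineT c os), machineT]
  have h := run_selectT hos j o hj h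
  repeat' (with_reducible
    first
    | exact h | apply run_app | apply run_nilT | apply run_consT | apply run_qconsT
    | apply run_zeroT | apply run_succT | apply run_qnilT | apply run_bang | apply run_lam
    | simp only [subst_consT, subst_zeroT, subst_qconsT, scons_zero, scons_succ, goT,
      subst_v, subst_app, subst_bang, subst_codeT, subst_newq, h1])
  refine red_codeT c [p] [j, p'] _ T as hc ?_
  simp only [listT] at h ⊢
  repeat' (with_reducible
    first
    | exact h | apply run_app | apply run_nilT | apply run_consT | apply run_qconsT
    | apply run_zeroT | apply run_succT | apply run_qnilT | apply run_bang | apply run_lam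
    | simp only [subst_consT, subst_zeroT, subst_qconsT, scons_zero, scons_succ, goT,
      subst_v, subst_app, subst_bang, subst_codeT, subst_newq, h1])

/-- Each removed qubit is put directly after the second list, before the arguments passed so far;
hence the reversal. The linear list is consumed by applying it to a branch that takes head and tail
as linear arguments, while the rest of the state is passed on explicitly. -/
theorem run_popT {T : Term} {F : Term} (hF : ∀ i, cnt i F = 0) (d p B P R : Term)
    (xs L : List ℕ) (as : List Term)
    (h : Red U (apps F (bang d :: bang p :: bang B :: bang P :: qlistT L :: R ::
      ((xs.map qvar).reverse ++ as))) T) :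
    Red U (apps (popT xs.length F) (bang d :: bang p :: bang B :: bang P ::
      qlistT (xs ++ L) :: R :: as)) T := by
  induction xs generalizing as with
  | nil => exact h
  | cons x xs ih =>
    have h1 : ∀ σ, subst σ (popT xs.length F) = popT xs.length F :=
      subst_of_closed (cnt_popT hF _)
    have h := ih (qvar x :: as) (by simpa using h)
    rw [← subst_var (popT _ F), List.length_cons, popT, List.cons_append, qlistT_cons]
    repeat' (with_reducible
      first
      | exact h | apply run_app | apply run_nilT | apply run_consT | apply run_qconsT
      | apply run_zeroT | apply run_succT | apply run_qnilT | apply run_bang | apply run_lam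
      | simp only [subst_consT, subst_zeroT, subst_qconsT, scons_zero, scons_succ, goT,
        subst_v, subst_app, subst_bang, subst_codeT, subst_newq, h1])

/-- The second list is linear and cannot be discarded. Being empty, it is consumed by selecting its
second argument, the identity, which then returns the first list. -/
theorem run_stopT {T : Term} (d p B P : Term) (L : List ℕ)
    (h : Red U (qlistT L) T) :
    Red U (apps stopT [bang d, bang p, bang B, bang P, qlistT L, qlistT []]) T := by
  have h : Red U (apps (qlistT L) []) T := h
  rw [← subst_var stopT, stopT, show qlistT [] = qnilT from rfl]
  repeat' (with_reducible
    first
    | exact h | apply run_app | apply run_nilT | apply run_consT | apply run_qconsT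
    | apply run_zeroT | apply run_succT | apply run_qnilT | apply run_bang | apply run_lam
    | simp only [subst_consT, subst_zeroT, subst_qconsT, scons_zero, scons_succ, goT,
      subst_v, subst_app, subst_bang, subst_codeT, subst_newq])

theorem run_resetT {T : Term} (d p B P L R : Term)
    (h : Red U (apps d [bang d, bang p, bang B, bang B, L, R]) T) :
    Red U (apps resetT [bang d, bang p, bang B, bang P, L, R]) T := by
  rw [← subst_var resetT, resetT]
  repeat' (with_reducible
    first
    | exact h | apply run_app | apply run_nilT | apply run_consT | apply run_qconsT
    | apply run_zeroT | apply run_succT | apply run_qnilT | apply run_bang | apply run_lam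
    | simp only [subst_consT, subst_zeroT, subst_qconsT, scons_zero, scons_succ, goT,
      subst_v, subst_app, subst_bang, subst_codeT, subst_newq])

theorem run_advanceT {T : Term} (d p B b P L R : Term)
    (h : Red U (apps d [bang d, bang p, bang B, bang P, L, R]) T) :
    Red U (apps advanceT [bang d, bang p, bang B, bang (consT b P), L, R]) T := by
  rw [← subst_var advanceT, advanceT]
  repeat' (with_reducible
    first
    | exact h | apply run_app | apply run_nilT | apply run_consT | apply run_qconsT
    | apply run_zeroT | apply run_succT | apply run_qnilT | apply run_bang | apply run_lam
    | simp only [subst_consT, subst_zeroT, subst_qconsT, scons_zero, scons_succ, goT,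
      subst_v, subst_app, subst_bang, subst_codeT, subst_newq])

/-- The creation is stored unevaluated in the list; it is fired afterwards, in `run_new`. -/
theorem run_newT {T : Term} (d p B b P L R : Term)
    (h : Red U (apps d [bang d, bang p, bang B, bang (consT b P), qconsT (newq b) L, R]) T) :
    Red U (apps newT [bang d, bang p, bang B, bang (consT b P), L, R]) T := by
  rw [← subst_var newT, newT]
  repeat' (with_reducible
    first
    | exact h | apply run_app | apply run_nilT | apply run_consT | apply run_qconsT
    | apply run_zeroT | apply run_succT | apply run_qnilT | apply run_bang | apply run_lam
    | simp only [subst_consT, subst_zeroT, subst_qconsT, scons_zero, scons_succ, goT,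
      subst_v, subst_app, subst_bang, subst_codeT, subst_newq])

theorem run_moveT {T : Term} (d p B P R : Term) (x : ℕ) (L : List ℕ)
    (h : Red U (apps d [bang d, bang p, bang B, bang P, qlistT L, qconsT (qvar x) R]) T) :
    Red U (apps moveT [bang d, bang p, bang B, bang P, qlistT (x :: L), R]) T := by
  refine run_popT (by simp [goT, Pat.size]) d p B P R [x] L [] ?_
  rw [← subst_var (lamBang _)]
  simp only [List.map_cons, List.map_nil, List.reverse_singleton, List.append_nil]
  repeat' (with_reducible
    first
    | exact h | apply run_app | apply run_nilT | apply run_consT | apply run_qconsT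
    | apply run_zeroT | apply run_succT | apply run_qnilT | apply run_bang | apply run_lam
    | simp only [subst_consT, subst_zeroT, subst_qconsT, scons_zero, scons_succ, goT,
      subst_v, subst_app, subst_bang, subst_codeT, subst_newq])

/-- Two removals: `x` from the first list, and then `y` from the second one, with the roles of the
lists exchanged. Keeping `x` in front lets repeated pulls restore the qubits that were moved out of
its way. -/
theorem run_pullT {T : Term} (d p B P : Term) (x y : ℕ) (L R : List ℕ)
    (h : Red U (apps d [bang d, bang p, bang B, bang P, qlistT (x :: y :: L), qlistT R]) T) :
    Red U (apps pullT [bang d, bang p, bang B, bang P, qlistT (x :: L), qlistT (y :: R)]) T := by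
  refine run_popT (by simp [cnt_popT, goT, Pat.size]) d p B P (qlistT (y :: R)) [x] L [] ?_
  rw [← subst_var (lamBang _)]
  simp only [List.map_cons, List.map_nil, List.reverse_singleton, List.append_nil]
  set G := ƛ(ƛ(ƛ(ƛ(λ₁(λ₁(λ₁(λ₁(goT #7 #6 #5 #4 (qconsT #0 (qconsT #1 #2)) #3)))))))) with hG
  have hG0 : ∀ i, cnt i G = 0 := by simp [hG, goT, Pat.size]
  have h1 : ∀ σ, subst σ (popT 1 G) = popT 1 G := subst_of_closed (cnt_popT hG0 1)
  simp only [qlistT_cons] at h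
  repeat' (with_reducible
    first
    | exact h | apply run_app | apply run_nilT | apply run_consT | apply run_qconsT
    | apply run_zeroT | apply run_succT | apply run_qnilT | apply run_bang | apply run_lam
    | simp only [subst_consT, subst_zeroT, subst_qconsT, scons_zero, scons_succ, goT,
      subst_v, subst_app, subst_bang, subst_codeT, subst_newq, h1])
  -- The second list now stands in the first place, and `x` waits as an additional argument.
  refine run_popT hG0 d p B P (qlistT L) [y] R [qvar x] ?_
  rw [← subst_var G, hG]
  simp only [List.map_cons, List.map_nil, List.reverse_singleton, List.cons_append,
    List.nil_append]
  repeat' (with_reducible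
    first
    | exact h | apply run_app | apply run_nilT | apply run_consT | apply run_qconsT
    | apply run_zeroT | apply run_succT | apply run_qnilT | apply run_bang | apply run_lam
    | simp only [subst_consT, subst_zeroT, subst_qconsT, scons_zero, scons_succ, goT,
      subst_v, subst_app, subst_bang, subst_codeT, subst_newq])

/-- The substitution `N_0, …, N_{k-1}, σ 0, σ 1, …`. -/
def sappend (Ns : List Term) (σ : ℕ → Term) : ℕ → Term := Ns.foldr scons σ

theorem sappend_add (Ns : List Term) (σ : ℕ → Term) (i : ℕ) :
    sappend Ns σ (Ns.length + i) = σ i := by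
  induction Ns with
  | nil => simp [sappend]
  | cons N Ns ih =>
    rw [List.length_cons, Nat.add_right_comm]
    exact ih

theorem sappend_lt (Ns : List Term) (σ : ℕ → Term) {i : ℕ} (h : i < Ns.length) :
    sappend Ns σ i = Ns[i] := by
  induction Ns generalizing i with
  | nil => simp at h
  | cons N Ns ih =>
    cases i with
    | zero => rfl
    | succ i => exact ih (by simpa using h)

/-- The last argument becomes index 0, so passing the list in reverse makes index `j` denote its
`j`-th element. This matches the order produced by `popT`. -/
theorem run_lamsT {T : Term} (Ns as : List Term) (σ : ℕ → Term) (M : Term)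
    (h : Red U (apps (subst (sappend Ns σ) M) as) T) :
    Red U (apps (subst σ (lamsT Ns.length M)) (Ns.reverse ++ as)) T := by
  induction Ns generalizing M as with
  | nil => exact h
  | cons N Ns ih =>
    rw [List.reverse_cons, List.append_assoc]
    exact ih (N :: as) _ (run_lam h)

end QCalc

end

noncomputable section

set_option linter.unusedSimpArgs false

namespace QCalc
open Term

variable {U : ℕ → Gate}

/-! ### Runs -/

/-- Reduction of terms together with their registers, given as functions of assignments of bits to
all names. -/
def UStep (U : ℕ → Gate) (x y : Finset ℕ × ((ℕ → Bool) → ℂ) × Term) : Prop :=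
  ∃ a : Lab, TStep U x.2.2 a y.2.2 ∧ (∀ c r, a = .new c r → r ∉ x.1) ∧
    y.1 = a.vars x.1 ∧ y.2.1 = a.act U x.2.1

/-- The reflexive and transitive closure of `UStep`. -/
def Run (U : ℕ → Gate) : Finset ℕ × ((ℕ → Bool) → ℂ) × Term →
    Finset ℕ × ((ℕ → Bool) → ℂ) × Term → Prop :=
  Relation.ReflTransGen (UStep U)

theorem Run.refl (x : Finset ℕ × ((ℕ → Bool) → ℂ) × Term) : Run U x x := Relation.ReflTransGen.refl

theorem Run.trans {x y z : Finset ℕ × ((ℕ → Bool) → ℂ) × Term} (h : Run U x y) (h' : Run U y z) :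
    Run U x z := Relation.ReflTransGen.trans h h'

theorem Red.run {t t' : Term} (h : Red U t t') (V : Finset ℕ) (Φ : (ℕ → Bool) → ℂ) :
    Run U (V, Φ, t) (V, Φ, t') := by
  induction h with
  | refl => exact .refl _
  | tail _ hs ih => exact ih.tail ⟨.silent, hs, fun _ _ h => by simp at h, rfl, rfl⟩

theorem TStep.run {t t' : Term} {a : Lab} (h : TStep U t a t') {V : Finset ℕ}
    (ha : ∀ c r, a = .new c r → r ∉ V) (Φ : (ℕ → Bool) → ℂ) :
    Run U (V, Φ, t) (a.vars V, a.act U Φ, t') :=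
  .single ⟨a, h, ha, rfl, rfl⟩

/-- `Run` records a register through its extension to all assignments; this lemma returns from such
runs to reductions of configurations. -/
theorem Run.reach {x y : Finset ℕ × ((ℕ → Bool) → ℂ) × Term} (h : Run U x y) (P : PreConfig)
    (hP : (P.vars, P.ext, P.term) = x) :
    ∃ P' : PreConfig, (P'.vars, P'.ext, P'.term) = y ∧
      Relation.ReflTransGen (Config.Step U) (Quotient.mk _ P) (Quotient.mk _ P') := by
  induction h with
  | refl => exact ⟨P, hP, .refl⟩
  | tail _ hs ih =>
    obtain ⟨P', rfl, hr⟩ := ih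
    obtain ⟨a, h1, h2, h3, h4⟩ := hs
    obtain ⟨Q, hQ, hl, ht⟩ := LStep.exists h1 h2
    refine ⟨Q, ?_, hr.tail ⟨_, _, rfl, rfl, hQ⟩⟩
    rw [hl.vars, hl.ext, ht, ← h3, ← h4]

/-- Reduction is allowed below `λ!`, so a creation or a gate stored at the head of a list can fire
there. -/
theorem TStep.qconsT {N N' : Term} {a : Lab} (h : TStep U N a N') (L : Term) :
    TStep U (qconsT N L) a (QCalc.qconsT N' L) :=
  .inLamBang _ _ _ (.inLamBang _ _ _ (.leftApp _ _ _ _ (.rightApp _ _ _ _ (h.shift 2))))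

theorem subst_pushT (τ : ℕ → Term) (k : ℕ) (L : Term) :
    subst τ (pushT k L) = (List.range k).foldr (fun j T => qconsT (τ j) T) (subst τ L) := by
  unfold pushT
  induction List.range k with
  | nil => rfl
  | cons j l ih => simp only [List.foldr_cons, subst_qconsT, ih, subst_v]

theorem foldr_qconsT (xs L : List ℕ) :
    (List.range xs.length).foldr (fun j T => qconsT (qvar (xs.getD j 0)) T) (qlistT L) =
      qlistT (xs ++ L) := by
  have h : (List.range xs.length).map (fun j => xs.getD j 0) = xs := by
    apply List.ext_getElem
    · simp
    · intro i h1 h2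
      simp [List.getElem?_eq_getElem h2]
  have h2 : ∀ l : List ℕ, l.foldr (fun j T => qconsT (qvar (xs.getD j 0)) T) (qlistT L) =
      qlistT (l.map (fun j => xs.getD j 0) ++ L) := by
    intro l
    induction l with
    | nil => rfl
    | cons j l ih => rw [List.foldr_cons, ih]; rfl
  rw [h2, h]

theorem inst_subst_sappend {k : ℕ} (Ns : Fin k → Term) (τ : ℕ → Term) (M : Term) :
    inst Ns (subst (liftSub k τ) M) = subst (sappend (List.ofFn Ns) τ) M := by
  unfold inst
  rw [subst_subst]
  congr 1
  funext i
  by_cases hi : i < k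
  · rw [sappend_lt _ _ (by simpa using hi)]
    simp [liftSub, hi, subst]
  · obtain ⟨j, rfl⟩ := Nat.exists_eq_add_of_le (not_lt.mp hi)
    have := sappend_add (List.ofFn Ns) τ j
    rw [List.length_ofFn] at this
    rw [this]
    simp [liftSub, shift, subst_rename, subst_var]

/-- After the qubits have been removed from the list, a one-qubit gate fires inside the rebuilt
list. A larger gate fires in the argument of a pattern abstraction, which then names the resulting
components and rebuilds the list. -/
theorem run_gateT (i : ℕ) (d p B P R : Term) (xs L : List ℕ) (hk : (U i).arity = xs.length)
    (hn : xs.Nodup) (V : Finset ℕ) (Φ : (ℕ → Bool) → ℂ) :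
    Run U (V, Φ, apps (gateT U i) [bang d, bang p, bang B, bang P, qlistT (xs ++ L), R])
      (V, gateSem (U i) xs Φ, apps d [bang d, bang p, bang B, bang P, qlistT (xs ++ L), R]) := by
  set σ := scons R (scons (qlistT L) (scons P (scons B (scons p (scons d var))))) with hσ
  have h1 : Red U (apps (gateT U i) [bang d, bang p, bang B, bang P, qlistT (xs ++ L), R])
      (subst (sappend (xs.map qvar) σ) (gateBodyT i xs.length)) := by
    rw [gateT, hk]
    refine run_popT ?_ d p B P R xs L [] ?_
    · intro j
      have := cnt_gateBodyT i xs.length j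
      simp only [cnt_lamBang, cnt_lam, cnt_lamsT, Pat.size]
      rw [← this]
      congr 1
      omega
    · rw [← subst_var (lamBang _)]
      refine run_bang (run_bang (run_bang (run_bang (run_lam (run_lam ?_)))))
      have := run_lamsT (U := U) (xs.map qvar) [] σ (gateBodyT i xs.length) .refl
      rw [List.length_map] at this
      exact this
  refine (h1.run V Φ).trans ?_
  have hpos := (U i).arity_pos
  rcases xs with _ | ⟨x, _ | ⟨y, xs⟩⟩
  · simp only [List.length_nil] at hk; omega
  · have e : subst (sappend ([x].map qvar) σ) (gateBodyT i [x].length) =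
        apps d [bang d, bang p, bang B, bang P, qconsT (app (gate i) (qvar x)) (qlistT L), R] := by
      change subst (scons (qvar x) σ)
        (goT (var 6) (var 5) (var 4) (var 3) (qconsT (app (gate i) (var 0)) (var 2)) (var 1)) = _
      simp only [goT, subst_app, subst_bang, subst_v, subst_qconsT, hσ, scons_zero, scons_succ]
      rfl
    rw [e]
    exact TStep.run (((TStep.uqOne i x hk).qconsT (qlistT L)).rightApp
      (apps d [bang d, bang p, bang B, bang P]) _ _ _ |>.apps [R]) (by simp) Φ
  · set n := xs.length with hlen
    set rs : Fin (n + 2) → ℕ := fun j => (x :: y :: xs).getD j 0 with hrs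
    set zs := x :: y :: xs with hzs
    have hzl : zs.length = n + 2 := rfl
    have hofFn : List.ofFn rs = zs := by
      apply List.ext_getElem
      · simp [hzl]
      · intro j h1 h2
        rw [List.getElem_ofFn]
        simp [hrs, List.getElem?_eq_getElem h2]
    have hinj : Function.Injective rs := by
      rw [← List.nodup_ofFn, hofFn]
      exact hn
    set τ := sappend (zs.map qvar) σ with hτ
    set M := goT (var (n + 2 + (n + 2 + 5))) (var (n + 2 + (n + 2 + 4)))
      (var (n + 2 + (n + 2 + 3))) (var (n + 2 + (n + 2 + 2)))
      (pushT (n + 2) (var (n + 2 + (n + 2 + 1)))) (var (n + 2 + (n + 2))) with hM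
    have e : subst τ (gateBodyT i zs.length) =
        app (lam (.tuple n) (subst (liftSub (n + 2) τ) M))
          (app (gate i) (tup (fun j => qvar (rs j)))) := by
      have : (fun j : Fin (n + 2) => subst τ (var j)) = fun j => qvar (rs j) := by
        funext j
        have hj : (j : ℕ) < (zs.map qvar).length := by simp [hzl]
        have hj' : (j : ℕ) < zs.length := by simpa using hj
        rw [subst_v, hτ, sappend_lt _ _ hj]
        simp [hrs, List.getElem?_eq_getElem hj']
      rw [← this]
      rfl
    rw [e]
    have s1 := (TStep.uqTuple (U := U) i rs _ hk hinj (fun _ => rfl)).rightApp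
      (lam (.tuple n) (subst (liftSub (n + 2) τ) M)) |>.run (V := V) (by simp) Φ
    rw [hofFn] at s1
    refine s1.trans ?_
    have s2 := TStep.qBeta (U := U) (subst (liftSub (n + 2) τ) M) rs _ (fun _ => rfl)
      |>.run (V := V) (by simp) (gateSem (U i) zs Φ)
    have e2 : inst (fun j => qvar (rs j)) (subst (liftSub (n + 2) τ) M) =
        apps d [bang d, bang p, bang B, bang P, qlistT (zs ++ L), R] := by
      have hof : List.ofFn (fun j => qvar (rs j)) = zs.map qvar := by
        rw [← hofFn, List.map_ofFn]
        rfl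
      rw [inst_subst_sappend, hof]
      -- Below the tuple pattern, the state variables lie behind two blocks of `n + 2` indices: the
      -- components of the pattern and the qubits as they were bound before the gate.
      have hv : ∀ j, sappend (zs.map qvar) τ (n + 2 + (n + 2 + j)) = σ j := by
        intro j
        have e1 := sappend_add (zs.map qvar) τ (n + 2 + j)
        have e2 := sappend_add (zs.map qvar) σ j
        rw [List.length_map, hzl] at e1 e2
        rw [e1, hτ, e2]
      have hpush : subst (sappend (zs.map qvar) τ) (pushT (n + 2) (var (n + 2 + (n + 2 + 1)))) =
          qlistT (zs ++ L) := by
        rw [subst_pushT, subst_v, hv, ← foldr_qconsT, hzl]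
        refine List.foldr_ext _ _ _ (fun j hj T => ?_)
        have hj : j < zs.length := by simpa [hzl] using hj
        have hj' : j < (zs.map qvar).length := by simpa using hj
        rw [sappend_lt _ _ hj']
        simp [List.getElem?_eq_getElem hj]
      simp only [hM, goT, subst_app, subst_bang, subst_v, hpush, hv]
      have h0 := hv 0
      rw [add_zero] at h0
      rw [h0]
      rfl
    rw [e2] at s2
    exact s2

end QCalc

end

noncomputable section

namespace QCalc
open Term

variable {U : ℕ → Gate}

local notation:75 f:75 " ⬝ " x:76 => Term.app f (Term.bang x)
local prefix:max "ƛ" => lamBang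
local prefix:max "λ₁" => lam Pat.var
local prefix:max "#" => Term.var

/-! ### Programs of the machine -/

open Turing.ToPartrec (Code)

/-- A code that finds the first instruction and the rest of a program. -/
theorem exists_fetch_code :
    ∃ c : Code, ∀ p : List ℕ, [p.headI, Encodable.encode p.tail] ∈ c.eval [Encodable.encode p] := by
  have hd : Computable (fun n : ℕ => ((Encodable.decode n : Option (List ℕ)).getD [])) :=
    (Primrec.option_getD.comp Primrec.decode (Primrec.const [])).to_comp
  obtain ⟨c₁, h₁⟩ := exists_code_of_computable (Primrec.list_headI.to_comp.comp hd)
  obtain ⟨c₂, h₂⟩ := exists_code_of_computable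
    (Computable.encode.comp (Primrec.list_tail.to_comp.comp hd))
  refine ⟨.cons c₁ c₂, fun p => ?_⟩
  have e₁ := h₁ (Encodable.encode p)
  have e₂ := h₂ (Encodable.encode p)
  simp only [Encodable.encodek, Option.getD_some] at e₁ e₂
  simp only [Code.eval, Part.bind_eq_bind, Part.mem_bind_iff, Part.pure_eq_some,
    Part.mem_some_iff]
  exact ⟨_, e₁, _, e₂, rfl⟩

/-- The code `exists_fetch_code`. -/
def fetchCode : Code := exists_fetch_code.choose

/-- The instructions of the machine, for the gates with symbols in the list `Gs`. -/
def instrs (U : ℕ → Gate) (Gs : List ℕ) : List Term :=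
  [stopT, resetT, advanceT, newT, moveT, pullT] ++ Gs.map (gateT U)

/-- The machine for the gates with symbols in the list `Gs`. -/
def machine (U : ℕ → Gate) (Gs : List ℕ) : Term := machineT fetchCode (instrs U Gs)

theorem cnt_instrs (Gs : List ℕ) : ∀ o ∈ instrs U Gs, ∀ i, cnt i o = 0 := by
  intro o ho i
  simp only [instrs, List.mem_append, List.mem_cons, List.not_mem_nil, or_false,
    List.mem_map] at ho
  rcases ho with (rfl | rfl | rfl | rfl | rfl | rfl) | ⟨j, _, rfl⟩ <;> simp

/-- A state of the machine. -/
def stateT (U : ℕ → Gate) (Gs p : List ℕ) (B P : List Bool) (L R : List ℕ) : Term :=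
  apps (machine U Gs) [bang (machine U Gs), bang (listT [Encodable.encode p]), bang (bitsT B),
    bang (bitsT P), qlistT L, qlistT R]

theorem run_fetch {Gs p : List ℕ} {B P : List Bool} {L R : List ℕ} {o T : Term}
    (ho : (instrs U Gs)[p.headI]? = some o)
    (h : Red U (apps o [bang (machine U Gs), bang (listT [Encodable.encode p.tail]),
      bang (bitsT B), bang (bitsT P), qlistT L, qlistT R]) T) :
    Red U (stateT U Gs p B P L R) T :=
  run_machineT (cnt_instrs Gs) ho (exists_fetch_code.choose_spec p) _ h

variable {Gs : List ℕ} {B : List Bool} {V : Finset ℕ} {Φ : (ℕ → Bool) → ℂ}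

/-- The head of the empty program defaults to 0, which is the index of the stop instruction. -/
theorem run_stop (P : List Bool) (L : List ℕ) :
    Run U (V, Φ, stateT U Gs [] B P L []) (V, Φ, qlistT L) :=
  (run_fetch (o := stopT) rfl (run_stopT _ _ _ _ L .refl)).run V Φ

theorem run_reset (p : List ℕ) (P : List Bool) (L R : List ℕ) :
    Run U (V, Φ, stateT U Gs (1 :: p) B P L R) (V, Φ, stateT U Gs p B B L R) :=
  (run_fetch (o := resetT) rfl (run_resetT _ _ _ _ _ _ .refl)).run V Φ

theorem run_advance (p : List ℕ) (b : Bool) (P : List Bool) (L R : List ℕ) :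
    Run U (V, Φ, stateT U Gs (2 :: p) B (b :: P) L R) (V, Φ, stateT U Gs p B P L R) :=
  (run_fetch (o := advanceT) rfl (run_advanceT _ _ _ _ _ _ _ .refl)).run V Φ

/-- The name `r` may be any unused one. This freedom lets the simulation give the qubits the names
of the circuit. -/
theorem run_new (p : List ℕ) (b : Bool) (P : List Bool) (L R : List ℕ) {r : ℕ} (hr : r ∉ V) :
    Run U (V, Φ, stateT U Gs (3 :: p) B (b :: P) L R)
      (insert r V, newSem b r Φ, stateT U Gs p B (b :: P) (r :: L) R) := by
  refine ((run_fetch (o := newT) rfl (run_newT _ _ _ _ _ _ _ .refl)).run V Φ).trans ?_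
  have h := TStep.apps (((TStep.new (U := U) b r).qconsT (qlistT L)).rightApp
    (apps (machine U Gs) [bang (machine U Gs), bang (listT [Encodable.encode p]), bang (bitsT B),
      bang (bitsT (b :: P))])) [qlistT R]
  refine h.run (V := V) (fun c s e => ?_) Φ
  cases e
  exact hr

theorem run_move (p : List ℕ) (P : List Bool) (x : ℕ) (L R : List ℕ) :
    Run U (V, Φ, stateT U Gs (4 :: p) B P (x :: L) R)
      (V, Φ, stateT U Gs p B P L (x :: R)) :=
  (run_fetch (o := moveT) rfl (run_moveT _ _ _ _ _ _ _ .refl)).run V Φ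

theorem run_pull (p : List ℕ) (P : List Bool) (x y : ℕ) (L R : List ℕ) :
    Run U (V, Φ, stateT U Gs (5 :: p) B P (x :: L) (y :: R))
      (V, Φ, stateT U Gs p B P (x :: y :: L) R) :=
  (run_fetch (o := pullT) rfl (run_pullT _ _ _ _ _ _ _ _ .refl)).run V Φ

/-- The gate instructions follow the six fixed ones, whence the offset 6. -/
theorem run_gate (p : List ℕ) (P : List Bool) {i : ℕ} (hi : i ∈ Gs) (xs L R : List ℕ)
    (hk : (U i).arity = xs.length) (hn : xs.Nodup) :
    Run U (V, Φ, stateT U Gs ((6 + Gs.idxOf i) :: p) B P (xs ++ L) R)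
      (V, gateSem (U i) xs Φ, stateT U Gs p B P (xs ++ L) R) := by
  have hlt : Gs.idxOf i < Gs.length := List.idxOf_lt_length_iff.mpr hi
  refine ((run_fetch (o := gateT U i) ?_ .refl).run V Φ).trans
    (run_gateT i _ _ _ _ _ xs L hk hn V Φ)
  rw [instrs, List.getElem?_append_right (by simp)]
  simp [List.getElem?_eq_getElem hlt]

theorem run_advances (p : List ℕ) (k : ℕ) (P Q : List Bool) (L R : List ℕ) (hk : P.length = k) :
    Run U (V, Φ, stateT U Gs (List.replicate k 2 ++ p) B (P ++ Q) L R)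
      (V, Φ, stateT U Gs p B Q L R) := by
  induction P generalizing k with
  | nil => subst hk; exact .refl _
  | cons b P ih =>
    subst hk
    exact (run_advance _ b _ L R).trans (ih _ rfl)

theorem run_moves (p : List ℕ) (P : List Bool) (A L R : List ℕ) :
    Run U (V, Φ, stateT U Gs (List.replicate A.length 4 ++ p) B P (A ++ L) R)
      (V, Φ, stateT U Gs p B P L (A.reverse ++ R)) := by
  induction A generalizing R with
  | nil => exact .refl _
  | cons a A ih =>
    refine (run_move _ P a _ R).trans ?_
    have := ih (a :: R)
    rwa [List.append_cons A.reverse, ← List.reverse_cons] at this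

theorem run_pulls (p : List ℕ) (P : List Bool) (x : ℕ) (A L R : List ℕ) :
    Run U (V, Φ, stateT U Gs (List.replicate A.length 5 ++ p) B P (x :: L) (A ++ R))
      (V, Φ, stateT U Gs p B P (x :: (A.reverse ++ L)) R) := by
  induction A generalizing L with
  | nil => exact .refl _
  | cons a A ih =>
    refine (run_pull _ P x a _ _).trans ?_
    have := ih (a :: L)
    rwa [List.append_cons A.reverse, ← List.reverse_cons] at this

/-- The list `l` with the element `j` moved to the front. -/
def toFront (l : List ℕ) (j : ℕ) : List ℕ :=
  j :: (l.take (l.idxOf j) ++ l.drop (l.idxOf j + 1))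

/-- The instructions that move `j` to the front of the list `l` of qubits. -/
def frontProg (l : List ℕ) (j : ℕ) : List ℕ :=
  List.replicate (l.idxOf j) 4 ++ List.replicate (l.idxOf j) 5

theorem toFront_split {A C : List ℕ} {j : ℕ} (hj : j ∉ A) :
    toFront (A ++ j :: C) j = j :: (A ++ C) := by
  have h : (A ++ j :: C).idxOf j = A.length := by
    rw [List.idxOf_append_of_notMem hj, List.idxOf_cons_self, add_zero]
  have h2 : (A ++ j :: C).drop (A.length + 1) = C := by
    rw [List.drop_append]
    simp
  rw [toFront, h, h2, List.take_left']
  rfl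

theorem exists_split_of_mem {l : List ℕ} {j : ℕ} (hj : j ∈ l) :
    ∃ A C, l = A ++ j :: C ∧ j ∉ A :=
  let ⟨A, C, h⟩ := List.append_of_mem hj
  by
    clear h
    induction l with
    | nil => simp at hj
    | cons a l ih =>
      by_cases h : j = a
      · exact ⟨[], l, by simp [h], by simp⟩
      · obtain ⟨A, C, h1, h2⟩ := ih (by simpa [h] using hj)
        exact ⟨a :: A, C, by simp [h1], by simp [h, h2]⟩

theorem toFront_perm {l : List ℕ} {j : ℕ} (hj : j ∈ l) : (toFront l j).Perm l := by
  obtain ⟨A, C, rfl, hA⟩ := exists_split_of_mem hj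
  rw [toFront_split hA]
  exact List.perm_middle.symm

/-- For `l = A ++ j :: C` with `j ∉ A`, moving the elements of `A` away stacks them in reverse on
the second list, and pulling them back to the place behind `j` reverses them again. The second list
ends up empty. -/
theorem run_front (p : List ℕ) (P : List Bool) {l : List ℕ} {j : ℕ} (hj : j ∈ l) :
    Run U (V, Φ, stateT U Gs (frontProg l j ++ p) B P l [])
      (V, Φ, stateT U Gs p B P (toFront l j) []) := by
  obtain ⟨A, C, rfl, hA⟩ := exists_split_of_mem hj
  have h : (A ++ j :: C).idxOf j = A.length := by
    rw [List.idxOf_append_of_notMem hA, List.idxOf_cons_self, add_zero]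
  rw [toFront_split hA, frontProg, h, List.append_assoc]
  refine (run_moves _ P A _ []).trans ?_
  have h2 := run_pulls (U := U) (Gs := Gs) (B := B) (V := V) (Φ := Φ) p P j A.reverse C []
  rwa [List.length_reverse, List.reverse_reverse] at h2

/-- Move the elements of a list one after the other to the front of the list of qubits. The state
consists of the program so far and the list of qubits. -/
def frontsStep (s : List ℕ × List ℕ) (js : List ℕ) : List ℕ × List ℕ :=
  js.foldl (fun s j => (s.1 ++ frontProg s.2 j, toFront s.2 j)) s

/-- Apply a gate to given elements of the list of qubits. -/
def gateStep (Gs : List ℕ) (s : List ℕ × List ℕ) (a : ℕ × List ℕ) : List ℕ × List ℕ :=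
  let s' := frontsStep s a.2.reverse
  (s'.1 ++ [6 + Gs.idxOf a.1], s'.2)

/-- The names of `m` qubits. -/
def names (m : ℕ) : List ℕ := (List.range m).map (fun i => i + 1)

/-- The program for a circuit on `m` qubits, after the program `p` for the creation of the
qubits. -/
def circuitProg (Gs : List ℕ) (p : List ℕ) (m : ℕ) (k : Circuit) : List ℕ :=
  (frontsStep (k.foldl (gateStep Gs) (p, names m)) (names m).reverse).1

/-- The program for the creation of qubits with names `1,…,k`, the `i`-th one from the element with
index `n + 1 - g i` of the list of input bits. -/
def initProg (n : ℕ) (g : ℕ → ℕ) (k : ℕ) : List ℕ :=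
  Nat.rec [] (fun i p => (1 :: (List.replicate (n + 1 - g (i + 1)) 2 ++ [3])) ++ p) k

/-! The effect of the programs. -/

theorem frontsStep_fst (p l : List ℕ) (js : List ℕ) :
    frontsStep (p, l) js = (p ++ (frontsStep ([], l) js).1, (frontsStep ([], l) js).2) := by
  induction js generalizing p l with
  | nil => simp [frontsStep]
  | cons j js ih =>
    have e : ∀ q, frontsStep (q, l) (j :: js) =
      frontsStep (q ++ frontProg l j, toFront l j) js := fun q => rfl
    rw [e, e, ih, ih ([] ++ _)]
    simp

theorem frontsStep_snd (p l : List ℕ) (js : List ℕ) :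
    (frontsStep (p, l) js).2 = js.foldl toFront l := by
  induction js generalizing p l with
  | nil => rfl
  | cons j js ih => exact ih _ _

theorem foldl_toFront_perm {l js : List ℕ} (h : ∀ j ∈ js, j ∈ l) : (js.foldl toFront l).Perm l := by
  induction js generalizing l with
  | nil => exact .refl _
  | cons j js ih =>
    have hp := toFront_perm (h j (by simp))
    exact (ih (fun i hi => hp.mem_iff.mpr (h i (by simp [hi])))).trans hp

/-- The elements already brought to the front form `Y`. As the next ones lie in `Z` and not in `Y`,
each is put before `Y` without disturbing its order. -/
theorem foldl_toFront {js Y Z : List ℕ} (hl : ∀ j ∈ js, j ∈ Z) (hn : js.Nodup)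
    (hY : ∀ j ∈ js, j ∉ Y) : ∃ X, js.foldl toFront (Y ++ Z) = js.reverse ++ Y ++ X := by
  induction js generalizing Y Z with
  | nil => exact ⟨Z, rfl⟩
  | cons j js ih =>
    obtain ⟨A, C, rfl, hA⟩ := exists_split_of_mem (hl j (by simp))
    rw [List.nodup_cons] at hn
    have h1 : toFront (Y ++ (A ++ j :: C)) j = (j :: Y) ++ (A ++ C) := by
      rw [← List.append_assoc, toFront_split (by simp [hA, hY j (by simp)]), List.append_assoc]
      rfl
    rw [List.foldl_cons, h1]
    have hne : ∀ i ∈ js, i ≠ j := fun i hi e => hn.1 (e ▸ hi)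
    have g1 : ∀ i ∈ js, i ∈ A ++ C := fun i hi => by
      have := hl i (by simp [hi])
      simpa [hne i hi] using this
    have g2 : ∀ i ∈ js, i ∉ j :: Y := fun i hi => by
      simpa [hne i hi] using hY i (by simp [hi])
    obtain ⟨X, hX⟩ := ih g1 hn.2 g2
    exact ⟨X, by rw [hX]; simp⟩

theorem run_fronts (p : List ℕ) (P : List Bool) {l js : List ℕ} (h : ∀ j ∈ js, j ∈ l) :
    Run U (V, Φ, stateT U Gs ((frontsStep ([], l) js).1 ++ p) B P l [])
      (V, Φ, stateT U Gs p B P (js.foldl toFront l) []) := by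
  induction js generalizing l with
  | nil => exact .refl _
  | cons j js ih =>
    have hp := toFront_perm (h j (by simp))
    have e : frontsStep ([], l) (j :: js) = frontsStep ([] ++ frontProg l j, toFront l j) js := rfl
    rw [e, frontsStep_fst, List.nil_append, List.append_assoc]
    exact (run_front _ P (h j (by simp))).trans
      (ih (fun i hi => hp.mem_iff.mpr (h i (by simp [hi]))))

/-- The operation determined by a circuit. -/
def circuitSem (U : ℕ → Gate) (k : Circuit) (Φ : (ℕ → Bool) → ℂ) : (ℕ → Bool) → ℂ :=
  k.foldl (fun Ψ a => gateSem (U a.1) a.2 Ψ) Φ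

theorem gateStep_fst (p l : List ℕ) (k : Circuit) :
    k.foldl (gateStep Gs) (p, l) =
      (p ++ (k.foldl (gateStep Gs) ([], l)).1, (k.foldl (gateStep Gs) ([], l)).2) := by
  induction k generalizing p l with
  | nil => simp
  | cons a k ih =>
    simp only [List.foldl_cons, gateStep]
    rw [ih, frontsStep_fst, ih ((frontsStep _ _).1 ++ _)]
    simp

/-- The arguments of a gate are brought to the front in reverse order, so they end there in the
order required. Operators refer to qubits by name, hence it suffices to know the list up to
permutation between gates. -/
theorem run_gates (p : List ℕ) (P : List Bool) {l : List ℕ} (k : Circuit)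
    (hk : ∀ a ∈ k, a.1 ∈ Gs ∧ a.2.length = (U a.1).arity ∧ a.2.Nodup ∧ ∀ r ∈ a.2, r ∈ l) :
    ∃ l', l'.Perm l ∧ (k.foldl (gateStep Gs) ([], l)).2 = l' ∧
      Run U (V, Φ, stateT U Gs ((k.foldl (gateStep Gs) ([], l)).1 ++ p) B P l [])
        (V, circuitSem U k Φ, stateT U Gs p B P l' []) := by
  induction k generalizing l Φ with
  | nil => exact ⟨l, .refl _, rfl, .refl _⟩
  | cons a k ih =>
    obtain ⟨h1, h2, h3, h4⟩ := hk a (by simp)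
    have hp : (a.2.reverse.foldl toFront l).Perm l :=
      foldl_toFront_perm (fun j hj => h4 j (by simpa using hj))
    obtain ⟨X, hX⟩ := foldl_toFront (js := a.2.reverse) (Y := []) (Z := l)
      (fun j hj => h4 j (by simpa using hj)) (List.nodup_reverse.mpr h3) (by simp)
    rw [List.nil_append, List.reverse_reverse, List.append_nil] at hX
    obtain ⟨l', hl1, hl2, hl3⟩ := ih (Φ := gateSem (U a.1) a.2 Φ)
      (l := a.2.reverse.foldl toFront l) (fun b hb => by
        obtain ⟨g1, g2, g3, g4⟩ := hk b (by simp [hb])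
        exact ⟨g1, g2, g3, fun r hr => hp.mem_iff.mpr (g4 r hr)⟩)
    have e : gateStep Gs ([], l) a = ((frontsStep ([], l) a.2.reverse).1 ++ [6 + Gs.idxOf a.1],
      a.2.reverse.foldl toFront l) := by
      simp only [gateStep, frontsStep_snd]
    refine ⟨l', hl1.trans hp, ?_, ?_⟩
    · rw [List.foldl_cons, e, gateStep_fst]
      exact hl2
    · rw [List.foldl_cons, e, gateStep_fst, List.append_assoc, List.append_assoc]
      refine (run_fronts _ P (fun j hj => h4 j (by simpa using hj))).trans ?_
      refine Run.trans ?_ hl3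
      rw [hX, List.singleton_append]
      exact run_gate _ P h1 a.2 X [] h2.symm h3

theorem names_nodup (m : ℕ) : (names m).Nodup :=
  List.nodup_range.map (fun a b h => by simpa using h)

theorem mem_names {m r : ℕ} : r ∈ names m ↔ r ∈ Finset.Icc 1 m := by
  simp only [names, List.mem_map, List.mem_range, Finset.mem_Icc]
  constructor
  · rintro ⟨i, hi, rfl⟩
    omega
  · rintro ⟨h1, h2⟩
    exact ⟨r - 1, by omega, by omega⟩

theorem circuitProg_eq (p : List ℕ) (m : ℕ) (k : Circuit) :
    circuitProg Gs p m k = p ++ circuitProg Gs [] m k := by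
  unfold circuitProg
  rw [gateStep_fst, frontsStep_fst]
  rcases k.foldl (gateStep Gs) ([], names m) with ⟨q, l⟩
  rw [frontsStep_fst q]
  simp

theorem run_circuitProg (P : List Bool) (m : ℕ) (k : Circuit)
    (hk : ∀ a ∈ k, a.1 ∈ Gs ∧ a.2.length = (U a.1).arity ∧ a.2.Nodup ∧
      ∀ r ∈ a.2, r ∈ Finset.Icc 1 m) :
    Run U (V, Φ, stateT U Gs (circuitProg Gs [] m k) B P (names m) [])
      (V, circuitSem U k Φ, qlistT (names m)) := by
  set l' := (k.foldl (gateStep Gs) ([], names m)).2 with hl'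
  obtain ⟨l'', h1, h2, h3⟩ := run_gates (U := U) (Gs := Gs) (B := B) (V := V) (Φ := Φ)
    ((frontsStep ([], l') (names m).reverse).1 ++ []) P (l := names m) k
    (fun a ha => by
      obtain ⟨g1, g2, g3, g4⟩ := hk a ha
      exact ⟨g1, g2, g3, fun r hr => mem_names.mpr (g4 r hr)⟩)
  rw [← hl'] at h2
  subst h2
  have hm : ∀ j ∈ (names m).reverse, j ∈ l' := fun j hj =>
    h1.mem_iff.mpr (List.mem_reverse.mp hj)
  have e : circuitProg Gs [] m k = (k.foldl (gateStep Gs) ([], names m)).1 ++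
      ((frontsStep ([], l') (names m).reverse).1 ++ []) := by
    rw [circuitProg, List.append_nil, ← Prod.mk.eta (p := k.foldl _ _), frontsStep_fst]
  obtain ⟨X, hX⟩ := foldl_toFront (js := (names m).reverse) (Y := []) (Z := l') hm
    (List.nodup_reverse.mpr (names_nodup m)) (by simp)
  rw [List.nil_append, List.reverse_reverse, List.append_nil] at hX
  -- Sorting puts all names in front; since the list is a permutation of them, nothing is left
  -- behind.
  have hX0 : X = [] := by
    have := ((foldl_toFront_perm hm).trans h1).length_eq
    rw [hX, List.length_append] at this
    exact List.length_eq_zero_iff.mp (by omega)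
  rw [hX0, List.append_nil] at hX
  rw [e]
  refine h3.trans ((run_fronts _ P hm).trans ?_)
  rw [hX]
  exact run_stop P (names m)

/-- The amplitude of `f` in the basis vector given by `b` on the names `k + 1, …, m`. -/
def ketSem (b : ℕ → Bool) (k m : ℕ) (f : ℕ → Bool) : ℂ :=
  ∏ i ∈ Finset.Icc (k + 1) m, if f i = b i then 1 else 0

/-- The amplitude of a basis vector is a product of one indicator per qubit, and a creation
contributes its factor. -/
theorem newSem_ketSem (b : ℕ → Bool) {k m : ℕ} (h : k < m) :
    newSem (b (k + 1)) (k + 1) (ketSem b (k + 1) m) = ketSem b k m := by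
  funext f
  have e : Finset.Icc (k + 1) m = insert (k + 1) (Finset.Icc (k + 1 + 1) m) := by
    ext x
    simp only [Finset.mem_Icc, Finset.mem_insert]
    omega
  rw [newSem, ketSem, ketSem, e, Finset.prod_insert (by simp)]
  split_ifs <;> simp

/-- A created qubit goes to the front of the list, so the qubits are created from the last name down
to 1 and the list comes out sorted. Resetting the pointer before each creation makes its final
position depend on that qubit alone. -/
theorem run_initProg (p : List ℕ) (b : ℕ → Bool) (n : ℕ) (g : ℕ → ℕ) (m k : ℕ) (hk : k ≤ m)
    (hB : ∀ i ∈ Finset.Icc 1 m, ∃ P, B.drop (n + 1 - g i) = b i :: P) (P : List Bool) :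
    ∃ P', Run U (Finset.Icc (k + 1) m, ketSem b k m,
        stateT U Gs (initProg n g k ++ p) B P ((names m).drop k) [])
      (Finset.Icc 1 m, ketSem b 0 m, stateT U Gs p B P' (names m) []) := by
  induction k generalizing P with
  | zero => exact ⟨P, .refl _⟩
  | succ k ih =>
    have hm : k + 1 ∈ Finset.Icc 1 m := by simpa using hk
    obtain ⟨Q, hQ⟩ := hB (k + 1) hm
    obtain ⟨P', hP'⟩ := ih (by omega) (b (k + 1) :: Q)
    refine ⟨P', Run.trans ?_ hP'⟩
    have e : initProg n g (k + 1) ++ p = 1 :: (List.replicate (n + 1 - g (k + 1)) 2 ++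
        (3 :: (initProg n g k ++ p))) := by
      simp [initProg]
    have hlen : n + 1 - g (k + 1) ≤ B.length := by
      by_contra hc
      rw [List.drop_eq_nil_of_le (by omega)] at hQ
      simp at hQ
    have hd : (names m).drop k = (k + 1) :: (names m).drop (k + 1) := by
      have : k < (names m).length := by simpa [names] using hk
      rw [List.drop_eq_getElem_cons this]
      simp [names]
    have hI : insert (k + 1) (Finset.Icc (k + 1 + 1) m) = Finset.Icc (k + 1) m := by
      ext x
      simp only [Finset.mem_Icc, Finset.mem_insert]
      omega
    rw [e]
    refine (run_reset _ P _ _).trans ?_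
    have h1 := run_advances (U := U) (Gs := Gs) (B := B) (V := Finset.Icc (k + 1 + 1) m)
      (Φ := ketSem b (k + 1) m) (3 :: (initProg n g k ++ p)) (n + 1 - g (k + 1))
      (B.take (n + 1 - g (k + 1))) (B.drop (n + 1 - g (k + 1))) ((names m).drop (k + 1)) []
      (by simpa using hlen)
    rw [List.take_append_drop] at h1
    refine h1.trans ?_
    rw [hQ]
    have h2 := run_new (U := U) (Gs := Gs) (B := B) (V := Finset.Icc (k + 1 + 1) m)
      (Φ := ketSem b (k + 1) m) (initProg n g k ++ p) (b (k + 1)) Q ((names m).drop (k + 1)) []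
      (r := k + 1) (by simp)
    rw [newSem_ketSem b (by omega), ← hd, hI] at h2
    exact h2

end QCalc

end

noncomputable section

namespace QCalc
open Term

/-! ### Computability of the programs -/

theorem primrec_replicate (a : ℕ) : Primrec (fun k : ℕ => List.replicate k a) := by
  have h : Primrec (fun k : ℕ => (List.range k).map (fun _ => a)) :=
    Primrec.list_map Primrec.list_range (Primrec.const a).to₂
  exact h.of_eq (fun k => by simp)

theorem primrec_idxOf : Primrec₂ (fun (l : List ℕ) (j : ℕ) => l.idxOf j) :=
  Primrec.list_idxOf.comp Primrec.snd Primrec.fst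

theorem primrec_toFront : Primrec₂ toFront := by
  have h := primrec_idxOf
  refine Primrec.list_cons.comp Primrec.snd (Primrec.list_append.comp
    (Primrec.list_take.comp h Primrec.fst) (Primrec.list_drop.comp (Primrec.succ.comp h) Primrec.fst))

theorem primrec_frontProg : Primrec₂ frontProg :=
  Primrec.list_append.comp ((primrec_replicate 4).comp primrec_idxOf)
    ((primrec_replicate 5).comp primrec_idxOf)

theorem primrec_frontsStep : Primrec₂ frontsStep := by
  refine Primrec.list_foldl (f := fun x : (List ℕ × List ℕ) × List ℕ => x.2) (g := fun x => x.1)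
    (h := fun _ y => (y.1.1 ++ frontProg y.1.2 y.2, toFront y.1.2 y.2)) Primrec.snd Primrec.fst ?_
  have h1 : Primrec (fun y : ((List ℕ × List ℕ) × List ℕ) × ((List ℕ × List ℕ) × ℕ) => y.2.1.2) :=
    Primrec.snd.comp (Primrec.fst.comp Primrec.snd)
  have h2 : Primrec (fun y : ((List ℕ × List ℕ) × List ℕ) × ((List ℕ × List ℕ) × ℕ) => y.2.2) :=
    Primrec.snd.comp Primrec.snd
  exact Primrec.pair (Primrec.list_append.comp (Primrec.fst.comp (Primrec.fst.comp Primrec.snd))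
    (primrec_frontProg.comp h1 h2)) (primrec_toFront.comp h1 h2)

theorem primrec_gateStep (Gs : List ℕ) : Primrec₂ (gateStep Gs) := by
  have h : Primrec (fun x : (List ℕ × List ℕ) × (ℕ × List ℕ) => frontsStep x.1 x.2.2.reverse) :=
    primrec_frontsStep.comp Primrec.fst
      (Primrec.list_reverse.comp (Primrec.snd.comp Primrec.snd))
  refine Primrec.pair (Primrec.list_append.comp (Primrec.fst.comp h) ?_) (Primrec.snd.comp h)
  exact Primrec.list_cons.comp (Primrec.nat_add.comp (Primrec.const 6)
    (primrec_idxOf.comp (Primrec.const Gs) (Primrec.fst.comp Primrec.snd))) (Primrec.const [])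

theorem primrec_names : Primrec names :=
  Primrec.list_map Primrec.list_range (Primrec.succ.comp Primrec.snd)

theorem primrec_circuitProg (Gs : List ℕ) :
    Primrec (fun x : List ℕ × ℕ × Circuit => circuitProg Gs x.1 x.2.1 x.2.2) := by
  have hn : Primrec (fun x : List ℕ × ℕ × Circuit => names x.2.1) :=
    primrec_names.comp (Primrec.fst.comp Primrec.snd)
  refine Primrec.fst.comp (primrec_frontsStep.comp ?_ (Primrec.list_reverse.comp hn))
  exact Primrec.list_foldl (h := fun _ y => gateStep Gs y.1 y.2) (Primrec.snd.comp Primrec.snd)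
    (Primrec.pair Primrec.fst hn)
    ((primrec_gateStep Gs).comp (Primrec.fst.comp Primrec.snd) (Primrec.snd.comp Primrec.snd))

/-- Assembling a program from the circuit is primitive recursive; only the given functions and the
recursion up to `f n` need general computability. -/
theorem computable_program (Gs : List ℕ) {f h : ℕ → ℕ} {g : ℕ × ℕ → ℕ} {K : ℕ → Circuit}
    (hf : Computable f) (hg : Computable g) (hh : Computable h) (hK : Computable K) :
    Computable (fun n => Encodable.encode (circuitProg Gs (initProg n (fun i => g (n, i)) (f n))
      (f n) (K (h n)))) := by
  refine Computable.encode.comp ((primrec_circuitProg Gs).to_comp.comp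
    (Computable.pair ?_ (Computable.pair hf (hK.comp hh))))
  refine Computable.nat_rec (h := fun n y => (1 :: (List.replicate (n + 1 - g (n, y.1 + 1)) 2 ++
    [3])) ++ y.2) hf (Computable.const []) ?_
  have hi : Computable (fun x : ℕ × ℕ × List ℕ => g (x.1, x.2.1 + 1)) :=
    hg.comp (Computable.pair Computable.fst
      (Computable.succ.comp (Computable.fst.comp Computable.snd)))
  have hs : Computable (fun x : ℕ × ℕ × List ℕ => x.1 + 1 - g (x.1, x.2.1 + 1)) :=
    Primrec.nat_sub.to_comp.comp (Computable.succ.comp Computable.fst) hi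
  exact Primrec.list_append.to_comp.comp (Primrec.list_cons.to_comp.comp (Computable.const 1)
    (Primrec.list_append.to_comp.comp ((primrec_replicate 2).to_comp.comp hs)
      (Computable.const [3]))) (Computable.snd.comp Computable.snd)

end QCalc

end

noncomputable section

set_option linter.unusedSimpArgs false

namespace QCalc
open Term

variable {U : ℕ → Gate}

local notation:75 f:75 " ⬝ " x:76 => Term.app f (Term.bang x)
local prefix:max "ƛ" => lamBang
local prefix:max "λ₁" => lam Pat.var
local prefix:max "#" => Term.var

/-! ### The term that simulates a family of circuits -/

open Turing.ToPartrec (Code)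

/-- Start the machine on the program computed by the code `c` from the length of the input. -/
def startT (D : Term) (c : Code) : Term :=
  ƛ(ƛ(ƛ(codeT c ⬝ ƛ(app (app (D ⬝ D ⬝ #0 ⬝ consT (bit true) #1 ⬝ consT (bit true) #1) qnilT) qnilT) ⬝
    consT #1 nilT)))

/-- Read one bit of the input; pass to `Y` at its end. -/
def readT (Y : Term) : Term :=
  ƛ(λ₁(ƛ(ƛ(ƛ(#3 ⬝ #2 ⬝ Y ⬝ #2 ⬝ succT #1 ⬝ consT #4 #0)))))

/-- Read the input and start the machine. -/
def inputT (Y : Term) : Term :=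
  ƛ(#0 ⬝ readT Y ⬝ Y ⬝ readT Y ⬝ zeroT ⬝ consT (bit false) nilT)

theorem subst_bit (σ : ℕ → Term) (b : Bool) : subst σ (bit b) = bit b := rfl

theorem subst_qnil (σ : ℕ → Term) : subst σ qnilT = qnilT := rfl

theorem cnt_startT {D : Term} (hD : ∀ i, cnt i D = 0) (c : Code) (i : ℕ) :
    cnt i (startT D c) = 0 := by
  simp [startT, hD]

theorem cnt_readT {Y : Term} (hY : ∀ i, cnt i Y = 0) (i : ℕ) : cnt i (readT Y) = 0 := by
  simp [readT, hY, Pat.size]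

theorem cnt_inputT {Y : Term} (hY : ∀ i, cnt i Y = 0) (i : ℕ) : cnt i (inputT Y) = 0 := by
  simp [inputT, hY, cnt_readT]

theorem run_startT {D S T : Term} (hD : ∀ i, cnt i D = 0) {c : Code} {n p : ℕ}
    (hc : [p] ∈ c.eval [n]) (B : List Bool)
    (h : Red U (apps D [bang D, bang (listT [p]), bang (bitsT (true :: B)),
      bang (bitsT (true :: B)), qnilT, qnilT]) T) :
    Red U (apps (startT D c) [bang S, bang (natT n), bang (bitsT B)]) T := by
  have hD : ∀ σ, subst σ D = D := subst_of_closed hD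
  rw [← subst_var (startT _ _), startT]
  simp only [bitsT] at h
  repeat' (with_reducible
    first
    | exact h | apply run_app | apply run_bang
    | simp only [subst_consT, subst_nilT, scons_zero, scons_succ, subst_v, subst_app, subst_bang,
        subst_codeT, subst_bit, subst_qnil, hD])
  refine red_codeT c [n] [p] _ T _ hc ?_
  repeat' (with_reducible
    first
    | exact h | apply run_app | apply run_bang
    | simp only [subst_consT, subst_nilT, scons_zero, scons_succ, subst_v, subst_app, subst_bang,
        subst_codeT, subst_bit, subst_qnil, hD])

/-- An input list selects between the reader and `Y`. The reader gets a bit and the remaining list,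
and restarts the latter with the numeral increased and the bit put before the accumulator, so the
bits arrive reversed. The rest of the list is not below `!`, hence bound linearly and used once. -/
theorem run_readT {Y T : Term} (hY : ∀ i, cnt i Y = 0) (cs B : List Bool) (n : ℕ)
    (h : Red U (apps Y [bang (readT Y), bang (natT (n + cs.length)),
      bang (bitsT (cs.reverse ++ B))]) T) :
    Red U (apps (list (cs.map (fun c => bang (bit c)))) [bang (readT Y), bang Y, bang (readT Y),
      bang (natT n), bang (bitsT B)]) T := by
  have hYs : ∀ σ, subst σ Y = Y := subst_of_closed hY
  have hR : ∀ σ, subst σ (readT Y) = readT Y := subst_of_closed (cnt_readT hY)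
  induction cs generalizing n B with
  | nil => exact run_qnilT (by simpa using h)
  | cons c cs ih =>
    have h := ih (c :: B) (n + 1) (by
      rw [List.length_cons, List.reverse_cons, List.append_assoc] at h
      rwa [Nat.add_right_comm])
    simp only [natT, bitsT] at h
    refine run_qconsT (L := list (cs.map (fun c => bang (bit c)))) ?_
    rw [← subst_var (readT Y), readT] at h ⊢
    repeat' (with_reducible
      first
      | exact h | apply run_app | apply run_bang | apply run_lam
      | simp only [subst_consT, subst_succT, subst_nilT, scons_zero, scons_succ, subst_v,
          subst_app, subst_bang, subst_bit, hYs])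

theorem run_inputT {Y T : Term} (hY : ∀ i, cnt i Y = 0) (cs : List Bool)
    (h : Red U (apps Y [bang (readT Y), bang (natT cs.length),
      bang (bitsT (cs.reverse ++ [false]))]) T) :
    Red U (app (inputT Y) (bits cs)) T := by
  have hYs : ∀ σ, subst σ Y = Y := subst_of_closed hY
  have hR : ∀ σ, subst σ (readT Y) = readT Y := subst_of_closed (cnt_readT hY)
  have h := run_readT hY cs [false] 0 (by simpa using h)
  simp only [natT, bitsT] at h
  change Red U (apps (inputT Y) [bits cs]) T
  rw [← subst_var (inputT Y), inputT, bits]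
  repeat' (with_reducible
    first
    | exact h | apply run_app | apply run_bang
    | simp only [subst_consT, subst_zeroT, subst_nilT, scons_zero, scons_succ, subst_v,
        subst_app, subst_bang, subst_bit, hYs, hR])

/-- The term for a family of circuits, where the code `c` computes the programs. -/
def familyT (U : ℕ → Gate) (Gs : List ℕ) (c : Code) : Term := inputT (startT (machine U Gs) c)

theorem cnt_machine (Gs : List ℕ) (i : ℕ) : cnt i (machine U Gs) = 0 :=
  cnt_machineT fetchCode (cnt_instrs Gs) i

theorem cnt_familyT (Gs : List ℕ) (c : Code) (i : ℕ) : cnt i (familyT U Gs c) = 0 :=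
  cnt_inputT (cnt_startT (cnt_machine Gs) c) i

/-- In the reversed list the sentinel `true` for index `n + 1` comes first and the sentinel `false`
for index 0 comes last, so `inputBit cs j` has position `n + 1 - j`. -/
theorem drop_input (cs : List Bool) {j : ℕ} (hj : j ≤ cs.length + 1) :
    ∃ P, (true :: (cs.reverse ++ [false])).drop (cs.length + 1 - j) = inputBit cs j :: P := by
  have hl : cs.length + 1 - j < (true :: (cs.reverse ++ [false])).length := by simp
  rw [List.drop_eq_getElem_cons hl]
  refine ⟨_, List.cons_eq_cons.mpr ⟨?_, rfl⟩⟩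
  rcases j with _ | j
  · simp [inputBit]
  · rcases Nat.eq_or_lt_of_le (show j ≤ cs.length by omega) with rfl | h
    · simp [inputBit]
    · have e : cs.length + 1 - (j + 1) = (cs.length - 1 - j) + 1 := by omega
      have h2 : cs.length - 1 - (cs.length - 1 - j) = j := by omega
      simp only [e, List.getElem_cons_succ, inputBit]
      rw [List.getElem_append_left (by simp; omega), List.getElem_reverse]
      simp [h2, List.getElem?_eq_getElem h]

theorem run_familyT {Gs : List ℕ} {c : Code} {f h : ℕ → ℕ} {g : ℕ × ℕ → ℕ} {K : ℕ → Circuit}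
    (hc : ∀ n, [Encodable.encode (circuitProg Gs (initProg n (fun i => g (n, i)) (f n)) (f n)
      (K (h n)))] ∈ c.eval [n])
    (hg : ∀ n m, 1 ≤ m → m ≤ f n → g (n, m) ≤ n + 1)
    (hK : ∀ n, ∀ a ∈ K (h n), a.1 ∈ Gs ∧ a.2.length = (U a.1).arity ∧ a.2.Nodup ∧
      ∀ r ∈ a.2, r ∈ Finset.Icc 1 (f n)) (cs : List Bool) :
    Run U (∅, fun _ => 1, app (familyT U Gs c) (bits cs))
      (Finset.Icc 1 (f cs.length), circuitSem U (K (h cs.length))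
        (ketSem (fun i => inputBit cs (g (cs.length, i))) 0 (f cs.length)),
        qlistT (names (f cs.length))) := by
  set n := cs.length with hn
  set m := f n with hm
  have h1 : Red U (app (familyT U Gs c) (bits cs)) _ :=
    run_inputT (cnt_startT (cnt_machine Gs) c) cs
      (run_startT (cnt_machine Gs) (hc n) (cs.reverse ++ [false]) .refl)
  refine (h1.run _ _).trans ?_
  obtain ⟨P, hP⟩ := run_initProg (U := U) (Gs := Gs) (B := true :: (cs.reverse ++ [false]))
    (circuitProg Gs [] m (K (h n))) (fun i => inputBit cs (g (n, i))) n (fun i => g (n, i)) m m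
    le_rfl (fun i hi => by
      rw [Finset.mem_Icc] at hi
      exact drop_input cs (hg n i hi.1 hi.2)) (true :: (cs.reverse ++ [false]))
  -- The creation starts at `k = m`: there are no qubits yet, the empty product gives the vector 1,
  -- and the list is empty.
  rw [← circuitProg_eq] at hP
  have e1 : Finset.Icc (m + 1) m = ∅ := by simp
  have e2 : ketSem (fun i => inputBit cs (g (n, i))) m m = fun _ => 1 := by
    funext x
    simp [ketSem]
  have e3 : (names m).drop m = [] := by simp [names]
  rw [e1, e2, e3] at hP
  exact Run.trans hP (run_circuitProg P m _ (hK n))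

end QCalc

end

noncomputable section

namespace QCalc
open Term

variable {U : ℕ → Gate}

local notation:75 f:75 " ⬝ " x:76 => Term.app f (Term.bang x)
local prefix:max "ƛ" => lamBang
local prefix:max "λ₁" => lam Pat.var
local prefix:max "#" => Term.var

/-! ### The simulating term satisfies the linearity conditions -/

section
variable (f b : Bool) (i r n : ℕ) (M N : Term)

@[simp] theorem ok_var : ok f (var i) := trivial
@[simp] theorem ok_qvar : ok f (qvar r) := trivial
@[simp] theorem ok_bit : ok f (bit b) := trivial
@[simp] theorem ok_gate : ok f (Term.gate i) := trivial
@[simp] theorem ok_bang : ok f (bang M) ↔ ok true M := Iff.rfl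
@[simp] theorem ok_newq : ok f (newq M) ↔ ok true M := Iff.rfl
@[simp] theorem ok_lamBang : ok f (lamBang M) ↔ ok false M := Iff.rfl
@[simp] theorem ok_tup (Ms : Fin (n + 2) → Term) : ok f (tup Ms) ↔ ∀ j, ok true (Ms j) := Iff.rfl
@[simp] theorem ok_lam_var : ok f (lam Pat.var M) ↔ ok false M ∧ cnt 0 M = 1 := by
  simp [ok, Pat.size]
@[simp] theorem ok_lam_tuple :
    ok f (lam (Pat.tuple n) M) ↔ ok false M ∧ ∀ j < n + 2, cnt j M = 1 := Iff.rfl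
@[simp] theorem ok_app : ok false (app M N) ↔ ok false M ∧ ok true N := by simp [ok]
@[simp] theorem ok_app_gate : ok f (app (Term.gate i) N) ↔ ok true N := by simp [ok]

theorem ok_shift (k : ℕ) (h : ok f M) : ok f (shift k M) := ok_rename M f _ h

@[simp] theorem ok_zeroT : ok f zeroT := by simp [zeroT]
@[simp] theorem ok_nilT : ok f nilT := by simp [nilT]
@[simp] theorem ok_qnilT : ok f qnilT := by simp [qnilT]

variable {M N}

theorem ok_succT (h : ok true M) : ok f (succT M) := by simp [succT, ok_shift _ _ 2 h]
theorem ok_consT (h : ok true M) (h' : ok true N) : ok f (consT M N) := by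
  simp [consT, ok_shift _ _ 2 h, ok_shift _ _ 2 h']
theorem ok_qconsT (h : ok true M) (h' : ok true N) : ok f (qconsT M N) := by
  simp [qconsT, ok_shift _ _ 2 h, ok_shift _ _ 2 h']

attribute [simp] qvars_shift
@[simp] theorem qvars_zeroT : zeroT.qvars = ∅ := by simp [zeroT, qvars]
@[simp] theorem qvars_nilT : nilT.qvars = ∅ := by simp [nilT, qvars]
@[simp] theorem qvars_qnilT : qnilT.qvars = ∅ := by simp [qnilT, qvars]
@[simp] theorem qvars_succT : (succT M).qvars = M.qvars := by simp [succT, qvars]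
@[simp] theorem qvars_consT : (consT M N).qvars = M.qvars ∪ N.qvars := by simp [consT, qvars]
@[simp] theorem qvars_qconsT : (qconsT M N).qvars = M.qvars ∪ N.qvars := by simp [qconsT, qvars]

@[simp] theorem ok_codeT (c : Turing.ToPartrec.Code) : ok f (codeT c) := by
  induction c generalizing f <;> simp_all [codeT, loopT, ok_consT, ok_succT]

@[simp] theorem qvars_codeT (c : Turing.ToPartrec.Code) : (codeT c).qvars = ∅ := by
  induction c <;> simp_all [codeT, loopT, qvars]

theorem ok_popT (h : ok false M) (hM : ∀ i, cnt i M = 0) (k : ℕ) (hk : k = 0 → ok f M) :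
    ok f (popT k M) := by
  induction k generalizing f with
  | zero => exact hk rfl
  | succ k ih => simp [popT, ih, h, cnt_popT hM, Pat.size]

theorem qvars_popT (h : M.qvars = ∅) (k : ℕ) : (popT k M).qvars = ∅ := by
  induction k with
  | zero => exact h
  | succ k ih => simp [popT, ih, qvars]

theorem ok_lamsT {k : ℕ} (h : ok false M) (hM : ∀ j < k, cnt j M = 1) : ok false (lamsT k M) := by
  induction k generalizing M with
  | zero => exact h
  | succ k ih =>
    refine ih (by simp [h, hM]) (fun j hj => ?_)
    rw [cnt_lam]
    exact hM _ (by simpa [Pat.size] using hj)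

theorem qvars_lamsT (k : ℕ) (M : Term) : (lamsT k M).qvars = M.qvars := by
  induction k generalizing M with
  | zero => rfl
  | succ k ih => rw [lamsT, ih]; rfl

theorem ok_pushT (k : ℕ) (h : ok true M) : ok true (pushT k M) := by
  unfold pushT
  induction List.range k with
  | nil => exact h
  | cons j l ih => exact ok_qconsT _ (ok_var _ _) ih

theorem qvars_pushT (k : ℕ) (M : Term) : (pushT k M).qvars = M.qvars := by
  unfold pushT
  induction List.range k with
  | nil => rfl
  | cons j l ih => simp [ih, qvars]

end

@[simp] theorem ok_newT (f : Bool) : ok f newT := by simp [newT, goT, Pat.size, ok_qconsT]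
@[simp] theorem ok_moveT (f : Bool) : ok f moveT :=
  ok_popT f (by simp [goT, Pat.size, ok_qconsT]) (by simp [goT, Pat.size]) 1 (by simp)
@[simp] theorem ok_pullT (f : Bool) : ok f pullT := by
  refine ok_popT f ?_ ?_ 1 (by simp)
  · have h : ok false (popT 1 (ƛ(ƛ(ƛ(ƛ(λ₁(λ₁(λ₁(λ₁(goT #7 #6 #5 #4
        (qconsT #0 (qconsT #1 #2)) #3)))))))))) :=
      ok_popT _ (by simp [goT, Pat.size, ok_qconsT]) (by simp [goT, Pat.size]) 1 (by simp)
    simp only [ok_lamBang, ok_lam_var, ok_app, ok_bang, ok_var, h]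
    simp [Pat.size, cnt_popT, goT]
  · simp [goT, Pat.size, cnt_popT]

theorem ok_gateBodyT (i k : ℕ) : ok false (gateBodyT i k) := by
  rcases k with _ | _ | n
  · simp [gateBodyT]
  · simp [gateBodyT, goT, ok_qconsT]
  · simp only [gateBodyT, goT, ok_app, ok_app_gate, ok_lam_tuple, ok_bang, ok_var, ok_tup,
      ok_pushT, cnt_app, cnt_bang, cnt_var, cnt_pushT]
    simp only [true_and, and_true, implies_true]
    intro j hj
    split_ifs <;> omega

/-- The indices below `k + 2` are the `k` qubits and the two lists, all bound linearly. The
remaining state variables are duplicable and not subject to this condition. -/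
theorem cnt_gateBodyT_of_lt (i k : ℕ) {j : ℕ} (hk : 0 < k) (h : j < k + 2) :
    cnt j (gateBodyT i k) = 1 := by
  rcases k with _ | _ | n
  · simp at hk
  · simp [gateBodyT, goT]
    split_ifs <;> omega
  · have e : (∑ x : Fin (n + 2), if (x : ℕ) = j then 1 else 0) = if j < n + 2 then 1 else 0 := by
      split_ifs with hj
      · rw [Finset.sum_eq_single ⟨j, hj⟩]
        · simp
        · intro b _ hb
          exact if_neg (fun h => hb (Fin.ext h))
        · simp
      · exact Finset.sum_eq_zero (fun x _ => if_neg (by omega))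
    simp only [gateBodyT, goT, cnt_app, cnt_lam, cnt_bang, cnt_var, cnt_pushT, cnt_gate, cnt_tup,
      Pat.size, e]
    split_ifs <;> omega

@[simp] theorem ok_gateT (f : Bool) (i : ℕ) : ok f (gateT U i) := by
  have hpos := (U i).arity_pos
  refine ok_popT f ?_ (fun j => ?_) _ (by omega)
  · simp only [ok_lamBang, ok_lam_var, cnt_lam, cnt_lamsT, Pat.size]
    exact ⟨⟨ok_lamsT (ok_gateBodyT i _) (fun j hj => cnt_gateBodyT_of_lt i _ hpos (by omega)),
      cnt_gateBodyT_of_lt i _ hpos (by omega)⟩, cnt_gateBodyT_of_lt i _ hpos (by omega)⟩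
  · have := cnt_gateBodyT i (U i).arity j
    simp only [cnt_lamBang, cnt_lam, cnt_lamsT, Pat.size]
    rw [← this]
    congr 1
    omega

@[simp] theorem qvars_gateT (i : ℕ) : (gateT U i).qvars = ∅ := by
  refine qvars_popT ?_ _
  simp only [qvars, qvars_lamsT]
  rcases (U i).arity with _ | _ | n
  · simp [gateBodyT]
  · simp [gateBodyT, goT, qvars]
  · simp [gateBodyT, goT, qvars, qvars_pushT, Finset.ext_iff]

theorem ok_instrs (Gs : List ℕ) : ∀ o ∈ instrs U Gs, ok true o ∧ o.qvars = ∅ := by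
  intro o ho
  simp only [instrs, List.mem_append, List.mem_cons, List.not_mem_nil, or_false,
    List.mem_map] at ho
  rcases ho with (rfl | rfl | rfl | rfl | rfl | rfl) | ⟨j, _, rfl⟩
  · simp [stopT, qvars, Pat.size]
  · simp [resetT, goT, qvars, Pat.size]
  · simp [advanceT, goT, qvars, Pat.size]
  · exact ⟨ok_newT _, by simp [newT, goT, qvars]⟩
  · exact ⟨ok_moveT _, qvars_popT (by simp [goT, qvars]) 1⟩
  · exact ⟨ok_pullT _, qvars_popT (by simp [goT, qvars, qvars_popT]) 1⟩
  · simp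

theorem ok_selectT {os : List Term} (h : ∀ o ∈ os, ok true o ∧ o.qvars = ∅) :
    ok true (selectT os) ∧ (selectT os).qvars = ∅ := by
  induction os with
  | nil => simp [selectT]
  | cons o os ih =>
    have h1 := h o (by simp)
    have h2 := ih (fun o ho => h o (by simp [ho]))
    simp [selectT, qvars, h1, h2]

theorem ok_machine (Gs : List ℕ) : ok true (machine U Gs) ∧ (machine U Gs).qvars = ∅ := by
  have h := ok_selectT (ok_instrs (U := U) Gs)
  simp [machine, machineT, qvars, h, h.1.toFalse]

theorem ok_familyT (Gs : List ℕ) (c : Turing.ToPartrec.Code) :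
    ok true (familyT U Gs c) ∧ (familyT U Gs c).qvars = ∅ := by
  have h := ok_machine (U := U) Gs
  have hD := cnt_machine (U := U) Gs
  simp [familyT, inputT, readT, startT, qvars, h, h.1.toFalse, ok_consT, ok_succT, hD]

theorem ok_bits (cs : List Bool) (f : Bool) : ok f (bits cs) ∧ (bits cs).qvars = ∅ := by
  have : ok true (list (cs.map (fun c => bang (bit c)))) ∧
      (list (cs.map (fun c => bang (bit c)))).qvars = ∅ := by
    induction cs with
    | nil => simp [list, qvars]
    | cons c cs ih =>
      have h1 : ok true (qconsT (bang (bit c)) (list (cs.map (fun c => bang (bit c))))) :=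
        ok_qconsT _ (by simp) ih.1
      exact ⟨h1, by simp [list, qvars, ih.2]⟩
  exact this

theorem good_familyT (Gs : List ℕ) (c : Turing.ToPartrec.Code) (cs : List Bool) :
    Good (app (familyT U Gs c) (bits cs)) := by
  have h1 := ok_familyT (U := U) Gs c
  have h2 := ok_bits cs true
  refine ⟨(ok_app _ _).mpr ⟨h1.1.toFalse, h2.1⟩, fun r => ?_⟩
  have : r ∉ (app (familyT U Gs c) (bits cs)).qvars := by simp [qvars, h1.2, h2.2]
  rw [mem_qvars_iff, not_not] at this
  simp [this]

end QCalc

end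

noncomputable section

namespace QCalc
open Term

/-! ### Well-formed terms -/

theorem wt_congr (M : Term) : ∀ w w' u : ℕ → ℕ, (∀ i, cnt i M ≠ 0 → w i = w' i) →
    wt w u M = wt w' u M := by
  have hl : ∀ (k : ℕ) (w w' : ℕ → ℕ) (N : Term), (∀ i, cnt (i + k) N ≠ 0 → w i = w' i) →
      ∀ i, cnt i N ≠ 0 → liftW k w i = liftW k w' i := by
    intro k w w' N h i hi
    by_cases hk : i < k
    · simp [liftW, hk]
    · simp only [liftW, hk, if_false]
      exact h _ (by rwa [Nat.sub_add_cancel (by omega)])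
  induction M with
  | var i => exact fun w w' u h => h i (by simp)
  | app M N ihM ihN =>
    intro w w' u h
    exact congrArg₂ _ (ihM _ _ _ (fun i hi => h i (by simp [hi])))
      (ihN _ _ _ (fun i hi => h i (by simp [hi])))
  | tup Ms ih =>
    intro w w' u h
    refine Finset.sum_congr rfl (fun j _ => ih j _ _ _ (fun i hi => h i ?_))
    rw [cnt_tup]
    exact fun h0 => hi (Finset.sum_eq_zero_iff.mp h0 j (Finset.mem_univ j))
  | bang M ih => exact fun w w' u h => congrArg _ (ih _ _ _ (fun i hi => h i (by simp [hi])))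
  | newq M ih => exact fun w w' u h => ih _ _ _ h
  | lamBang M ih =>
    exact fun w w' u h => ih _ _ _ (hl 1 w w' M (fun i hi => h i (by rwa [cnt_lamBang])))
  | lam p M ih =>
    exact fun w w' u h => ih _ _ _ (hl _ w w' M (fun i hi => h i (by rwa [cnt_lam])))
  | _ => exact fun w w' u h => rfl

theorem cnt_rename_of_unique {M : Term} {ρ : ℕ → ℕ} {i j : ℕ} (hj : ρ j = i)
    (h : ∀ l, cnt l M ≠ 0 → ρ l = i → l = j) : cnt i (rename ρ M) = cnt j M := by
  rw [cnt, wt_rename, cnt]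
  refine wt_congr M _ _ _ (fun l hl => ?_)
  simp only [Pi.single_apply]
  by_cases e : l = j
  · subst e; simp [hj]
  · rw [if_neg e, if_neg (fun e' => e (h l hl e'))]

theorem exists_of_cnt_rename {M : Term} {ρ : ℕ → ℕ} {i : ℕ} (h : cnt i (rename ρ M) ≠ 0) :
    ∃ j, ρ j = i ∧ cnt j M ≠ 0 := by
  by_contra! hc
  refine h ?_
  rw [cnt, wt_rename, ← wt_zero M]
  refine wt_congr M _ _ _ (fun l hl => ?_)
  simp only [Pi.single_apply, Pi.zero_apply]
  exact if_neg (fun e => hl (hc l e))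

theorem rename_eq_self {M : Term} {ρ : ℕ → ℕ} (h : ∀ i, cnt i M ≠ 0 → ρ i = i) :
    rename ρ M = M := by
  rw [rename_congr M ρ id h, rename_eq_subst]
  exact subst_var M

/-- The environment with items `!x` for `x` in `S` and `x` for `x` in `T`. -/
def env (S T : Finset ℕ) : Env := S.val.map Item.bang + T.val.map Item.lin

theorem env_empty : env ∅ ∅ = 0 := rfl

theorem names_env (S T : Finset ℕ) :
    Multiset.bind (env S T) Item.names = S.val.map Sum.inl + T.val.map Sum.inl := by
  rw [env, Multiset.add_bind, Multiset.bind_map, Multiset.bind_map]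
  simp only [Item.names, Multiset.bind_singleton]

theorem valid_env {S T : Finset ℕ} (h : Disjoint S T) : Env.Valid (env S T) := by
  rw [Env.Valid, names_env, ← Multiset.map_add]
  refine Multiset.Nodup.map Sum.inl_injective ?_
  exact Multiset.nodup_add.mpr ⟨S.nodup, T.nodup, Finset.disjoint_val.mpr h⟩

theorem env_insert_left {S T : Finset ℕ} {x : ℕ} (h : x ∉ S) :
    env (insert x S) T = Item.bang x ::ₘ env S T := by
  rw [env, Finset.insert_val_of_notMem h, Multiset.map_cons, Multiset.cons_add, env]

theorem Term.Judgement.weaken {S T : Finset ℕ} {M : Term} (h : Judgement (env S T) M) (S' : Finset ℕ)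
    (hd : Disjoint (S' ∪ S) T) : Judgement (env (S' ∪ S) T) M := by
  induction S' using Finset.induction_on with
  | empty => simpa using h
  | insert x S' hx ih =>
    rw [Finset.insert_union] at hd ⊢
    have ih := ih (hd.mono_left (Finset.subset_insert _ _))
    by_cases hxs : x ∈ S' ∪ S
    · rwa [Finset.insert_eq_of_mem hxs]
    · have hv := valid_env hd
      rw [env_insert_left hxs] at hv ⊢
      exact .weak x ih hv

/-- The map that is `π` on `D`. -/
def onSet (D : Finset ℕ) (π : ℕ → ℕ) (v : ℕ) : ℕ := if v ∈ D then π v else v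

/-- The variables of `D` are merged into their images in `A` one at a time. -/
theorem Term.Judgement.contract {A D T : Finset ℕ} {π : ℕ → ℕ} {M : Term}
    (h : Judgement (env (D ∪ A) T) M) (hD : Disjoint D A) (hT : Disjoint (D ∪ A) T)
    (hπ : ∀ v ∈ D, π v ∈ A) : Judgement (env A T) (rename (onSet D π) M) := by
  induction D using Finset.induction_on generalizing M with
  | empty =>
    rw [rename_eq_self (fun i _ => by simp [onSet])]
    simpa using h
  | insert y D hy ih =>
    rw [Finset.insert_union] at h hT
    rw [Finset.disjoint_insert_left] at hD
    have hyA : y ∉ D ∪ A := by simp [hy, hD.1]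
    have hx : π y ∈ D ∪ A := Finset.mem_union_right _ (hπ y (by simp))
    have hT' := hT.mono_left (Finset.subset_insert y (D ∪ A))
    have hv := valid_env hT'
    rw [env_insert_left hyA, ← Finset.insert_erase hx,
      env_insert_left (Finset.notMem_erase _ _), Multiset.cons_swap] at h
    rw [← Finset.insert_erase hx, env_insert_left (Finset.notMem_erase _ _)] at hv
    -- The merged variable keeps the name `π y`, which is available because the contraction removes
    -- its old item.
    have h1 := Judgement.contr (π y) y (π y) h hv
    rw [← env_insert_left (Finset.notMem_erase _ _), Finset.insert_erase hx] at h1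
    have h2 := ih h1 hD.2 hT' (fun v hv => hπ v (by simp [hv]))
    rw [rename_rename] at h2
    convert h2 using 2
    funext v
    have hn : π y ∉ D := fun hd => Finset.disjoint_left.mp hD.2 hd (hπ y (by simp))
    simp only [onSet, Finset.mem_insert]
    by_cases hvy : v = y
    · subst hvy; simp [hn]
    · by_cases hvx : v = π y
      · subst hvx; simp [hn, hvy]
      · simp [hvx, hvy]

/-- The term `M` can be derived in all environments in which each variable of `T` occurs
exactly once in `M`. -/
def Derivable (M : Term) : Prop :=
  ∀ S T : Finset ℕ, Disjoint S T → (∀ i, cnt i M ≠ 0 → i ∈ S ∪ T) → (∀ i ∈ T, cnt i M = 1) →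
    Judgement (env S T) M

theorem Term.Judgement.weaken_empty {M : Term} (h : Judgement 0 M) (S : Finset ℕ) :
    Judgement (env S ∅) M := by
  have := Judgement.weaken (S := ∅) (T := ∅) (by simpa [env_empty] using h) S (by simp)
  simpa using this

theorem Derivable.of_closed {M : Term} (hM : ∀ i, cnt i M = 0) (h : Judgement 0 M) :
    Derivable M := by
  intro S T _ _ hT
  have : T = ∅ := Finset.eq_empty_of_forall_notMem (fun i hi => by simpa [hM] using hT i hi)
  subst this
  exact h.weaken_empty S

theorem derivable_var (x : ℕ) : Derivable (var x) := by
  intro S T hd hfv hT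
  have hTx : ∀ i ∈ T, x = i := fun i hi => by
    by_contra h
    have := hT i hi
    simp [h] at this
  rcases Finset.mem_union.mp (hfv x (by simp)) with hx | hx
  · have hT0 : T = ∅ := Finset.eq_empty_of_forall_notMem (fun i hi => by
      obtain rfl := hTx i hi
      exact Finset.disjoint_left.mp hd hx hi)
    subst hT0
    have h : Judgement (env {x} ∅) (var x) := Judgement.der (Γ := 0) x (.classicVar x)
    have := h.weaken S (by simp)
    rwa [Finset.union_eq_left.mpr (by simpa using hx)] at this
  · obtain rfl : T = {x} := by
      ext i
      simp only [Finset.mem_singleton]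
      exact ⟨fun hi => (hTx i hi).symm, fun e => e ▸ hx⟩
    have h : Judgement (env ∅ {x}) (var x) := .classicVar x
    have := h.weaken S (by simpa using hd)
    rwa [Finset.union_empty] at this

theorem Derivable.bang {M : Term} (h : Derivable M) : Derivable (bang M) := by
  intro S T hd hfv hT
  -- Counts below `!` are even, hence never 1; so promotion meets no linear item.
  have hT0 : T = ∅ := Finset.eq_empty_of_forall_notMem (fun i hi => by
    have := hT i hi
    rw [cnt_bang] at this
    omega)
  subst hT0
  refine .prom (fun a ha => ?_) (h S ∅ hd (fun i hi => hfv i (by simp [hi])) (by simp))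
  simp only [env, Finset.empty_val, Multiset.map_zero, add_zero, Multiset.mem_map] at ha
  obtain ⟨x, _, rfl⟩ := ha
  exact ⟨x, rfl⟩

theorem Derivable.newq {M : Term} (h : Derivable M) : Derivable (newq M) :=
  fun S T hd hfv hT => .new (h S T hd hfv hT)

/-- A finite family of terms can be derived in disjoint environments, from which a given one is
obtained by contractions. -/
theorem exists_contraction {k : ℕ} {Ms : Fin k → Term} (h : ∀ i ρ, Derivable (rename ρ (Ms i)))
    {S T : Finset ℕ} (hd : Disjoint S T) (hfv : ∀ i j, cnt j (Ms i) ≠ 0 → j ∈ S ∪ T)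
    (hT : ∀ j ∈ T, ∑ i, cnt j (Ms i) = 1) :
    ∃ (Γ : Fin k → Env) (Ns : Fin k → Term) (r : ℕ → ℕ), (∀ i, Judgement (Γ i) (Ns i)) ∧
      Env.Valid (∑ i, Γ i) ∧ (∀ i, rename r (Ns i) = Ms i) ∧
      ∀ t, Judgement (∑ i, Γ i) t → Judgement (env S T) (rename r t) := by
  obtain ⟨K, hK⟩ : ∃ K, ∀ j ∈ S ∪ T, j < K := by
    refine ⟨(S ∪ T).sup id + 1, fun j hj => ?_⟩
    exact Nat.lt_succ_of_le (Finset.le_sup (f := id) hj)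
  have hKS : ∀ j ∈ S, j < K := fun j hj => hK j (Finset.mem_union_left _ hj)
  have hKT : ∀ j ∈ T, j < K := fun j hj => hK j (Finset.mem_union_right _ hj)
  -- All names in use are below `K`. The `i`-th term gets its own copies of the shared variables,
  -- shifted by `K * (i + 1)` into a block of their own, and reduction modulo `K` later contracts
  -- all copies to the original. A linear variable occurs in one term only and is assigned to that
  -- term.
  let σ : Fin k → ℕ → ℕ := fun i v => if v ∈ S then v + K * (i + 1) else v
  let S' : Fin k → Finset ℕ := fun i => S.image (fun v => v + K * (i + 1))
  let T' : Fin k → Finset ℕ := fun i => T.filter (fun j => cnt j (Ms i) ≠ 0)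
  have hlow : ∀ i v, v ∈ S' i → K ≤ v := by
    intro i v hv
    obtain ⟨w, hw, rfl⟩ := Finset.mem_image.mp hv
    have : K * 1 ≤ K * (i + 1) := Nat.mul_le_mul_left _ (by omega)
    omega
  have hS'd : ((Finset.univ : Finset (Fin k)) : Set (Fin k)).PairwiseDisjoint S' := by
    intro i _ j _ hij
    refine Finset.disjoint_left.mpr (fun v hi hj => hij ?_)
    obtain ⟨a, ha, rfl⟩ := Finset.mem_image.mp hi
    obtain ⟨b, hb, he⟩ := Finset.mem_image.mp hj
    have h1 : (a + K * (i + 1)) / K = i + 1 := by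
      rw [Nat.add_mul_div_left _ _ (by have := hKS a ha; omega), Nat.div_eq_of_lt (hKS a ha)]
      omega
    have h2 : (b + K * (j + 1)) / K = j + 1 := by
      rw [Nat.add_mul_div_left _ _ (by have := hKS a ha; omega), Nat.div_eq_of_lt (hKS b hb)]
      omega
    rw [he, h1] at h2
    exact Fin.ext (by omega)
  have hT'd : ((Finset.univ : Finset (Fin k)) : Set (Fin k)).PairwiseDisjoint T' := by
    intro i _ j _ hij
    refine Finset.disjoint_left.mpr (fun v hi hj => ?_)
    obtain ⟨hv, hi⟩ := Finset.mem_filter.mp hi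
    obtain ⟨-, hj⟩ := Finset.mem_filter.mp hj
    have h1 := hT v hv
    have h2 : ∑ l ∈ {i, j}, cnt v (Ms l) ≤ ∑ l, cnt v (Ms l) :=
      Finset.sum_le_sum_of_subset (Finset.subset_univ _)
    rw [Finset.sum_pair hij] at h2
    omega
  set D := Finset.univ.disjiUnion S' hS'd with hD
  have hsum : ∑ i, env (S' i) (T' i) = env D T := by
    have e1 : ∑ i, (S' i).val = D.val := rfl
    have e2 : ∑ i, (T' i).val = T.val := by
      have : Finset.univ.disjiUnion T' hT'd = T := by
        ext v
        simp only [T', Finset.mem_disjiUnion, Finset.mem_univ, true_and, Finset.mem_filter]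
        refine ⟨fun ⟨_, h, _⟩ => h, fun hv => ?_⟩
        by_contra! hc
        have := hT v hv
        rw [Finset.sum_eq_zero (fun i _ => hc i hv)] at this
        simp at this
      conv_rhs => rw [← this]
      rfl
    simp only [env, Finset.sum_add_distrib]
    rw [← e1, ← e2]
    congr 1
    · exact (map_sum (Multiset.mapAddMonoidHom Item.bang) _ _).symm
    · exact (map_sum (Multiset.mapAddMonoidHom Item.lin) _ _).symm
  have hDlow : ∀ v ∈ D, K ≤ v := by
    intro v hv
    obtain ⟨i, _, hi⟩ := Finset.mem_disjiUnion.mp hv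
    exact hlow i v hi
  have hDS : Disjoint D S := Finset.disjoint_left.mpr (fun v h1 h2 => by
    have := hDlow v h1
    have := hKS v h2
    omega)
  have hDT : Disjoint D T := Finset.disjoint_left.mpr (fun v h1 h2 => by
    have := hDlow v h1
    have := hKT v h2
    omega)
  refine ⟨fun i => env (S' i) (T' i), fun i => rename (σ i) (Ms i), onSet D (fun v => v % K),
    fun i => ?_, ?_, fun i => ?_, fun t ht => ?_⟩
  · have hfr : ∀ j, cnt j (Ms i) ≠ 0 → j ∈ T → σ i j = j := fun j _ hj => by
      have : j ∉ S := fun hs => Finset.disjoint_left.mp hd hs hj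
      simp [σ, this]
    refine h i (σ i) _ _ ?_ (fun v hv => ?_) (fun j hj => ?_)
    · refine Finset.disjoint_left.mpr (fun v h1 h2 => ?_)
      have := hlow i v h1
      have := hKT v (Finset.mem_filter.mp h2).1
      omega
    · obtain ⟨j, rfl, hj⟩ := exists_of_cnt_rename hv
      rcases Finset.mem_union.mp (hfv i j hj) with hs | ht
      · refine Finset.mem_union_left _ (Finset.mem_image.mpr ⟨j, hs, ?_⟩)
        simp [σ, hs]
      · rw [hfr j hj ht]
        exact Finset.mem_union_right _ (Finset.mem_filter.mpr ⟨ht, hj⟩)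
    · obtain ⟨hjT, hj⟩ := Finset.mem_filter.mp hj
      rw [cnt_rename_of_unique (j := j) (hfr j hj hjT)]
      · have h1 := hT j hjT
        have h2 := Finset.single_le_sum (f := fun i => cnt j (Ms i)) (fun _ _ => Nat.zero_le _)
          (Finset.mem_univ i)
        omega
      · intro l hl he
        by_cases hs : l ∈ S
        · have : σ i l ∈ S' i := Finset.mem_image.mpr ⟨l, hs, by simp [σ, hs]⟩
          have := hlow i _ this
          have := hKT j hjT
          omega
        · simpa [σ, hs] using he
  · rw [hsum]
    exact valid_env hDT
  · simp only [rename_rename]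
    refine rename_eq_self (fun j hj => ?_)
    by_cases hs : j ∈ S
    · have hj' : j + K * (i + 1) ∈ D :=
        Finset.mem_disjiUnion.mpr ⟨i, Finset.mem_univ i, Finset.mem_image.mpr ⟨j, hs, rfl⟩⟩
      simp only [onSet, σ, hs, if_true, hj', Nat.add_mul_mod_self_left]
      exact Nat.mod_eq_of_lt (hKS j hs)
    · have hj' : j ∉ D := fun hD => by
        have := hDlow j hD
        have := hK j (hfv i j hj)
        omega
      simp [onSet, σ, hs, hj']
  · rw [hsum] at ht
    have hdis : Disjoint (S ∪ D) T := Finset.disjoint_union_left.mpr ⟨hd, hDT⟩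
    have ht := ht.weaken S hdis
    rw [Finset.union_comm] at ht hdis
    refine ht.contract hDS hdis (fun v hv => ?_)
    obtain ⟨i, _, hi⟩ := Finset.mem_disjiUnion.mp hv
    obtain ⟨w, hw, rfl⟩ := Finset.mem_image.mp hi
    simp only [Nat.add_mul_mod_self_left]
    rwa [Nat.mod_eq_of_lt (hKS w hw)]

theorem Derivable.tup {n : ℕ} {Ms : Fin (n + 2) → Term}
    (h : ∀ i ρ, Derivable (rename ρ (Ms i))) : Derivable (tup Ms) := by
  intro S T hd hfv hT
  obtain ⟨Γ, Ns, r, h1, h2, h3, h4⟩ := exists_contraction h hd (fun i j hj => hfv j (by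
    rw [cnt_tup]
    exact fun h0 => hj (Finset.sum_eq_zero_iff.mp h0 i (Finset.mem_univ i)))) hT
  have := h4 _ (.rightTens Γ Ns h1 h2)
  simp only [rename, h3] at this
  exact this

theorem Derivable.app {M N : Term} (hM : ∀ ρ, Derivable (rename ρ M))
    (hN : ∀ ρ, Derivable (rename ρ N)) : Derivable (app M N) := by
  intro S T hd hfv hT
  obtain ⟨Γ, Ns, r, h1, h2, h3, h4⟩ := exists_contraction (Ms := ![M, N])
    (by simp [Fin.forall_fin_two, hM, hN]) hd (by
      rw [Fin.forall_fin_two]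
      exact ⟨fun j (hj : cnt j M ≠ 0) => hfv j (by simp [hj]),
        fun j (hj : cnt j N ≠ 0) => hfv j (by simp [hj])⟩)
    (fun j hj => by rw [Fin.sum_univ_two]; exact hT j hj)
  rw [Fin.sum_univ_two] at h2 h4
  have := h4 _ (.app (h1 0) (h1 1) h2)
  simp only [rename, h3] at this
  exact this

theorem idxOf_map_range {k K j : ℕ} (hj : j < k) :
    ((List.range k).map (fun i => i + K)).idxOf (j + K) = j := by
  have hn : ((List.range k).map (fun i => i + K)).Nodup :=
    List.nodup_range.map (fun a b h => by simpa using h)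
  have := hn.idxOf_getElem j (by simpa using hj)
  simpa using this

/-- The renaming that is undone by `closing xs` for `xs = K, …, K + k - 1`. -/
def opening (k K j : ℕ) : ℕ := if j < k then j + K else j - k

theorem closing_opening {k K j : ℕ} (h : k ≤ j → j - k < K) :
    closing ((List.range k).map (fun i => i + K)) (opening k K j) = j := by
  by_cases hj : j < k
  · have hm : j + K ∈ (List.range k).map (fun i => i + K) :=
      List.mem_map.mpr ⟨j, List.mem_range.mpr hj, rfl⟩
    rw [opening, if_pos hj, closing, if_pos hm, idxOf_map_range hj]
  · have hm : j - k ∉ (List.range k).map (fun i => i + K) := by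
      simp only [List.mem_map, List.mem_range, not_exists, not_and]
      intro x _
      have := h (by omega)
      omega
    rw [opening, if_neg hj, closing, if_neg hm, List.length_map, List.length_range]
    omega

/-- The abstraction rules act on named variables. Those bound by the abstraction get the fresh names
`K, …, K + k - 1`, above every name in `S ∪ T`, so that closing them again restores `M` with its
counts. -/
theorem exists_opening {M : Term} (h : ∀ ρ, Derivable (rename ρ M)) (k : ℕ) {S T : Finset ℕ}
    (hfv : ∀ i, cnt (i + k) M ≠ 0 → i ∈ S ∪ T)
    (hT : ∀ i ∈ T, cnt (i + k) M = 1) :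
    ∃ (K : ℕ) (N : Term), (∀ i ∈ S ∪ T, i < K) ∧
      rename (closing ((List.range k).map (fun i => i + K))) N = M ∧
      (∀ j < k, cnt (j + K) N = cnt j M) ∧ (∀ i ∈ T, cnt i N = 1) ∧
      (∀ i, cnt i N ≠ 0 → i ∈ S ∪ T ∨ ∃ j < k, i = j + K) ∧ Derivable N := by
  obtain ⟨K, hK⟩ : ∃ K, ∀ j ∈ S ∪ T, j < K := by
    refine ⟨(S ∪ T).sup id + 1, fun j hj => ?_⟩
    exact Nat.lt_succ_of_le (Finset.le_sup (f := id) hj)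
  have hlt : ∀ j, cnt j M ≠ 0 → k ≤ j → j - k ∈ S ∪ T := fun j hj hk =>
    hfv _ (by rwa [Nat.sub_add_cancel hk])
  have hinj : ∀ l, cnt l M ≠ 0 →
      closing ((List.range k).map (fun i => i + K)) (opening k K l) = l := fun l hl =>
    closing_opening (fun hk => hK _ (hlt l hl hk))
  refine ⟨K, rename (opening k K) M, hK, ?_, fun j hj => ?_, fun i hi => ?_, fun i hi => ?_, h _⟩
  · rw [rename_rename]
    exact rename_eq_self hinj
  · refine cnt_rename_of_unique (by simp [opening, hj]) (fun l hl e => ?_)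
    rw [← hinj l hl, e]
    have := closing_opening (k := k) (K := K) (j := j) (by omega)
    rwa [opening, if_pos hj] at this
  · rw [← hT i hi]
    refine cnt_rename_of_unique (by simp [opening]) (fun l hl e => ?_)
    have hiK := hK i (Finset.mem_union_right _ hi)
    rw [← hinj l hl, e]
    have := closing_opening (k := k) (K := K) (j := i + k) (by omega)
    rwa [opening, if_neg (by omega), Nat.add_sub_cancel] at this
  · obtain ⟨j, rfl, hj⟩ := exists_of_cnt_rename hi
    by_cases hk : j < k
    · exact Or.inr ⟨j, hk, by simp [opening, hk]⟩
    · rw [opening, if_neg hk]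
      exact Or.inl (hlt j hj (by omega))

theorem Derivable.lamBang {M : Term} (h : ∀ ρ, Derivable (rename ρ M)) :
    Derivable (lamBang M) := by
  intro S T hd hfv hT
  obtain ⟨K, N, hK, h1, -, h3, h4, h5⟩ := exists_opening h 1
    (fun i hi => hfv i (by rwa [cnt_lamBang])) (fun i hi => by rw [← cnt_lamBang]; exact hT i hi)
  have hKS : K ∉ S := fun hs => lt_irrefl _ (hK K (Finset.mem_union_left _ hs))
  have hKT : K ∉ T := fun hs => lt_irrefl _ (hK K (Finset.mem_union_right _ hs))
  have := h5 (insert K S) T (by simp [hKT, hd]) (fun i hi => by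
    rcases h4 i hi with h | ⟨j, hj, rfl⟩
    · simp only [Finset.insert_union, Finset.mem_insert]
      exact Or.inr h
    · obtain rfl : j = 0 := by omega
      simp) h3
  rw [env_insert_left hKS] at this
  have := Judgement.lamBang K this
  rw [← h1]
  simpa [List.range_succ] using this

theorem Derivable.lam {p : Pat} {M : Term} (h : ∀ ρ, Derivable (rename ρ M))
    (hp : ∀ j < p.size, cnt j M = 1) : Derivable (lam p M) := by
  intro S T hd hfv hT
  obtain ⟨K, N, hK, h1, h2, h3, h4, h5⟩ := exists_opening h p.size
    (fun i hi => hfv i (by rwa [cnt_lam])) (fun i hi => by rw [← cnt_lam]; exact hT i hi)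
  have hKS : ∀ j ∈ S, j < K := fun j hj => hK j (Finset.mem_union_left _ hj)
  have hKT : ∀ j ∈ T, j < K := fun j hj => hK j (Finset.mem_union_right _ hj)
  set xs := (List.range p.size).map (fun i => i + K) with hxs
  have hn : xs.Nodup := List.nodup_range.map (fun a b h => by simpa using h)
  have hx : ∀ v, v ∈ xs ↔ ∃ j < p.size, v = j + K := by
    intro v
    simp only [hxs, List.mem_map, List.mem_range]
    exact ⟨fun ⟨j, h1, h2⟩ => ⟨j, h1, h2.symm⟩, fun ⟨j, h1, h2⟩ => ⟨j, h1, h2.symm⟩⟩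
  have hxT : Disjoint xs.toFinset T := Finset.disjoint_left.mpr (fun v h1 h2 => by
    obtain ⟨j, _, rfl⟩ := (hx v).mp (List.mem_toFinset.mp h1)
    have := hKT _ h2
    omega)
  have hxS : Disjoint S xs.toFinset := Finset.disjoint_left.mpr (fun v h2 h1 => by
    obtain ⟨j, _, rfl⟩ := (hx v).mp (List.mem_toFinset.mp h1)
    have := hKS _ h2
    omega)
  have key := h5 S (xs.toFinset ∪ T) (Finset.disjoint_union_right.mpr ⟨hxS, hd⟩) (fun i hi => by
    rcases h4 i hi with h | h
    · rcases Finset.mem_union.mp h with h | h <;> simp [h]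
    · have := (hx i).mpr h
      simp [this]) (fun i hi => by
    rcases Finset.mem_union.mp hi with h | h
    · obtain ⟨j, hj, rfl⟩ := (hx i).mp (List.mem_toFinset.mp h)
      rw [h2 j hj, hp j hj]
    · exact h3 i h)
  have e : env S (xs.toFinset ∪ T) = ((xs.map Item.lin : List Item) : Env) + env S T := by
    have e1 : (xs.toFinset ∪ T).val = (xs : Multiset ℕ) + T.val := by
      rw [← Finset.disjUnion_eq_union _ _ hxT, Finset.disjUnion_val, List.toFinset_val,
        hn.dedup]
    rw [env, e1, Multiset.map_add, Multiset.map_coe, env]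
    abel
  rw [e] at key
  rw [← h1]
  cases p with
  | var =>
    have : xs = [K] := by simp [hxs, Pat.size, List.range_succ]
    rw [this] at key ⊢
    exact .lamVar K key
  | tuple n =>
    have hl : xs.length = n + 2 := by simp [hxs, Pat.size]
    exact .lamTuple n xs hl (.leftTens xs (by omega) key)

/-- All renamings are included in the statement because subterms are renamed when environments are
made disjoint and when binders are opened. The occurrence condition in `ok` supplies the linearity
required of pattern variables. -/
theorem derivable_of_ok (M : Term) : ∀ f, ok f M → M.qvars = ∅ → ∀ ρ, Derivable (rename ρ M) := by
  induction M with
  | var i => exact fun f h hq ρ => derivable_var _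
  | qvar r => intro f h hq; simp [qvars] at hq
  | bit b => exact fun f h hq ρ => .of_closed (fun _ => rfl) (.constBit b)
  | gate i => exact fun f h hq ρ => .of_closed (fun _ => rfl) (.constGate i)
  | bang M ih => exact fun f h hq ρ => .bang (ih _ h hq ρ)
  | newq M ih => exact fun f h hq ρ => .newq (ih _ h hq ρ)
  | app M N ihM ihN =>
    intro f h hq ρ
    rw [qvars, Finset.union_eq_empty] at hq
    exact .app (fun ρ' => by rw [rename_rename]; exact ihM _ h.2.1 hq.1 _)
      (fun ρ' => by rw [rename_rename]; exact ihN _ h.2.2 hq.2 _)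
  | tup Ms ih =>
    intro f h hq ρ
    refine .tup (fun i ρ' => ?_)
    rw [rename_rename]
    refine ih i _ (h i) ?_ _
    exact Finset.subset_empty.mp (hq ▸ Finset.subset_biUnion_of_mem (fun i => (Ms i).qvars)
      (Finset.mem_univ i))
  | lamBang M ih =>
    intro f h hq ρ
    exact .lamBang (fun ρ' => by rw [rename_rename]; exact ih _ h hq _)
  | lam p M ih =>
    intro f h hq ρ
    have h' := ok_rename _ _ ρ h
    exact .lam (fun ρ' => by rw [rename_rename]; exact ih _ h.1 hq _) h'.2

/-- A closed term without quantum variables that satisfies the linearity conditions is well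
formed. -/
theorem wellFormed_of_ok {f : Bool} {M : Term} (h : ok f M) (hc : ∀ i, cnt i M = 0)
    (hq : M.qvars = ∅) : WellFormed M := by
  have := derivable_of_ok M f h hq id ∅ ∅ (by simp) (fun i hi => ?_) (by simp)
  · rw [rename_eq_self (ρ := id) (fun i _ => rfl), env_empty] at this
    rw [WellFormed, hq]
    exact this
  · rw [rename_eq_self (ρ := id) (fun i _ => rfl)] at hi
    exact absurd (hc i) hi

end QCalc

end

noncomputable section

namespace QCalc
open Term

variable {U : ℕ → Gate}

/-! ### The output of the simulation -/

@[simp] theorem cnt_qlistT (l : List ℕ) (i : ℕ) : cnt i (qlistT l) = 0 := by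
  induction l with
  | nil => exact cnt_qnilT i
  | cons r l ih => rw [qlistT_cons, cnt_qconsT, ih, cnt_qvar]

theorem qlistT_cons_eq (r : ℕ) (l : List ℕ) :
    qlistT (r :: l) = lamBang (lamBang (app (app (var 1) (qvar r)) (qlistT l))) := by
  have h : shift 2 (qlistT l) = qlistT l :=
    rename_eq_self (fun i hi => absurd (cnt_qlistT l i) hi)
  rw [qlistT_cons, qconsT, h]
  rfl

theorem qlistT_names (m : ℕ) : qlistT (names m) = qlist m := by
  rw [qlistT, names, List.map_map]
  rfl

theorem qvars_qlistT (l : List ℕ) : (qlistT l).qvars = l.toFinset := by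
  induction l with
  | nil => exact qvars_qnilT
  | cons r l ih => rw [qlistT_cons, qvars_qconsT, ih, List.toFinset_cons]; rfl

theorem qvars_qlist (m : ℕ) : (qlist m).qvars = Finset.Icc 1 m := by
  rw [← qlistT_names, qvars_qlistT]
  ext r
  rw [List.mem_toFinset, mem_names]

theorem mapQ_qlistT (θ : ℕ → ℕ) (l : List ℕ) : (qlistT l).mapQ θ = qlistT (l.map θ) := by
  induction l with
  | nil => rfl
  | cons r l ih =>
    rw [qlistT_cons_eq, List.map_cons, qlistT_cons_eq, ← ih]
    rfl

theorem qlistT_injective : Function.Injective qlistT := by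
  intro l
  induction l with
  | nil =>
    intro l' h
    cases l' with
    | nil => rfl
    | cons r l' => rw [qlistT_cons_eq] at h; simp [qlistT, list] at h
  | cons r l ih =>
    intro l' h
    cases l' with
    | nil => rw [qlistT_cons_eq] at h; simp [qlistT, list] at h
    | cons r' l' =>
      rw [qlistT_cons_eq, qlistT_cons_eq] at h
      simp only [Term.lamBang.injEq, Term.app.injEq, Term.qvar.injEq, true_and] at h
      rw [h.1, ih h.2]

theorem not_step_qlistT {l : List ℕ} {a : Lab} {t : Term} : ¬ TStep U (qlistT l) a t := by
  induction l generalizing t with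
  | nil =>
    intro h
    rw [show qlistT [] = lamBang (lamBang (var 0)) from rfl] at h
    rcases h with _ | _ | _ | _ | _ | _ | _ | _ | _ | _ | _ | _ | ⟨_, _, _, h⟩
    rcases h with _ | _ | _ | _ | _ | _ | _ | _ | _ | _ | _ | _ | ⟨_, _, _, h⟩
    cases h
  | cons r l ih =>
    intro h
    rw [qlistT_cons_eq] at h
    have hl : ∃ N, qlistT l = lamBang N := by
      cases l with
      | nil => exact ⟨_, rfl⟩
      | cons r l => exact ⟨_, qlistT_cons_eq r l⟩
    obtain ⟨N, hN⟩ := hl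
    rw [hN] at h ih
    cases h with
    | inLamBang _ _ _ h =>
    cases h with
    | inLamBang _ _ _ h =>
    cases h with
    | rightApp _ _ _ _ h => exact ih h
    | leftApp _ _ _ _ h =>
      cases h with
      | rightApp _ _ _ _ h => cases h
      | leftApp _ _ _ _ h => cases h

theorem isNormal_qlist (m : ℕ) (φ : HSpace (qlist m).qvars) :
    Config.IsNormal U (Config.ofTerm (qlist m) φ) := by
  intro C h
  obtain ⟨a, Q, -, hl⟩ := Config.Step.exists_lstep h
  have := hl.term
  simp only [← qlistT_names] at this
  exact not_step_qlistT this

/-- A renaming that carries one output list to the other must preserve its length and fix each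
listed name, hence it acts trivially on the register. -/
theorem ofTerm_qlist_inj {m m' : ℕ} {φ : HSpace (qlist m).qvars} {φ' : HSpace (qlist m').qvars}
    (h : Config.ofTerm (qlist m) φ = Config.ofTerm (qlist m') φ') : m = m' ∧ HEq φ φ' := by
  obtain ⟨θ, hθ, hr, ht⟩ := Quotient.exact h
  simp only [← qlistT_names, mapQ_qlistT] at ht
  have hn := qlistT_injective ht
  obtain rfl : m' = m := by simpa [names] using congrArg List.length hn
  refine ⟨rfl, heq_of_eq ?_⟩
  have hfix : ∀ r ∈ names m', θ r = r := by
    intro r hr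
    obtain ⟨i, hi, rfl⟩ := List.getElem_of_mem hr
    have := congrArg (fun l => l[i]?) hn
    simpa [hi] using this.symm
  funext g
  obtain ⟨f, rfl⟩ := exists_assignment g
  refine Eq.trans ?_ (hr f).symm
  refine congrArg φ (funext fun v => ?_)
  have hv : v.1 ∈ names m' := by
    rw [mem_names, ← qvars_qlist]
    exact v.2
  rw [hfix _ hv]

/-! ### Registers -/

theorem circuitOp_apply {k : Circuit} {V : Finset ℕ} (φ : HSpace V)
    (hk : ∀ a ∈ k, a.2.length = (U a.1).arity ∧ a.2.Nodup ∧ ∀ r ∈ a.2, r ∈ V) (f : ℕ → Bool) :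
    circuitOp U k φ (fun v => f v) = circuitSem U k (fun f => φ (fun v => f v)) f := by
  induction k generalizing φ with
  | nil => rfl
  | cons a k ih =>
    have h := hk a (by simp)
    refine (ih (gateOp (U a.1) a.2 φ) (fun b hb => hk b (by simp [hb]))).trans ?_
    have e : (fun f : ℕ → Bool => gateOp (U a.1) a.2 φ (fun v => f v)) =
        gateSem (U a.1) a.2 (fun f => φ (fun v => f v)) := by
      funext f
      exact gateOp_apply φ h.1 h.2.1 h.2.2 f
    rw [e]
    rfl

theorem ket_apply (b : ℕ → Bool) (m : ℕ) (f : ℕ → Bool) :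
    ket (V := (qlist m).qvars) (fun r => b r) (fun v => f v) = ketSem b 0 m f := by
  rw [ket, ketSem, Finset.prod_ite_zero]
  have : ((fun v : (qlist m).qvars => f v) = fun r : (qlist m).qvars => b r) ↔
      ∀ i ∈ Finset.Icc (0 + 1) m, f i = b i := by
    rw [zero_add, ← qvars_qlist, funext_iff]
    simp
  by_cases h : ∀ i ∈ Finset.Icc (0 + 1) m, f i = b i
  · rw [if_pos (this.mpr h), if_pos h, Finset.prod_const_one]
  · rw [if_neg (fun h' => h (this.mp h')), if_neg h]

theorem isRegister_ket {V : Finset ℕ} (f : V → Bool) : IsRegister (ket f) := by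
  rw [IsRegister, Finset.sum_eq_single f]
  · simp [ket]
  · intro g _ hg
    simp [ket, hg]
  · simp

theorem sum_norm_sq_mulVec {ι : Type*} [Fintype ι] [DecidableEq ι] {A : Matrix ι ι ℂ}
    (hA : A ∈ Matrix.unitaryGroup ι ℂ) (w : ι → ℂ) :
    ∑ x, ‖∑ y, A x y * w y‖ ^ 2 = ∑ y, ‖w y‖ ^ 2 := by
  have h : ∀ v : ι → ℂ, star v ⬝ᵥ v = ((∑ x, ‖v x‖ ^ 2 : ℝ) : ℂ) := by
    intro v
    rw [dotProduct]
    push_cast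
    exact Finset.sum_congr rfl (fun x _ => Complex.conj_mul' (v x))
  have h2 : star (A.mulVec w) ⬝ᵥ A.mulVec w = star w ⬝ᵥ w := by
    rw [Matrix.star_mulVec, Matrix.dotProduct_mulVec, Matrix.vecMul_vecMul]
    have := Matrix.mem_unitaryGroup_iff'.mp hA
    rw [Matrix.star_eq_conjTranspose] at this
    rw [this, Matrix.vecMul_one]
  rw [h, h] at h2
  exact_mod_cast h2

/-- For a fixed assignment outside `rs` the gate acts as a unitary matrix on the bits at `rs` and
preserves the sum of squares over them. Summing over all assignments counts each sum of this kind
equally often, namely once per string of bits at `rs`, and this factor cancels. -/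
theorem isRegister_gateOp {G : Gate} {rs : List ℕ} {V : Finset ℕ} {φ : HSpace V}
    (hG : rs.length = G.arity) (hn : rs.Nodup) (hV : ∀ r ∈ rs, r ∈ V) (h : IsRegister φ) :
    IsRegister (gateOp G rs φ) := by
  let F : (V → Bool) → ℕ → Bool := fun f v => bitAt f v
  let u : (Fin G.arity → Bool) → (V → Bool) → V → Bool := fun x f v => updBits rs x (F f) v
  let e : (V → Bool) → Fin G.arity → Bool := fun f i => F f (rs.getD i 0)
  have hFr : ∀ f : V → Bool, (fun v : V => F f v) = f := fun f => by
    funext v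
    simp [F, bitAt]
  have hFV : ∀ (f : ℕ → Bool), ∀ v ∈ V, F (fun v : V => f v) v = f v := fun f v hv => by
    simp [F, bitAt, hv]
  have hmem : ∀ i : Fin G.arity, rs.getD i 0 ∈ V := fun i =>
    hV _ (getD_mem (by rw [hG]; exact i.2))
  have hue : ∀ x f, e (u x f) = x := fun x f => by
    funext i
    have := hFV (updBits rs x (F f)) _ (hmem i)
    exact this.trans (updBits_getD hG hn x _ i)
  have huu : ∀ x y f, u x (u y f) = u x f := fun x y f => by
    funext v
    have h1 := congrFun (updBits_updBits (rs := rs) x y (F f)) v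
    refine Eq.trans ?_ h1
    simp only [u, updBits]
    split_ifs
    · rfl
    · simpa [updBits, *] using hFV (updBits rs y (F f)) v v.2
  have hu0 : ∀ f, u (e f) f = f := fun f => by
    have := updBits_self hG (F f)
    funext v
    exact (congrFun this v).trans (congrFun (hFr f) v)
  have havg : ∀ H : (V → Bool) → ℝ, ∑ f, ∑ x, H (u x f) =
      (Fintype.card (Fin G.arity → Bool) : ℝ) * ∑ f, H f := by
    intro H
    have h1 : ∑ f : V → Bool, ∑ _x : Fin G.arity → Bool, H f =
        (Fintype.card (Fin G.arity → Bool) : ℝ) * ∑ f, H f := by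
      simp [Finset.mul_sum]
    rw [← h1, ← Fintype.sum_prod_type', ← Fintype.sum_prod_type']
    -- Exchanging `x` with the bits of `f` at `rs` is an involution on pairs.
    refine Finset.sum_nbij' (fun p => (u p.2 p.1, e p.1)) (fun p => (u p.2 p.1, e p.1))
      (fun _ _ => Finset.mem_univ _) (fun _ _ => Finset.mem_univ _) ?_ ?_ (fun _ _ => rfl)
    · rintro ⟨f, x⟩ -
      simp only [huu, hu0, hue]
    · rintro ⟨f, x⟩ -
      simp only [huu, hu0, hue]
  have happ : ∀ f x, gateOp G rs φ (u x f) = ∑ y, G.op x y * φ (u y f) := by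
    intro f x
    refine (gateOp_apply φ hG hn hV (updBits rs x (F f))).trans ?_
    refine Finset.sum_congr rfl (fun y _ => ?_)
    have : (fun i : Fin G.arity => updBits rs x (F f) (rs.getD i 0)) = x :=
      funext (updBits_getD hG hn x _)
    rw [this, updBits_updBits]
  have h1 := havg (fun f => ‖gateOp G rs φ f‖ ^ 2)
  have h2 := havg (fun f => ‖φ f‖ ^ 2)
  have h3 : ∀ f, ∑ x, ‖gateOp G rs φ (u x f)‖ ^ 2 = ∑ y, ‖φ (u y f)‖ ^ 2 := fun f => by
    simp only [happ]
    exact sum_norm_sq_mulVec G.unitary _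
  simp only [h3] at h1
  rw [h1] at h2
  have hc : (Fintype.card (Fin G.arity → Bool) : ℝ) ≠ 0 := by
    exact_mod_cast Fintype.card_ne_zero
  rw [IsRegister, mul_left_cancel₀ hc h2]
  exact h

theorem isRegister_circuitOp {k : Circuit} {V : Finset ℕ} {φ : HSpace V}
    (hk : ∀ a ∈ k, a.2.length = (U a.1).arity ∧ a.2.Nodup ∧ ∀ r ∈ a.2, r ∈ V)
    (h : IsRegister φ) : IsRegister (circuitOp U k φ) := by
  induction k generalizing φ with
  | nil => exact h
  | cons a k ih =>
    have ha := hk a (by simp)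
    exact ih (fun b hb => hk b (by simp [hb])) (isRegister_gateOp ha.1 ha.2.1 ha.2.2 h)

theorem Run.evaluatesTo {t : Term} (ht : t.qvars = ∅) {m : ℕ} {k : Circuit} {b : ℕ → Bool}
    (hk : ∀ a ∈ k, a.2.length = (U a.1).arity ∧ a.2.Nodup ∧ ∀ r ∈ a.2, r ∈ Finset.Icc 1 m)
    (h : Run U (∅, fun _ => 1, t)
      (Finset.Icc 1 m, circuitSem U k (ketSem b 0 m), qlistT (names m))) :
    EvaluatesTo U t (qlist m) (circuitOp U k (ket (fun r => b r))) := by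
  refine ⟨ht.subset, ?_, isNormal_qlist m _⟩
  obtain ⟨P, hP, hr⟩ := h.reach ⟨∅, fun _ => 1, t, ht.subset⟩ rfl
  simp only [Prod.mk.injEq] at hP
  have : P = ⟨(qlist m).qvars, circuitOp U k (ket (fun r => b r)), qlist m,
      Finset.Subset.refl _⟩ := by
    refine PreConfig.eq_of (hP.1.trans (qvars_qlist m).symm) (hP.2.1.trans ?_)
      (hP.2.2.trans (qlistT_names m))
    funext f
    refine Eq.symm ((circuitOp_apply _ (by rwa [qvars_qlist]) f).trans ?_)
    congr 1
    funext f
    exact ket_apply b m f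
  rw [this] at hr
  exact hr

end QCalc

end

/-! ### The simulation theorem -/

theorem mainTheorem6
    (U : ℕ → QCalc.Gate) (hU : Function.Bijective U)
    (K : ℕ → QCalc.Circuit) (hK : QCalc.IsCircuitEnumeration U K)
    (f : ℕ → ℕ) (g : ℕ × ℕ → ℕ) (h : ℕ → ℕ)
    (hfgh : QCalc.IsFinitelyGenerated U K f g h) :
    ∃ M : QCalc.Term, QCalc.QuantumRelevant U M ∧
      ∀ (cs : List Bool) (m : ℕ) (Q : QCalc.HSpace (QCalc.Term.qlist m).qvars),
        QCalc.EvaluatesTo U (QCalc.Term.app M (QCalc.Term.bits cs)) (QCalc.Term.qlist m) Q ↔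
          m = f cs.length ∧
          Q = QCalc.circuitOp U (K (h cs.length))
            (QCalc.ket (fun r => QCalc.inputBit cs (g (cs.length, (r : ℕ))))) := by
  obtain ⟨𝒢, hfin, hfam⟩ := hfgh
  -- The enumeration is one-to-one, so finitely many gates have finitely many symbols and the
  -- machine has finitely many instructions.
  have hfin' : (U ⁻¹' 𝒢).Finite := hfin.preimage hU.injective.injOn
  let Gs := hfin'.toFinset.toList
  have hcirc : ∀ n, ∀ a ∈ K (h n), a.1 ∈ Gs ∧ a.2.length = (U a.1).arity ∧ a.2.Nodup ∧
      ∀ r ∈ a.2, r ∈ Finset.Icc 1 (f n) := fun n a ha =>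
    have h1 := (hfam.circuit n).1 a ha
    have h2 := (hfam.circuit n).2 a ha
    ⟨by simpa [Gs] using h2.1, h1.1, h1.2, h2.2⟩
  obtain ⟨c, hc⟩ := QCalc.exists_code_of_computable
    (QCalc.computable_program Gs hfam.computable_f hfam.computable_g hfam.computable_h hK.1)
  have hM := QCalc.ok_familyT (U := U) Gs c
  have heval : ∀ cs : List Bool, QCalc.EvaluatesTo U
      (QCalc.Term.app (QCalc.familyT U Gs c) (QCalc.Term.bits cs)) (QCalc.Term.qlist (f cs.length))
      (QCalc.circuitOp U (K (h cs.length))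
        (QCalc.ket (fun r => QCalc.inputBit cs (g (cs.length, (r : ℕ)))))) := fun cs =>
    QCalc.Run.evaluatesTo (b := fun r => QCalc.inputBit cs (g (cs.length, r)))
      (by simp [QCalc.Term.qvars, hM.2, QCalc.ok_bits cs true])
      (fun a ha => (hcirc _ a ha).2) (QCalc.run_familyT hc hfam.g_le hcirc cs)
  refine ⟨QCalc.familyT U Gs c,
    ⟨QCalc.wellFormed_of_ok hM.1 (QCalc.cnt_familyT Gs c) hM.2, fun cs => ⟨_, _, ?_, heval cs⟩⟩,
    fun cs m Q => ⟨fun hQ => ?_, ?_⟩⟩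
  · refine QCalc.isRegister_circuitOp (fun a ha => ?_) (QCalc.isRegister_ket _)
    rw [QCalc.qvars_qlist]
    exact (hcirc _ a ha).2
  · obtain ⟨h1, e1⟩ := hQ
    obtain ⟨h2, e2⟩ := heval cs
    have hgood : QCalc.Config.Good (Quotient.mk _
        ⟨∅, fun _ => 1, QCalc.Term.app (QCalc.familyT U Gs c) (QCalc.Term.bits cs), h1⟩) :=
      ⟨_, rfl, QCalc.good_familyT Gs c cs⟩
    -- By confluence any evaluation ends in the configuration already computed, and equal output
    -- configurations have equal length and register.
    obtain ⟨rfl, he⟩ := QCalc.ofTerm_qlist_inj (e1.unique hgood e2)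
    exact ⟨rfl, eq_of_heq he⟩
  · rintro ⟨rfl, rfl⟩
    exact heval cs
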